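/- Let $S^2=\mathbb{C}\cup\{\infty\}$ be the Riemann sphere, $K$ its canonical bundle, and let $\mathfrak{D}=p_1+p_2+p_3$ for three distinct points $p_1,p_2,p_3\in S^2$. Let $W\to S^2$ be a holomorphic vector bundle of rank $3$ and degree $0$, and let $\Phi\in H^0(S^2,K\otimes\mathfrak{sl}(W)\otimes\mathcal{O}(\mathfrak{D}))$ be a trace-free meromorphic $\operatorname{End}(W)$-valued $1$-form which is holomorphic away from $p_1,p_2,p_3$ and has at most simple poles at these points (that is, $(W,\Phi)$ is a parabolic Higgs bundle with trivial flags $W_{p_k}\supsetneq\{0\}$ and zero weights at the $p_k$; the residues of $\Phi$ need not be nilpotent). Assume that $(W,\Phi)$ is stable: every $\Phi$-invariant holomorphic subbundle $E\subset W$ with $0<\operatorname{rank}E<3$ has $\deg E<0$. Then, as a holomorphic vector bundle, $$W\cong\mathcal{O}\oplus\mathcal{O}\oplus\mathcal{O}\qquad\text{or}\qquad W\cong\mathcal{O}(-1)\oplus\mathcal{O}\oplus\mathcal{O}(1).$$ -/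

import Mathlib

open Bundle Set Filter Topology
open scoped Manifold ContDiff

/-! ### The Riemann sphere `S² = ℂ ∪ {∞}` -/

/-- The Riemann sphere, as the one-point compactification of `ℂ`. -/
abbrev RiemannSphere : Type := OnePoint ℂ

namespace RiemannSphere

/-- The affine coordinate `z`, with junk value `0` at `∞`. -/
noncomputable def coord (x : RiemannSphere) : ℂ := x.elim 0 id

/-- The coordinate `1 / z` around `∞`, with junk value `0` at `z = 0`. -/
noncomputable def invCoord (x : RiemannSphere) : ℂ := x.elim 0 (fun z => z⁻¹)

open Classical in
/-- The inverse of `invCoord`: `w ↦ 1 / w`, with `0 ↦ ∞`. -/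
noncomputable def ofInv (w : ℂ) : RiemannSphere :=
  if w = 0 then OnePoint.infty else ((w⁻¹ : ℂ) : RiemannSphere)

@[simp] lemma coord_coe (z : ℂ) : coord (z : RiemannSphere) = z := rfl

@[simp] lemma invCoord_coe (z : ℂ) : invCoord (z : RiemannSphere) = z⁻¹ := rfl

@[simp] lemma invCoord_infty : invCoord (OnePoint.infty : RiemannSphere) = 0 := rfl

@[simp] lemma ofInv_zero : ofInv 0 = OnePoint.infty := by simp [ofInv]

lemma ofInv_of_ne {w : ℂ} (h : w ≠ 0) : ofInv w = ((w⁻¹ : ℂ) : RiemannSphere) := by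
  simp [ofInv, h]

lemma continuousAt_invCoord {x : RiemannSphere} (hx : x ≠ ((0 : ℂ) : RiemannSphere)) :
    ContinuousAt invCoord x := by
  induction x using OnePoint.rec with
  | infty =>
    rw [OnePoint.continuousAt_infty', invCoord_infty]
    have h : Tendsto (fun z : ℂ => z⁻¹) (cocompact ℂ) (𝓝 0) := by
      rw [← Metric.cobounded_eq_cocompact]; exact tendsto_inv₀_cobounded
    rw [coclosedCompact_eq_cocompact]
    exact h
  | coe z =>
    have hz : z ≠ 0 := fun h => hx (by rw [h])
    rw [OnePoint.continuousAt_coe]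
    exact continuousAt_inv₀ hz

lemma continuous_ofInv : Continuous ofInv := by
  rw [continuous_iff_continuousAt]
  intro w
  by_cases hw : w = 0
  · subst hw
    rw [ContinuousAt, ofInv_zero, ← nhdsNE_sup_pure (0 : ℂ), tendsto_sup]
    constructor
    · have h : Tendsto (fun z : ℂ => z⁻¹) (𝓝[≠] 0) (coclosedCompact ℂ) := by
        rw [coclosedCompact_eq_cocompact, ← Metric.cobounded_eq_cocompact]
        exact tendsto_inv₀_nhdsNE_zero
      refine (OnePoint.tendsto_coe_infty.comp h).congr' ?_
      filter_upwards [self_mem_nhdsWithin] with z hz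
      exact (ofInv_of_ne hz).symm
    · rw [tendsto_pure_left]
      intro s hs
      rw [ofInv_zero]
      exact mem_of_mem_nhds hs
  · have h : ContinuousAt (fun z : ℂ => ((z⁻¹ : ℂ) : RiemannSphere)) w :=
      OnePoint.continuous_coe.continuousAt.comp (continuousAt_inv₀ hw)
    refine h.congr ?_
    filter_upwards [isOpen_ne.mem_nhds hw] with z hz
    exact (ofInv_of_ne hz).symm

/-- The affine chart `z : S² \ {∞} → ℂ`. -/
noncomputable def affineChart : OpenPartialHomeomorph RiemannSphere ℂ where
  toFun := coord
  invFun z := (z : RiemannSphere)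
  source := {OnePoint.infty}ᶜ
  target := univ
  map_source' _ _ := mem_univ _
  map_target' z _ := OnePoint.coe_ne_infty z
  left_inv' x hx := by
    induction x using OnePoint.rec with
    | infty => exact absurd rfl hx
    | coe z => rfl
  right_inv' _ _ := rfl
  open_source := OnePoint.isClosed_infty.isOpen_compl
  open_target := isOpen_univ
  continuousOn_toFun x hx := by
    induction x using OnePoint.rec with
    | infty => exact absurd rfl hx
    | coe z =>
      refine ContinuousAt.continuousWithinAt ?_
      rw [OnePoint.continuousAt_coe]
      exact continuousAt_id
  continuousOn_invFun := OnePoint.continuous_coe.continuousOn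

/-- The chart `1 / z : S² \ {0} → ℂ`. -/
noncomputable def inftyChart : OpenPartialHomeomorph RiemannSphere ℂ where
  toFun := invCoord
  invFun := ofInv
  source := {((0 : ℂ) : RiemannSphere)}ᶜ
  target := univ
  map_source' _ _ := mem_univ _
  map_target' w _ := by
    by_cases hw : w = 0
    · simp [hw]
    · simp [ofInv_of_ne hw, hw]
  left_inv' x hx := by
    induction x using OnePoint.rec with
    | infty => simp
    | coe z =>
      have hz : z ≠ 0 := fun h => hx (by rw [h]; rfl)
      rw [invCoord_coe, ofInv_of_ne (inv_ne_zero hz), inv_inv]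
  right_inv' w _ := by
    by_cases hw : w = 0
    · simp [hw]
    · simp [ofInv_of_ne hw]
  open_source := isClosed_singleton.isOpen_compl
  open_target := isOpen_univ
  continuousOn_toFun _ hx := (continuousAt_invCoord hx).continuousWithinAt
  continuousOn_invFun := continuous_ofInv.continuousOn

open Classical in
/-- The Riemann sphere as a one-dimensional complex manifold, with the two charts `z`, `1 / z`. -/
noncomputable instance : ChartedSpace ℂ RiemannSphere where
  atlas := {affineChart, inftyChart}
  chartAt x := if x = OnePoint.infty then inftyChart else affineChart
  mem_chart_source x := by
    by_cases hx : x = OnePoint.infty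
    · simp [hx, inftyChart]
    · simp [hx, affineChart]
  chart_mem_atlas x := by
    by_cases hx : x = OnePoint.infty <;> simp [hx]

instance : IsManifold 𝓘(ℂ) ω RiemannSphere := by
  have key : ∀ s : Set ℂ, (∀ z ∈ s, z ≠ 0) → ContDiffOn ℂ ω (fun z : ℂ => z⁻¹) s :=
    fun s hs z hz => (contDiffAt_inv ℂ (hs z hz)).contDiffWithinAt
  refine isManifold_of_contDiffOn _ _ _ ?_
  rintro e e' (rfl | rfl) (rfl | rfl)
  · refine contDiffOn_id.congr ?_
    rintro z -
    rfl
  · refine (key _ ?_).congr ?_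
    · rintro z ⟨hz, -⟩ rfl
      exact hz.2 rfl
    · rintro z -
      rfl
  · have h0 : ∀ z ∈ 𝓘(ℂ).symm ⁻¹' (inftyChart.symm ≫ₕ affineChart).source ∩ range 𝓘(ℂ),
        z ≠ 0 := by
      rintro z ⟨hz, -⟩ rfl
      simp [affineChart, inftyChart] at hz
    refine (key _ h0).congr ?_
    intro z hz
    change coord (ofInv z) = z⁻¹
    rw [ofInv_of_ne (h0 z hz), coord_coe]
  · refine contDiffOn_id.congr ?_
    rintro z -
    exact inftyChart.right_inv (mem_univ z)

/-! ### The line bundles `𝒪(n)` -/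

/-- `S² \ {∞}` for `false`, and `S² \ {0}` for `true`. -/
def patch : Bool → Set RiemannSphere
  | false => {OnePoint.infty}ᶜ
  | true => {((0 : ℂ) : RiemannSphere)}ᶜ

/-- The transition functions of `𝒪(n)`: a section is a pair of holomorphic functions, `f` on
`S² \ {∞}` and `g` on `S² \ {0}`, with `g = z⁻ⁿ f` on the overlap. -/
noncomputable def transition (n : ℤ) : Bool → Bool → RiemannSphere → ℂ
  | false, false, _ => 1
  | false, true, x => coord x ^ (-n)
  | true, false, x => coord x ^ n
  | true, true, _ => 1

lemma isOpen_patch (i : Bool) : IsOpen (patch i) := by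
  cases i
  · exact OnePoint.isClosed_infty.isOpen_compl
  · exact isClosed_singleton.isOpen_compl

lemma coord_ne_zero {x : RiemannSphere} (h : x ∈ patch false) (h' : x ∈ patch true) :
    coord x ≠ 0 := by
  induction x using OnePoint.rec with
  | infty => exact absurd rfl h
  | coe z => exact fun hz => h' (by rw [show z = 0 from hz]; rfl)

lemma contMDiffOn_coord : ContMDiffOn 𝓘(ℂ) 𝓘(ℂ) ω coord (patch false) :=
  contMDiffOn_of_mem_maximalAtlas
    (IsManifold.subset_maximalAtlas (show affineChart ∈ atlas ℂ RiemannSphere from Or.inl rfl))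

lemma contMDiffOn_coord_zpow (m : ℤ) :
    ContMDiffOn 𝓘(ℂ) 𝓘(ℂ) ω (fun x => coord x ^ m) (patch false ∩ patch true) := by
  intro x hx
  have h1 := contMDiffOn_coord.mono (inter_subset_left (t := patch true)) x hx
  have h2 : ContDiffAt ℂ ω (fun z : ℂ => z ^ m) (coord x) :=
    (analyticAt_id.zpow (coord_ne_zero hx.1 hx.2)).contDiffAt
  exact h2.contMDiffAt.comp_contMDiffWithinAt x h1

lemma contMDiffOn_transition (n : ℤ) (i j : Bool) :
    ContMDiffOn 𝓘(ℂ) 𝓘(ℂ) ω (transition n i j) (patch i ∩ patch j) := by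
  cases i <;> cases j
  · exact contMDiffOn_const
  · exact contMDiffOn_coord_zpow (-n)
  · rw [inter_comm]; exact contMDiffOn_coord_zpow n
  · exact contMDiffOn_const

lemma contMDiffOn_transition_smul (n : ℤ) (i j : Bool) :
    ContMDiffOn 𝓘(ℂ) 𝓘(ℂ, ℂ →L[ℂ] ℂ) ω
      (fun x => transition n i j x • ContinuousLinearMap.id ℂ ℂ) (patch i ∩ patch j) :=
  (contMDiffOn_transition n i j).smul contMDiffOn_const

/-- The holomorphic line bundle `𝒪(n)`, as a bundle core. -/
noncomputable def lineBundle (n : ℤ) : VectorBundleCore ℂ RiemannSphere ℂ Bool where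
  baseSet := patch
  isOpen_baseSet := isOpen_patch
  indexAt x := x.elim true (fun _ => false)
  mem_baseSet_at x := by
    induction x using OnePoint.rec with
    | infty => exact OnePoint.infty_ne_coe 0
    | coe z => exact OnePoint.coe_ne_infty z
  coordChange i j x := transition n i j x • ContinuousLinearMap.id ℂ ℂ
  coordChange_self i x _ v := by cases i <;> simp [transition]
  continuousOn_coordChange i j := (contMDiffOn_transition_smul n i j).continuousOn
  coordChange_comp i j k x hx v := by
    obtain ⟨⟨hi, hj⟩, hk⟩ := hx
    cases i <;> cases j <;> cases k <;> simp [transition]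
    · have h := coord_ne_zero hi hj
      field_simp
    · have h := coord_ne_zero hj hi
      field_simp

instance (n : ℤ) : (lineBundle n).IsContMDiff 𝓘(ℂ) ω where
  contMDiffOn_coordChange := contMDiffOn_transition_smul n

/-- The holomorphic line bundle `𝒪(n)` over the Riemann sphere (the family of its fibres). -/
def O (n : ℤ) (x : RiemannSphere) : Type := (lineBundle n).Fiber x

noncomputable section

variable (n : ℤ) (x : RiemannSphere)

instance : AddCommGroup (O n x) := inferInstanceAs (AddCommGroup ((lineBundle n).Fiber x))

instance : Module ℂ (O n x) := inferInstanceAs (Module ℂ ((lineBundle n).Fiber x))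

instance : TopologicalSpace (O n x) := inferInstanceAs (TopologicalSpace ((lineBundle n).Fiber x))

instance : TopologicalSpace (TotalSpace ℂ (O n)) :=
  inferInstanceAs (TopologicalSpace (TotalSpace ℂ (lineBundle n).Fiber))

instance : FiberBundle ℂ (O n) := inferInstanceAs (FiberBundle ℂ (lineBundle n).Fiber)

instance : VectorBundle ℂ ℂ (O n) := inferInstanceAs (VectorBundle ℂ ℂ (lineBundle n).Fiber)

instance : ContMDiffVectorBundle ω ℂ (O n) 𝓘(ℂ) :=
  inferInstanceAs (ContMDiffVectorBundle ω ℂ (lineBundle n).Fiber 𝓘(ℂ))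

end

/-- The direct sum `𝒪(a) ⊕ 𝒪(b) ⊕ 𝒪(c)`, with model fibre `ℂ × ℂ × ℂ`. -/
abbrev SumO (a b c : ℤ) : RiemannSphere → Type := O a ×ᵇ O b ×ᵇ O c

end RiemannSphere

/-! ### Holomorphic vector bundles and Higgs fields

A holomorphic vector bundle `W` over the Riemann sphere with model fibre `F` is a Mathlib vector
bundle with `ContMDiffVectorBundle ω F W 𝓘(ℂ)`: over `ℂ`, smoothness of order `ω` is
analyticity, that is, holomorphy. -/

/-- Two holomorphic vector bundles over the Riemann sphere are isomorphic. -/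
def HolomorphicallyIsomorphic
    (F₁ : Type*) [NormedAddCommGroup F₁] [NormedSpace ℂ F₁]
    (W₁ : RiemannSphere → Type*) [TopologicalSpace (TotalSpace F₁ W₁)]
    [∀ x, AddCommGroup (W₁ x)] [∀ x, Module ℂ (W₁ x)] [∀ x, TopologicalSpace (W₁ x)]
    [FiberBundle F₁ W₁]
    (F₂ : Type*) [NormedAddCommGroup F₂] [NormedSpace ℂ F₂]
    (W₂ : RiemannSphere → Type*) [TopologicalSpace (TotalSpace F₂ W₂)]
    [∀ x, AddCommGroup (W₂ x)] [∀ x, Module ℂ (W₂ x)] [∀ x, TopologicalSpace (W₂ x)]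
    [FiberBundle F₂ W₂] : Prop :=
  ∃ e : ∀ x, W₁ x ≃ₗ[ℂ] W₂ x,
    ContMDiff (𝓘(ℂ).prod 𝓘(ℂ, F₁)) (𝓘(ℂ).prod 𝓘(ℂ, F₂)) ω
      (fun v : TotalSpace F₁ W₁ => (⟨v.proj, e v.proj v.snd⟩ : TotalSpace F₂ W₂)) ∧
    ContMDiff (𝓘(ℂ).prod 𝓘(ℂ, F₂)) (𝓘(ℂ).prod 𝓘(ℂ, F₁)) ω
      (fun v : TotalSpace F₂ W₂ => (⟨v.proj, (e v.proj).symm v.snd⟩ : TotalSpace F₁ W₁))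

section Higgs

variable (F : Type*) [NormedAddCommGroup F] [NormedSpace ℂ F]
  (W : RiemannSphere → Type*) [TopologicalSpace (TotalSpace F W)]
  [∀ x, AddCommGroup (W x)] [∀ x, Module ℂ (W x)] [∀ x, TopologicalSpace (W x)]
  [FiberBundle F W]

/-- Sections `s₁, …, s_k` of `W` form a holomorphic frame over `U` of the family of subspaces
`E x ⊆ W x`. -/
structure IsHolomorphicFrameOn {k : ℕ} (E : ∀ x, Submodule ℂ (W x)) (U : Set RiemannSphere)
    (s : Fin k → ∀ x, W x) : Prop where
  holomorphic : ∀ i, ContMDiffOn 𝓘(ℂ) (𝓘(ℂ).prod 𝓘(ℂ, F)) ω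
    (fun x => TotalSpace.mk' F x (s i x)) U
  linearIndependent : ∀ x ∈ U, LinearIndependent ℂ (fun i => s i x)
  span_eq : ∀ x ∈ U, Submodule.span ℂ (range fun i => s i x) = E x

/-- `E ⊆ W` is a holomorphic subbundle of rank `k`: it has a holomorphic frame around each
point. -/
def IsHolomorphicSubbundle (k : ℕ) (E : ∀ x, Submodule ℂ (W x)) : Prop :=
  ∀ x, ∃ U : Set RiemannSphere, IsOpen U ∧ x ∈ U ∧
    ∃ s : Fin k → ∀ y, W y, IsHolomorphicFrameOn F W E U s

/-- The holomorphic subbundle `E ⊆ W` of rank `k` has degree `d`: the determinant bundle `Λᵏ E`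
has degree `d`, equivalently its dual has a meromorphic section `η`, not identically zero, whose
divisor has degree `-d`. A section of the dual of `Λᵏ E` is a family of alternating `k`-forms on
the spaces `E x`; here each form is written as a form on `W x`, of which only the restriction to
`E x` is used. The order `ν p` of `η` at `p` is the order of the function `η (s₁, …, s_k)`, for a
holomorphic frame `s` of `E` near `p`, in the chart at `p`. -/
def HasDegree (k : ℕ) (E : ∀ x, Submodule ℂ (W x)) (d : ℤ) : Prop :=
  ∃ (η : ∀ x, W x [⋀^Fin k]→ₗ[ℂ] ℂ) (ν : RiemannSphere →₀ ℤ),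
    (∀ p, ∃ U : Set RiemannSphere, IsOpen U ∧ p ∈ U ∧
      ∃ s : Fin k → ∀ y, W y, IsHolomorphicFrameOn F W E U s ∧
        MeromorphicAt (fun z => η ((chartAt ℂ p).symm z) fun i => s i ((chartAt ℂ p).symm z))
          (chartAt ℂ p p) ∧
        meromorphicOrderAt
          (fun z => η ((chartAt ℂ p).symm z) fun i => s i ((chartAt ℂ p).symm z))
          (chartAt ℂ p p) = (ν p : WithTop ℤ)) ∧
    d = -ν.sum fun _ m => m

variable [∀ x, IsTopologicalAddGroup (W x)] [∀ x, ContinuousSMul ℂ (W x)]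

/-- A family of linear maps `Φ x : T_x S² → End (W x)`, that is, a section of
`K ⊗ End(W)`; its values at the poles are irrelevant junk. -/
abbrev EndOneForm : Type _ :=
  ∀ x : RiemannSphere, TangentSpace 𝓘(ℂ) x →L[ℂ] W x →L[ℂ] W x

variable {W} in
/-- `E` is invariant under the Higgs field `Φ` with poles in `D`. -/
def IsInvariantSubbundle (D : Finset RiemannSphere) (Φ : EndOneForm W)
    (E : ∀ x, Submodule ℂ (W x)) : Prop :=
  ∀ x ∉ D, ∀ (v : TangentSpace 𝓘(ℂ) x), ∀ w ∈ E x, Φ x v w ∈ E x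

variable {W} in
/-- Stability of a degree-zero Higgs bundle with trivial flags and zero weights (so that the
parabolic degree is the degree): every `Φ`-invariant holomorphic subbundle, other than `0` and `W`,
has negative degree. -/
def IsStableHiggs (D : Finset RiemannSphere) (Φ : EndOneForm W) : Prop :=
  ∀ (k : ℕ) (E : ∀ x, Submodule ℂ (W x)) (d : ℤ), 0 < k → k < Module.finrank ℂ F →
    IsHolomorphicSubbundle F W k E → IsInvariantSubbundle D Φ E → HasDegree F W k E d → d < 0

variable [VectorBundle ℂ F W]

variable {W} in
/-- The section `Φ` of `K ⊗ End(W)` is holomorphic at the point `x`. -/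
def IsHolomorphicOneFormAt (Φ : EndOneForm W) (x : RiemannSphere) : Prop :=
  ContMDiffAt 𝓘(ℂ) (𝓘(ℂ).prod 𝓘(ℂ, ℂ →L[ℂ] F →L[ℂ] F)) ω
    (fun y => TotalSpace.mk' (ℂ →L[ℂ] F →L[ℂ] F)
      (E := fun y : RiemannSphere => TangentSpace 𝓘(ℂ) y →L[ℂ] W y →L[ℂ] W y) y (Φ y)) x

variable {W} in
/-- `Φ ∈ H⁰(S², K ⊗ sl(W) ⊗ 𝒪(D))`: a holomorphic one-form on the complement of `D` with values in
trace-free endomorphisms, with at most simple poles at the points of `D`. Trivial flags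
`W_p ⊋ 0` with weight `0` carry no data, and every residue preserves them. -/
structure IsParabolicHiggsField (D : Finset RiemannSphere) (Φ : EndOneForm W) : Prop where
  holomorphic : ∀ x ∉ D, IsHolomorphicOneFormAt F Φ x
  simple_pole : ∀ p ∈ D, ∃ Ψ : EndOneForm W, IsHolomorphicOneFormAt F Ψ p ∧
    ∀ᶠ y in 𝓝[≠] p, Ψ y = (chartAt ℂ p y - chartAt ℂ p p) • Φ y
  trace_free : ∀ x ∉ D, ∀ v : TangentSpace 𝓘(ℂ) x,
    LinearMap.trace ℂ (W x) (Φ x v : W x →ₗ[ℂ] W x) = 0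

end Higgs

/-! By the Birkhoff–Grothendieck theorem `W` is a sum of three line bundles. The code records it by
frames `s` on the plane and `t` at infinity with `t i = z ^ (-d i) • s i`, so the `i`-th summand is
𝒪(-d i). The component of `Φ` from summand `i` to summand `j` is a section of 𝒪(d i - d j) ⊗ K(𝔇) =
𝒪(d i - d j + 1), hence zero once `d i + 2 ≤ d j` (`coefficient_eq_zero`). Sort so that d₀ ≤ d₁ ≤
d₂, with sum 0. A gap of at least two would make the span of the summands before it a `Φ`-invariant
subbundle whose degree, by the ordering and the zero sum, is not negative; this contradicts
stability (`sum_pos_of_stable`). With both gaps at most one and sum zero, only (0, 0, 0) and (-1, 0,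
1) remain.

Most of the file proves the splitting (`exists_isSplittingFrame`). The analytic input is
`exists_holomorphic_section`: for each vector `v` there are a nonzero polynomial `p` and a section
over the plane asymptotic to `p • v` at infinity. Such sections come from gluing local data by
cutoffs and correcting by Cauchy transforms; the correction solves a Fredholm equation, and the
infinite-dimensional choice of `p` avoids its finite-dimensional obstruction.

This gives generically independent sections with pole orders at most `d i` at infinity. Among all
such systems take one with minimal ∑ d i. The minimum exists because a meromorphic function on the
sphere has degree zero, which bounds ∑ d i below by -deg W. If the sections were dependent at a
point of the plane, or their leading terms at infinity were dependent, one section could be replaced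
by another with a smaller bound. So a minimal system is a splitting frame, and two bundles with
frames of the same `d` are isomorphic. -/

/-! ### The Cauchy transform -/

section CauchyTransform

open MeasureTheory Complex

variable {F : Type*} [NormedAddCommGroup F] [NormedSpace ℂ F]

/-- The Wirtinger derivative `∂f / ∂z̄`. -/
noncomputable def dbar (f : ℂ → F) (z : ℂ) : F :=
  (1 / 2 : ℂ) • (fderiv ℝ f z 1 + I • fderiv ℝ f z I)

/-- The singularity has exponent 1, less than the real dimension 2 of the plane. -/
lemma locallyIntegrable_inv_complex : LocallyIntegrable (fun ζ : ℂ => ζ⁻¹) := by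
  refine locallyIntegrable_of_norm_le_rpow (C := 1) (α := 1) (by simp) (by simp) ?_
    measurable_inv.aestronglyMeasurable
  refine Eventually.of_forall fun x => ?_
  rw [norm_inv, one_mul, Real.rpow_neg_one]

lemma integrable_inv_smul {k : ℂ → F} (hk : Continuous k) (hc : HasCompactSupport k) :
    Integrable (fun ζ : ℂ => ζ⁻¹ • k ζ) :=
  locallyIntegrable_inv_complex.integrable_smul_right_of_hasCompactSupport hk hc

lemma integrableOn_of_continuous_polar {f : ℝ × ℝ → F} (hf : Continuous f) {R : ℝ}
    (hR : ∀ p : ℝ × ℝ, R < p.1 → f p = 0) :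
    IntegrableOn f (Ioi (0 : ℝ) ×ˢ Ioo (-Real.pi) Real.pi) := by
  have h : IntegrableOn f (Icc (0 : ℝ) R ×ˢ Icc (-Real.pi) Real.pi) :=
    hf.continuousOn.integrableOn_compact (isCompact_Icc.prod isCompact_Icc)
  refine h.of_forall_sdiff_eq_zero (measurableSet_Ioi.prod measurableSet_Ioo) ?_
  rintro ⟨r, t⟩ ⟨⟨hr, ht⟩, hn⟩
  refine hR _ (not_le.1 fun hle => hn ⟨⟨le_of_lt hr, hle⟩, Ioo_subset_Icc_self ht⟩)

lemma hasDerivAt_polar_radius (t r : ℝ) :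
    HasDerivAt (fun r : ℝ => (r : ℂ) * exp (t * I)) (exp (t * I)) r := by
  simpa using (ofRealCLM.hasDerivAt (x := r)).mul_const (exp (t * I))

lemma hasDerivAt_polar_angle (r t : ℝ) :
    HasDerivAt (fun t : ℝ => (r : ℂ) * exp (t * I)) (r • (I * exp (t * I))) t := by
  have h := (((ofRealCLM.hasDerivAt (x := t)).mul_const I).cexp).const_mul (r : ℂ)
  refine h.congr_deriv ?_
  simp [mul_comm]

/-- `1 / (π z)` is a fundamental solution of `∂ / ∂z̄`. -/
lemma integral_inv_smul_dbar [CompleteSpace F] {g : ℂ → F} (hg : ContDiff ℝ 1 g) (hc : HasCompactSupport g) :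
    ∫ ζ : ℂ, ζ⁻¹ • dbar g ζ = -(Real.pi : ℂ) • g 0 := by
  obtain ⟨R, hRpos, hR⟩ := hc.isCompact.isBounded.exists_pos_norm_le
  have hD : Continuous (fderiv ℝ g) := hg.continuous_fderiv one_ne_zero
  have hgR : ∀ z : ℂ, R < ‖z‖ → g z = 0 := fun z hz =>
    image_eq_zero_of_notMem_tsupport fun h => (hR z h).not_gt hz
  have hDR : ∀ z : ℂ, R < ‖z‖ → fderiv ℝ g z = 0 := fun z hz =>
    image_eq_zero_of_notMem_tsupport fun h =>
      (hR z (tsupport_fderiv_subset ℝ h)).not_gt hz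
  set P : ℝ × ℝ → ℂ := fun p => (p.1 : ℂ) * exp (p.2 * I) with hP
  have hPc : Continuous P := by fun_prop
  have hPn : ∀ p : ℝ × ℝ, R < p.1 → R < ‖P p‖ := fun p hp => by
    simp only [hP, norm_mul, norm_exp_ofReal_mul_I, mul_one, norm_real, Real.norm_eq_abs]
    exact hp.trans_le (le_abs_self _)
  set A : ℝ × ℝ → F := fun p => fderiv ℝ g (P p) (exp (p.2 * I)) with hA
  set B : ℝ × ℝ → F := fun p => fderiv ℝ g (P p) (I * exp (p.2 * I)) with hB
  have hAc : Continuous A := (hD.comp hPc).clm_apply (by fun_prop)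
  have hBc : Continuous B := (hD.comp hPc).clm_apply (by fun_prop)
  have hA0 : ∀ p : ℝ × ℝ, R < p.1 → A p = 0 := fun p hp => by simp [hA, hDR _ (hPn p hp)]
  have hB0 : ∀ p : ℝ × ℝ, R < p.1 → B p = 0 := fun p hp => by simp [hB, hDR _ (hPn p hp)]
  have hAi := integrableOn_of_continuous_polar hAc hA0
  have hBi := integrableOn_of_continuous_polar hBc hB0
  have hgd : ∀ z, HasFDerivAt g (fderiv ℝ g z) z := fun z =>
    (hg.differentiable one_ne_zero z).hasFDerivAt
  -- In polar coordinates ∂̄ = ½ e^{it} (∂_r + (i/r) ∂_t). The Jacobian `r` and the factor 1/ζ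
  -- cancel `e^{it}`, leaving `A = ∂_r g` and `B = (1/r) ∂_t g`.
  have key : ∀ p ∈ polarCoord.target,
      p.1 • ((Complex.polarCoord.symm p)⁻¹ • dbar g (Complex.polarCoord.symm p)) =
        (1 / 2 : ℂ) • (A p + I • B p) := by
    rintro ⟨r, t⟩ ⟨hr, -⟩
    have hr' : (r : ℂ) ≠ 0 := by exact_mod_cast (ne_of_gt hr : r ≠ 0)
    have hs : Complex.polarCoord.symm (r, t) = P (r, t) := by
      rw [Complex.polarCoord_symm_apply, hP]
      simp [exp_mul_I]
    rw [hs]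
    have hlin : ∀ w : ℂ, fderiv ℝ g (P (r, t)) w =
        w.re • fderiv ℝ g (P (r, t)) 1 + w.im • fderiv ℝ g (P (r, t)) I := fun w => by
      conv_lhs => rw [show w = w.re • (1 : ℂ) + w.im • I by simp [re_add_im]]
      rw [map_add, map_smul, map_smul]
    simp only [hA, hB, dbar]
    rw [hlin (exp _), hlin (I * exp _)]
    have e1 : (exp (t * I)).re = Real.cos t := exp_ofReal_mul_I_re t
    have e2 : (exp (t * I)).im = Real.sin t := exp_ofReal_mul_I_im t
    have e3 : (I * exp (t * I)).re = -Real.sin t := by simp [e2]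
    have e4 : (I * exp (t * I)).im = Real.cos t := by simp [e1]
    rw [e1, e2, e3, e4]
    have e5 : (P (r, t))⁻¹ = (r : ℂ)⁻¹ * (Real.cos t - Real.sin t * I) := by
      simp only [hP, mul_inv, ← exp_neg]
      rw [show -(t * I : ℂ) = ((-t : ℝ) : ℂ) * I by push_cast; ring, exp_mul_I]
      simp [sub_eq_add_neg]
    rw [e5]
    generalize fderiv ℝ g (P (r, t)) 1 = a
    generalize fderiv ℝ g (P (r, t)) I = b
    simp only [← coe_smul (E := F), smul_add, smul_smul]
    match_scalars
    · field_simp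
      ring
    · field_simp
      ring_nf
      simp
  rw [← Complex.integral_comp_polarCoord_symm, setIntegral_congr_fun
    (by exact (isOpen_Ioi.prod isOpen_Ioo).measurableSet) key]
  -- Along each ray the integral of ∂_r g is `-g 0`, since `g` vanishes far away.
  have hIA : ∫ p in polarCoord.target, A p = -(2 * Real.pi : ℝ) • g 0 := by
    change ∫ p in Ioi (0 : ℝ) ×ˢ Ioo (-Real.pi) Real.pi, A p ∂(volume.prod volume) = _
    rw [← setIntegral_prod_swap, setIntegral_prod]
    · have : ∀ t : ℝ, ∫ r in Ioi (0 : ℝ), A (Prod.swap (t, r)) = -g 0 := by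
        intro t
        have hd : ∀ r ∈ Ici (0 : ℝ), HasDerivAt (fun r : ℝ => g (P (r, t)))
            (A (Prod.swap (t, r))) r := fun r _ =>
          (hgd _).comp_hasDerivAt r (hasDerivAt_polar_radius t r)
        have hi : IntegrableOn (fun r => A (Prod.swap (t, r))) (Ioi (0 : ℝ)) := by
          have hcont : Continuous fun r : ℝ => A (Prod.swap (t, r)) := by fun_prop
          refine (hcont.continuousOn.integrableOn_compact
            (isCompact_Icc (a := (0 : ℝ)) (b := R))).of_forall_sdiff_eq_zero measurableSet_Ioi ?_
          rintro r ⟨hr, hn⟩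
          exact hA0 _ (not_le.1 fun hle => hn ⟨le_of_lt hr, hle⟩)
        rw [integral_Ioi_of_hasDerivAt_of_tendsto' hd hi (m := 0)]
        · simp [hP]
        · refine tendsto_const_nhds.congr' ?_
          filter_upwards [eventually_gt_atTop R] with r hr
          exact (hgR _ (hPn (r, t) hr)).symm
      simp only [this]
      rw [setIntegral_const]
      simp [Real.volume_real_Ioo_of_le (by linarith [Real.pi_pos] : -Real.pi ≤ Real.pi)]
      ring_nf
    · have := hAi.swap
      exact this
  -- Along each circle an angular derivative is integrated over a full period.
  have hIB : ∫ p in polarCoord.target, B p = 0 := by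
    change ∫ p in Ioi (0 : ℝ) ×ˢ Ioo (-Real.pi) Real.pi, B p ∂(volume.prod volume) = _
    rw [setIntegral_prod _ hBi, setIntegral_congr_fun (g := fun _ => (0 : F)) measurableSet_Ioi]
    · simp
    · intro r hr
      have h1 : ∫ t in (-Real.pi)..Real.pi, r • B (r, t) = 0 := by
        rw [intervalIntegral.integral_eq_sub_of_hasDerivAt (f := fun t : ℝ => g (P (r, t)))]
        · simp [hP, exp_neg, exp_pi_mul_I]
        · intro t _
          refine ((hgd _).comp_hasDerivAt t (hasDerivAt_polar_angle r t)).congr_deriv ?_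
          rw [map_smul]
        · exact ((hBc.comp (by fun_prop : Continuous fun t : ℝ => (r, t))).const_smul r
            ).intervalIntegrable _ _
      rw [intervalIntegral.integral_smul, smul_eq_zero] at h1
      have h2 := h1.resolve_left (ne_of_gt hr)
      rw [intervalIntegral.integral_of_le (by linarith [Real.pi_pos]), integral_Ioc_eq_integral_Ioo]
        at h2
      exact h2
  have hsum : ∫ p in polarCoord.target, (A p + I • B p) =
      (∫ p in polarCoord.target, A p) + ∫ p in polarCoord.target, I • B p :=
    integral_add hAi (hBi.smul I)
  rw [integral_smul, hsum, integral_smul, hIA, hIB, smul_zero, add_zero,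
    ← coe_smul, smul_smul]
  congr 1
  push_cast
  ring

/-- The integral `∫_A h(ζ) / (z - ζ)` over the plane. -/
noncomputable def cauchyIntegralOn (A : Set ℂ) (h : ℂ → F) (z : ℂ) : F :=
  ∫ ζ in A, (z - ζ)⁻¹ • h ζ

/-- Near a point off `A` the distance to `A` is bounded below, which dominates the kernel and its
derivative in `z`. -/
lemma differentiableOn_cauchyIntegralOn [CompleteSpace F] {A : Set ℂ} (hA : IsCompact A)
    {h : ℂ → F} (hh : Continuous h) : DifferentiableOn ℂ (cauchyIntegralOn A h) Aᶜ := by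
  intro z₀ hz₀
  obtain ⟨δ, hδ, hball⟩ := Metric.isOpen_iff.1 hA.isClosed.isOpen_compl z₀ hz₀
  have hfar : ∀ z ∈ Metric.ball z₀ (δ / 2), ∀ ζ ∈ A, δ / 2 ≤ ‖z - ζ‖ := by
    intro z hz ζ hζ
    have h1 : δ ≤ dist ζ z₀ := not_lt.1 fun hlt => hball hlt hζ
    have h2 : dist z z₀ < δ / 2 := hz
    have h3 := dist_triangle ζ z z₀
    rw [← dist_eq_norm, dist_comm]
    linarith
  have hne : ∀ z ∈ Metric.ball z₀ (δ / 2), ∀ ζ ∈ A, z - ζ ≠ 0 := fun z hz ζ hζ h0 => by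
    have := hfar z hz ζ hζ
    rw [h0, norm_zero] at this
    linarith
  have hcont : ∀ z ∈ Metric.ball z₀ (δ / 2), ContinuousOn (fun ζ => (z - ζ)⁻¹ • h ζ) A :=
    fun z hz => ((continuousOn_const.sub continuousOn_id).inv₀ (hne z hz)).smul hh.continuousOn
  have hz₀' : z₀ ∈ Metric.ball z₀ (δ / 2) := Metric.mem_ball_self (by positivity)
  have hnhds : Metric.ball z₀ (δ / 2) ∈ 𝓝 z₀ := Metric.ball_mem_nhds z₀ (by positivity)
  have hmeas : ∀ᶠ z in 𝓝 z₀, AEStronglyMeasurable (fun ζ => (z - ζ)⁻¹ • h ζ)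
      (volume.restrict A) := by
    filter_upwards [hnhds] with z hz
    exact (hcont z hz).aestronglyMeasurable hA.measurableSet
  have hint : Integrable (fun ζ => (z₀ - ζ)⁻¹ • h ζ) (volume.restrict A) :=
    (hcont z₀ hz₀').integrableOn_compact hA
  have hmeas' : AEStronglyMeasurable (fun ζ => (-((z₀ - ζ) ^ 2)⁻¹) • h ζ)
      (volume.restrict A) := by
    refine ContinuousOn.aestronglyMeasurable ?_ hA.measurableSet
    exact (((continuousOn_const.sub continuousOn_id).pow 2).inv₀
      (fun ζ hζ => pow_ne_zero 2 (hne z₀ hz₀' ζ hζ))).neg.smul hh.continuousOn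
  have hbound : ∀ᵐ ζ ∂(volume.restrict A), ∀ z ∈ Metric.ball z₀ (δ / 2),
      ‖(-((z - ζ) ^ 2)⁻¹) • h ζ‖ ≤ ((δ / 2) ^ 2)⁻¹ * ‖h ζ‖ := by
    refine (ae_restrict_iff' hA.measurableSet).2 (Eventually.of_forall fun ζ hζ z hz => ?_)
    rw [norm_smul, norm_neg, norm_inv, norm_pow]
    have := hfar z hz ζ hζ
    gcongr
  have hbi : Integrable (fun ζ => ((δ / 2) ^ 2)⁻¹ * ‖h ζ‖) (volume.restrict A) :=
    (continuous_const.mul hh.norm).continuousOn.integrableOn_compact hA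
  have hderiv : ∀ᵐ ζ ∂(volume.restrict A), ∀ z ∈ Metric.ball z₀ (δ / 2),
      HasDerivAt (fun z => (z - ζ)⁻¹ • h ζ) ((-((z - ζ) ^ 2)⁻¹) • h ζ) z := by
    refine (ae_restrict_iff' hA.measurableSet).2 (Eventually.of_forall fun ζ hζ z hz => ?_)
    have h1 : HasDerivAt (fun z : ℂ => (z - ζ)⁻¹) (-((z - ζ) ^ 2)⁻¹) z := by
      have := ((hasDerivAt_id z).sub_const ζ).inv (hne z hz ζ hζ)
      refine this.congr_deriv ?_
      simp [div_eq_mul_inv]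
    exact h1.smul_const _
  have key := hasDerivAt_integral_of_dominated_loc_of_deriv_le hnhds hmeas hint hmeas' hbound hbi
    hderiv
  exact key.2.differentiableAt.differentiableWithinAt

/-- The kernel is at most 1 / (|z| - R) when `A` lies in the disc of radius `R`. This decay keeps
the correction from disturbing the polynomial asymptotics at infinity. -/
lemma tendsto_cauchyIntegralOn {A : Set ℂ} (hA : IsCompact A) {h : ℂ → F} {C : ℝ}
    (hC : ∀ ζ, ‖h ζ‖ ≤ C) : Tendsto (cauchyIntegralOn A h) (cocompact ℂ) (𝓝 0) := by
  obtain ⟨R, hRpos, hR⟩ := hA.isBounded.exists_pos_norm_le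
  have hC0 : 0 ≤ C := (norm_nonneg _).trans (hC 0)
  have hlim : Tendsto (fun z : ℂ => (‖z‖ - R)⁻¹ * C * volume.real A) (cocompact ℂ) (𝓝 0) := by
    have h1 : Tendsto (fun z : ℂ => ‖z‖ - R) (cocompact ℂ) atTop :=
      tendsto_atTop_add_const_right _ _ (tendsto_norm_cocompact_atTop)
    simpa using (h1.inv_tendsto_atTop.mul_const C).mul_const (volume.real A)
  refine squeeze_zero_norm' ?_ hlim
  filter_upwards [tendsto_norm_cocompact_atTop.eventually_gt_atTop R] with z hz
  refine norm_setIntegral_le_of_norm_le_const hA.measure_lt_top fun ζ hζ => ?_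
  rw [norm_smul, norm_inv]
  have h2 : ‖z‖ - R ≤ ‖z - ζ‖ := (sub_le_sub_left (hR ζ hζ) _).trans (norm_sub_norm_le z ζ)
  have h3 : 0 < ‖z‖ - R := sub_pos.2 hz
  gcongr
  exact hC ζ

/-- As a convolution over the whole plane, the transform can be differentiated by letting the
derivative fall on `h`. -/
lemma cauchyIntegralOn_eq {A : Set ℂ} {h : ℂ → F} (h0 : ∀ ζ ∉ A, h ζ = 0) :
    cauchyIntegralOn A h = fun z => ∫ ζ : ℂ, ζ⁻¹ • h (z - ζ) := by
  funext z
  rw [cauchyIntegralOn, setIntegral_eq_integral_of_forall_compl_eq_zero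
    (fun ζ hζ => by rw [h0 ζ hζ, smul_zero]), ← integral_sub_left_eq_self _ volume z]
  simp

lemma hasFDerivAt_cauchyIntegral [CompleteSpace F] {h : ℂ → F} (hh : ContDiff ℝ 1 h)
    (hc : HasCompactSupport h) (z : ℂ) :
    ∃ L : ℂ →L[ℝ] F, HasFDerivAt (fun z => ∫ ζ : ℂ, ζ⁻¹ • h (z - ζ)) L z ∧
      ∀ v, L v = ∫ ζ : ℂ, ζ⁻¹ • fderiv ℝ h (z - ζ) v := by
  refine ⟨_, hc.hasFDerivAt_convolution_right
    (ContinuousLinearMap.lsmul ℝ ℂ : ℂ →L[ℝ] F →L[ℝ] F) locallyIntegrable_inv_complex hh z,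
    fun v => ?_⟩
  rw [convolution_precompR_apply _ locallyIntegrable_inv_complex (hc.fderiv ℝ)
    (hh.continuous_fderiv one_ne_zero)]
  rfl

lemma differentiable_cauchyIntegralOn [CompleteSpace F] {A : Set ℂ} {h : ℂ → F}
    (h0 : ∀ ζ ∉ A, h ζ = 0) (hh : ContDiff ℝ 1 h) (hc : HasCompactSupport h) :
    Differentiable ℝ (cauchyIntegralOn A h) := fun z => by
  obtain ⟨L, hL, -⟩ := hasFDerivAt_cauchyIntegral hh hc z
  rw [cauchyIntegralOn_eq h0]
  exact hL.differentiableAt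

/-- This is `integral_inv_smul_dbar` for ζ ↦ h (z - ζ); the reflection cancels the minus sign there.
-/
lemma dbar_cauchyIntegralOn [CompleteSpace F] {A : Set ℂ} {h : ℂ → F}
    (h0 : ∀ ζ ∉ A, h ζ = 0) (hh : ContDiff ℝ 1 h) (hc : HasCompactSupport h) (z : ℂ) :
    dbar (cauchyIntegralOn A h) z = (Real.pi : ℂ) • h z := by
  obtain ⟨L, hL, hLv⟩ := hasFDerivAt_cauchyIntegral hh hc z
  have hg : ContDiff ℝ 1 fun ζ => h (z - ζ) := hh.comp (contDiff_const.sub contDiff_id)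
  have hgc : HasCompactSupport fun ζ => h (z - ζ) :=
    hc.comp_homeomorph (Homeomorph.subLeft z)
  have hint : ∀ v, Integrable fun ζ : ℂ => ζ⁻¹ • fderiv ℝ h (z - ζ) v := fun v =>
    integrable_inv_smul (((hh.continuous_fderiv one_ne_zero).comp (by fun_prop)).clm_apply
      continuous_const) (((hc.fderiv_apply ℝ v).comp_homeomorph (Homeomorph.subLeft z)))
  have hd : ∀ ζ, fderiv ℝ (fun ζ => h (z - ζ)) ζ = -fderiv ℝ h (z - ζ) := fun ζ => by
    have h1 := ((hh.differentiable one_ne_zero (z - ζ)).hasFDerivAt).comp ζ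
      ((hasFDerivAt_const z ζ).sub (hasFDerivAt_id ζ))
    rw [show (fun ζ => h (z - ζ)) = h ∘ fun ζ => z - ζ from rfl]
    refine h1.fderiv.trans ?_
    ext v
    simp
  have hP := integral_inv_smul_dbar hg hgc
  rw [sub_zero] at hP
  rw [cauchyIntegralOn_eq h0, dbar, hL.fderiv, hLv, hLv, ← neg_inj, ← neg_smul ((Real.pi : ℂ)), ← hP,
    ← integral_smul, ← integral_add (hint 1) (by exact (hint I).smul I), ← integral_smul,
    ← integral_neg]
  congr 1
  funext ζ
  simp only [dbar, hd, neg_apply]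
  module

end CauchyTransform

/-! ### Finite codimension of the range of a compact perturbation of the identity -/

section Fredholm

open MeasureTheory BoundedContinuousFunction

/-- If `K` is a sum of an operator of norm less than one and one of finite rank, then an
infinite-dimensional space of right hand sides contains a nonzero one for which
`h + K h` can be solved. -/
lemma exists_add_apply_eq_of_norm_lt_one {X E V : Type*} [NormedAddCommGroup X] [NormedSpace ℂ X]
    [CompleteSpace X] [AddCommGroup E] [Module ℂ E] [AddCommGroup V] [Module ℂ V]
    [FiniteDimensional ℂ V] (hE : ¬ FiniteDimensional ℂ E) (K R : X →L[ℂ] X) (hK : ‖K - R‖ < 1)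
    (P : X →ₗ[ℂ] V) (hP : ∀ x, P x = 0 → R x = 0) (L : E →ₗ[ℂ] X) :
    ∃ p : E, p ≠ 0 ∧ ∃ h : X, h + K h = L p := by
  -- By the Neumann series `u = 1 + (K - R)` is invertible, and `1 + K = u + R`. Choosing `p ≠ 0` in
  -- the kernel of `P ∘ u⁻¹ ∘ L`, a map into a finite-dimensional space, kills the `R` term at `h =
  -- u⁻¹ (L p)`.
  obtain ⟨u, hu⟩ := isUnit_one_sub_of_norm_lt_one (x := -(K - R)) (by rwa [norm_neg])
  have hinj : ¬ Function.Injective (P ∘ₗ ((u⁻¹ : (X →L[ℂ] X)ˣ) : X →L[ℂ] X).toLinearMap ∘ₗ L) :=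
    fun hi => hE (FiniteDimensional.of_injective _ hi)
  rw [← LinearMap.ker_eq_bot, Submodule.eq_bot_iff] at hinj
  push Not at hinj
  obtain ⟨p, hp, hp0⟩ := hinj
  refine ⟨p, hp0, ((u⁻¹ : (X →L[ℂ] X)ˣ) : X →L[ℂ] X) (L p), ?_⟩
  have h1 : (u : X →L[ℂ] X) (((u⁻¹ : (X →L[ℂ] X)ˣ) : X →L[ℂ] X) (L p)) = L p := by
    rw [← mul_apply_eq_comp, Units.mul_inv, one_apply_eq_self]
  have h2 : R (((u⁻¹ : (X →L[ℂ] X)ˣ) : X →L[ℂ] X) (L p)) = 0 := hP _ hp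
  rw [hu] at h1
  rw [sub_neg_eq_add] at h1
  change _ + (K _ - R _) = _ at h1
  rwa [h2, sub_zero] at h1

variable {V : Type*} [NormedAddCommGroup V] [NormedSpace ℂ V]

/-- A function with values in a fine net of a compact set. -/
lemma exists_simpleFunc_dist_lt {A : Set ℂ} (hA : IsCompact A) (hne : A.Nonempty) {ε : ℝ}
    (hε : 0 < ε) : ∃ r : SimpleFunc ℂ ℂ, (∀ ζ, r ζ ∈ A) ∧ ∀ ζ ∈ A, dist (r ζ) ζ < ε := by
  have : Nonempty A := hne.to_subtype
  obtain ⟨e, he⟩ := TopologicalSpace.exists_dense_seq A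
  have hcov : A ⊆ ⋃ n, ⋃ k ≤ n, Metric.ball ((e k : A) : ℂ) ε := by
    intro ζ hζ
    obtain ⟨k, hk⟩ := he.exists_dist_lt ⟨ζ, hζ⟩ hε
    exact mem_iUnion.2 ⟨k, mem_iUnion₂.2 ⟨k, le_rfl, by simpa [Subtype.dist_eq] using hk⟩⟩
  obtain ⟨N, hN⟩ := hA.elim_directed_cover (fun n => ⋃ k ≤ n, Metric.ball ((e k : A) : ℂ) ε)
    (fun n => isOpen_biUnion fun _ _ => Metric.isOpen_ball) hcov
    (Monotone.directed_le fun m n hmn => biUnion_mono (fun k hk => le_trans hk hmn)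
      fun _ _ => le_rfl)
  refine ⟨SimpleFunc.nearestPt (fun n => ((e n : A) : ℂ)) N, fun ζ => ?_, fun ζ hζ => ?_⟩
  · rw [SimpleFunc.nearestPt, SimpleFunc.map_apply]
    exact (e _).2
  · obtain ⟨k, hk, hkζ⟩ := mem_iUnion₂.1 (hN hζ)
    have h1 := SimpleFunc.edist_nearestPt_le (fun n => ((e n : A) : ℂ)) ζ hk
    rw [edist_dist, edist_dist, ENNReal.ofReal_le_ofReal_iff dist_nonneg] at h1
    exact h1.trans_lt (by rwa [dist_comm, ← Metric.mem_ball])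

/-- The hypotheses under which `h ↦ M(z) ∫_A k(z, ζ) h(ζ)` is an operator on bounded continuous
functions. -/
structure IsKernel (M : ℂ → V →L[ℂ] V) (A : Set ℂ) (k : ℂ → ℂ → ℂ) (C : ℝ) : Prop where
  compact : IsCompact A
  continuous : Continuous M
  compactSupport : HasCompactSupport M
  nonneg : 0 ≤ C
  measurable : ∀ z ∈ tsupport M, AEStronglyMeasurable (k z) (volume.restrict A)
  bound : ∀ z ∈ tsupport M, ∀ ζ ∈ A, ‖k z ζ‖ ≤ C
  continuousOn : ∀ ζ ∈ A, ContinuousOn (fun z => k z ζ) (tsupport M)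

namespace IsKernel

variable {M : ℂ → V →L[ℂ] V} {A : Set ℂ} {k k' : ℂ → ℂ → ℂ} {C C' : ℝ}

lemma integrableOn (hk : IsKernel M A k C) {z : ℂ} (hz : z ∈ tsupport M) (h : ℂ →ᵇ V) :
    IntegrableOn (fun ζ => k z ζ • h ζ) A := by
  refine IntegrableOn.of_bound hk.compact.measure_lt_top
    ((hk.measurable z hz).smul h.continuous.aestronglyMeasurable) (C * ‖h‖) ?_
  refine (ae_restrict_iff' hk.compact.measurableSet).2 (Eventually.of_forall fun ζ hζ => ?_)
  rw [norm_smul]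
  exact mul_le_mul (hk.bound z hz ζ hζ) (h.norm_coe_le_norm ζ) (norm_nonneg _) hk.nonneg

lemma norm_integral_le (hk : IsKernel M A k C) {z : ℂ} (hz : z ∈ tsupport M) (h : ℂ →ᵇ V) :
    ‖∫ ζ in A, k z ζ • h ζ‖ ≤ C * volume.real A * ‖h‖ := by
  refine (norm_setIntegral_le_of_norm_le_const (C := C * ‖h‖) hk.compact.measure_lt_top
    fun ζ hζ => ?_).trans_eq (by ring)
  rw [norm_smul]
  exact mul_le_mul (hk.bound z hz ζ hζ) (h.norm_coe_le_norm ζ) (norm_nonneg _) hk.nonneg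

lemma apply_eq_zero {z : ℂ} (hz : z ∉ tsupport M) (v : V) : M z v = 0 := by
  rw [image_eq_zero_of_notMem_tsupport hz, zero_apply]

/-- The kernel is controlled only for `z` in the support of `M`. The plane is the union of this
closed set and the closure of its complement, where `M` is zero by continuity. -/
lemma continuous_apply_integral (hk : IsKernel M A k C) (h : ℂ →ᵇ V) :
    Continuous fun z => M z (∫ ζ in A, k z ζ • h ζ) := by
  have h1 : ContinuousOn (fun z => M z (∫ ζ in A, k z ζ • h ζ)) (tsupport M) := by
    refine hk.continuous.continuousOn.clm_apply ?_
    refine continuousOn_of_dominated (bound := fun _ => C * ‖h‖)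
      (fun z hz => (hk.integrableOn hz h).aestronglyMeasurable) (fun z hz => ?_) ?_ ?_
    · refine (ae_restrict_iff' hk.compact.measurableSet).2 (Eventually.of_forall fun ζ hζ => ?_)
      rw [norm_smul]
      exact mul_le_mul (hk.bound z hz ζ hζ) (h.norm_coe_le_norm ζ) (norm_nonneg _) hk.nonneg
    · exact integrableOn_const hk.compact.measure_lt_top.ne
    · refine (ae_restrict_iff' hk.compact.measurableSet).2 (Eventually.of_forall fun ζ hζ => ?_)
      exact (hk.continuousOn ζ hζ).smul continuousOn_const
  have h2 : ContinuousOn (fun z => M z (∫ ζ in A, k z ζ • h ζ)) (closure (tsupport M)ᶜ) := by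
    refine (continuousOn_const (c := (0 : V))).congr fun z hz => ?_
    have : M z = 0 := by
      have hcl : closure (tsupport M)ᶜ ⊆ {z | M z = 0} :=
        closure_minimal (fun z hz => image_eq_zero_of_notMem_tsupport hz)
          (isClosed_eq hk.continuous continuous_const)
      exact hcl hz
    rw [this, zero_apply]
  rw [← continuousOn_univ]
  refine (h1.union_of_isClosed h2 (isClosed_tsupport M) isClosed_closure).mono fun z _ => ?_
  by_cases hz : z ∈ tsupport M
  · exact Or.inl hz
  · exact Or.inr (subset_closure hz)

lemma norm_apply_integral_le (hk : IsKernel M A k C) {B : ℝ} (hB : ∀ z, ‖M z‖ ≤ B) (h : ℂ →ᵇ V)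
    (z : ℂ) : ‖M z (∫ ζ in A, k z ζ • h ζ)‖ ≤ B * (C * volume.real A) * ‖h‖ := by
  have hB0 : 0 ≤ B := (norm_nonneg _).trans (hB 0)
  by_cases hz : z ∈ tsupport M
  · refine (ContinuousLinearMap.le_of_opNorm_le _ (hB z) _).trans ?_
    rw [mul_assoc]
    exact mul_le_mul_of_nonneg_left (hk.norm_integral_le hz h) hB0
  · rw [apply_eq_zero hz, norm_zero]
    have := hk.nonneg
    positivity

lemma exists_operator (hk : IsKernel M A k C) :
    ∃ K : (ℂ →ᵇ V) →L[ℂ] (ℂ →ᵇ V), ∀ h z, K h z = M z (∫ ζ in A, k z ζ • h ζ) := by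
  obtain ⟨B, hB⟩ := hk.compactSupport.exists_bound_of_continuous hk.continuous
  refine ⟨LinearMap.mkContinuous
    { toFun := fun h => BoundedContinuousFunction.ofNormedAddCommGroup _
        (hk.continuous_apply_integral h) _ (hk.norm_apply_integral_le hB h)
      map_add' := fun h h' => ?_
      map_smul' := fun c h => ?_ } (B * (C * volume.real A)) fun h => ?_, fun h z => rfl⟩
  · ext z
    change M z _ = M z _ + M z _
    by_cases hz : z ∈ tsupport M
    · rw [← map_add, ← integral_add (hk.integrableOn hz h) (hk.integrableOn hz h')]
      simp
    · simp [apply_eq_zero hz]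
  · ext z
    change M z _ = c • M z _
    rw [← map_smul, ← integral_smul]
    simp [smul_comm c]
  · refine BoundedContinuousFunction.norm_ofNormedAddCommGroup_le _ ?_
      (hk.norm_apply_integral_le hB h)
    have := hk.nonneg
    have hB0 : 0 ≤ B := (norm_nonneg _).trans (hB 0)
    positivity

/-- Rounding the second variable of a continuous kernel. -/
lemma exists_finite_rank_approx (hk : IsKernel M A k C)
    (hcont : ContinuousOn (Function.uncurry k) (tsupport M ×ˢ A))
    {K : (ℂ →ᵇ V) →L[ℂ] (ℂ →ᵇ V)} (hK : ∀ h z, K h z = M z (∫ ζ in A, k z ζ • h ζ))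
    {ε : ℝ} (hε : 0 < ε) :
    ∃ (R : (ℂ →ᵇ V) →L[ℂ] (ℂ →ᵇ V)) (s : Finset ℂ) (P : (ℂ →ᵇ V) →ₗ[ℂ] (s → V)),
      ‖K - R‖ ≤ ε ∧ ∀ h, P h = 0 → R h = 0 := by
  rcases A.eq_empty_or_nonempty with rfl | hne
  · refine ⟨0, ∅, 0, ?_, fun _ _ => rfl⟩
    have : K = 0 := by ext h z; simp [hK]
    simp [this, hε.le]
  obtain ⟨B, hB⟩ := hk.compactSupport.exists_bound_of_continuous hk.continuous
  have hB0 : 0 ≤ B := (norm_nonneg _).trans (hB 0)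
  -- An error δ in the kernel costs at most `B * δ * vol A ≤ ε` in operator norm; the `+ 1` keeps
  -- the denominator positive.
  set δ : ℝ := ε / (B * volume.real A + 1) with hδ
  have hδ0 : 0 < δ := by positivity
  have huc := (hk.compactSupport.isCompact.prod hk.compact).uniformContinuousOn_of_continuous hcont
  obtain ⟨η, hη, hclose⟩ := Metric.uniformContinuousOn_iff.1 huc δ hδ0
  obtain ⟨r, hrA, hr⟩ := exists_simpleFunc_dist_lt hk.compact hne hη
  -- After rounding, the operator sees `h` only through its integrals over the finitely many cells
  -- of `r`; these integrals form `P`.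
  have hk' : IsKernel M A (fun z ζ => k z (r ζ)) C :=
    { hk with
      measurable := fun z _ => (r.map (k z)).measurable.aestronglyMeasurable
      bound := fun z hz ζ _ => hk.bound z hz _ (hrA ζ)
      continuousOn := fun ζ _ => hk.continuousOn _ (hrA ζ) }
  obtain ⟨R, hR⟩ := hk'.exists_operator
  have hfi : ∀ (y : ℂ) (h : ℂ →ᵇ V), IntegrableOn (fun ζ => h ζ) (A ∩ r ⁻¹' {y}) := fun y h =>
    (h.continuous.continuousOn.integrableOn_compact hk.compact).mono_set inter_subset_left
  refine ⟨R, r.range, { toFun := fun h y => ∫ ζ in A ∩ r ⁻¹' {(y : ℂ)}, h ζ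
                        map_add' := fun h h' => ?_
                        map_smul' := fun c h => ?_ }, ?_, fun h hP => ?_⟩
  · funext y
    exact integral_add (hfi y h) (hfi y h')
  · funext y
    exact integral_smul c _
  · refine ContinuousLinearMap.opNorm_le_bound _ hε.le fun h => ?_
    have hd : IsKernel M A (fun z ζ => k z ζ - k z (r ζ)) δ :=
      { hk with
        nonneg := hδ0.le
        measurable := fun z hz => (hk.measurable z hz).sub (hk'.measurable z hz)
        bound := fun z hz ζ hζ => by
          rw [← dist_eq_norm]
          refine (hclose (z, ζ) ⟨hz, hζ⟩ (z, r ζ) ⟨hz, hrA ζ⟩ ?_).le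
          rw [Prod.dist_eq, dist_self, dist_comm]
          exact max_lt hη (hr ζ hζ)
        continuousOn := fun ζ hζ => (hk.continuousOn ζ hζ).sub (hk'.continuousOn ζ hζ) }
    rw [BoundedContinuousFunction.norm_le (by positivity)]
    intro z
    have hz : (K - R) h z = M z (∫ ζ in A, (k z ζ - k z (r ζ)) • h ζ) := by
      change K h z - R h z = _
      rw [hK, hR]
      by_cases hz : z ∈ tsupport M
      · rw [← map_sub, ← integral_sub (hk.integrableOn hz h) (hk'.integrableOn hz h)]
        simp [sub_smul]
      · simp [apply_eq_zero hz]
    rw [hz]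
    refine (hd.norm_apply_integral_le hB h z).trans ?_
    gcongr
    rw [hδ, div_mul_eq_mul_div, mul_div_assoc', div_le_iff₀ (by positivity)]
    nlinarith
  · ext z
    rw [hR]
    have h0 : ∫ ζ in A, k z (r ζ) • h ζ = 0 := by
      have hA : A = ⋃ y ∈ r.range, A ∩ r ⁻¹' {y} := by
        ext ζ
        simp only [mem_iUnion, mem_inter_iff, mem_preimage, mem_singleton_iff, exists_and_left,
          exists_prop]
        exact ⟨fun hζ => ⟨hζ, r ζ, r.mem_range_self ζ, rfl⟩, fun hζ => hζ.1⟩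
      have hms : ∀ y, MeasurableSet (A ∩ r ⁻¹' {y}) := fun y =>
        hk.compact.measurableSet.inter (r.measurableSet_preimage _)
      have hcongr : ∀ y, EqOn (fun ζ => k z (r ζ) • h ζ) (fun ζ => k z y • h ζ)
          (A ∩ r ⁻¹' {y}) := fun y ζ hζ => by
        simp only
        rw [show r ζ = y from hζ.2]
      rw [hA, integral_biUnion_finset _ (fun y _ => hms y)]
      · refine Finset.sum_eq_zero fun y hy => ?_
        rw [setIntegral_congr_fun (hms y) (hcongr y), integral_smul]
        have := congrFun hP ⟨y, hy⟩
        change ∫ ζ in A ∩ r ⁻¹' {y}, h ζ = 0 at this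
        rw [this, smul_zero]
      · intro y _ y' _ hyy'
        refine Disjoint.mono inter_subset_right inter_subset_right ?_
        exact Disjoint.preimage _ (by simpa using hyy')
      · intro y _
        exact IntegrableOn.congr_fun (by exact (hfi y h).smul (k z y)) (fun ζ hζ => ((hcongr y) hζ).symm) (hms y)
    rw [h0, map_zero]
    rfl

end IsKernel

/-- Solvability of a Fredholm equation with Cauchy kernels, for a suitable polynomial multiple of
the right hand side. -/
theorem exists_polynomial_solution [FiniteDimensional ℂ V] {J : Type*} [Fintype J] (A : J → Set ℂ)
    (hA : ∀ j, IsCompact (A j)) (M : J → ℂ → V →L[ℂ] V) (hM : ∀ j, Continuous (M j))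
    (hMc : ∀ j, HasCompactSupport (M j)) (hMA : ∀ j, Disjoint (tsupport (M j)) (A j))
    (N : ℂ → V) (hN : Continuous N) (hNc : HasCompactSupport N) :
    ∃ p : Polynomial ℂ, p ≠ 0 ∧ ∃ h : ℂ → V, Continuous h ∧ (∃ C, ∀ z, ‖h z‖ ≤ C) ∧
      ∀ z, h z + ∑ j, M j z (cauchyIntegralOn (A j) h z) = p.eval z • N z := by
  -- Disjointness of supp `M j` and `A j` removes the singularity of the Cauchy kernel, so rounding
  -- applies to it.
  have hcont : ∀ j, ContinuousOn (Function.uncurry fun z ζ : ℂ => (z - ζ)⁻¹)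
      (tsupport (M j) ×ˢ A j) := fun j => by
    refine ContinuousOn.inv₀ (continuousOn_fst.sub continuousOn_snd) fun x hx h0 => ?_
    exact disjoint_left.1 (hMA j) hx.1 (by rw [sub_eq_zero.1 h0]; exact hx.2)
  have hker : ∀ j, ∃ C, IsKernel (M j) (A j) (fun z ζ => (z - ζ)⁻¹) C := fun j => by
    obtain ⟨C, hC⟩ := ((hMc j).isCompact.prod (hA j)).exists_bound_of_continuousOn (hcont j)
    refine ⟨max C 0, hA j, hM j, hMc j, le_max_right _ _, fun z hz => ?_, fun z hz ζ hζ =>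
      (hC (z, ζ) ⟨hz, hζ⟩).trans (le_max_left _ _), fun ζ hζ => ?_⟩
    · exact ((hcont j).comp (f := fun ζ => (z, ζ)) (by fun_prop)
        fun ζ hζ => ⟨hz, hζ⟩).aestronglyMeasurable (hA j).measurableSet
    · exact (hcont j).comp (f := fun z => (z, ζ)) (by fun_prop) fun z hz => ⟨hz, hζ⟩
  choose C hC using hker
  choose K hK using fun j => (hC j).exists_operator
  -- With this accuracy the total error is card J / (card J + 1) < 1.
  choose R s P hKR hP using fun j => (hC j).exists_finite_rank_approx (hcont j) (hK j)
    (by positivity : (0 : ℝ) < 1 / (Fintype.card J + 1))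
  have hLc : ∀ p : Polynomial ℂ, ∃ B, ∀ z, ‖p.eval z • N z‖ ≤ B := fun p =>
    hNc.smul_left.exists_bound_of_continuous (p.continuous.smul hN)
  choose B hB using hLc
  let L : Polynomial ℂ →ₗ[ℂ] (ℂ →ᵇ V) :=
    { toFun := fun p => BoundedContinuousFunction.ofNormedAddCommGroup _
        (p.continuous.smul hN) _ (hB p)
      map_add' := fun p q => by ext z; simp [add_smul]
      map_smul' := fun c p => by ext z; simp [mul_smul] }
  have hE : ¬ FiniteDimensional ℂ (Polynomial ℂ) := Polynomial.not_finite
  obtain ⟨p, hp, h, hh⟩ := exists_add_apply_eq_of_norm_lt_one hE (∑ j, K j) (∑ j, R j) (by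
      rw [← Finset.sum_sub_distrib]
      refine (norm_sum_le_of_le _ fun j _ => hKR j).trans_lt ?_
      rw [Finset.sum_const, Finset.card_univ, nsmul_eq_mul, mul_one_div, div_lt_one (by positivity)]
      linarith) (LinearMap.pi P) (fun x hx => by
      simp only [FunLike.coe_sum, Finset.sum_apply]
      exact Finset.sum_eq_zero fun j _ => hP j x (congrFun hx j)) L
  refine ⟨p, hp, h, h.continuous, ⟨_, h.norm_coe_le_norm⟩, fun z => ?_⟩
  have := DFunLike.congr_fun hh z
  simpa [hK, L, cauchyIntegralOn] using this

end Fredholm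

/-! ### Holomorphic sections of a cocycle over the plane -/

section Cutoff

/-- Smooth functions on the plane adapted to a finite open cover, one member of which is a
neighbourhood of infinity. -/
structure PlaneCutoff {J : Type*} [Fintype J] (U : J → Set ℂ) (j₀ : J) where
  /-- A partition of unity on the compact set `L`. -/
  ρ : J → ℂ → ℂ
  /-- Functions equal to one around the support of `ρ j`. -/
  χ : J → ℂ → ℂ
  /-- A set outside of which the functions `χ j` are constant. -/
  L : Set ℂ
  contDiff_ρ : ∀ j, ContDiff ℝ ∞ (ρ j)
  contDiff_χ : ∀ j, ContDiff ℝ ∞ (χ j)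
  isCompact_tsupport_ρ : ∀ j, IsCompact (tsupport (ρ j))
  tsupport_ρ_subset : ∀ j, tsupport (ρ j) ⊆ U j
  tsupport_χ_subset : ∀ j, tsupport (χ j) ⊆ U j
  χ_eq_one : ∀ j, ∀ z ∈ tsupport (ρ j), ∀ᶠ y in 𝓝 z, χ j y = 1
  tsupport_fderiv_χ : ∀ j, tsupport (fderiv ℝ (χ j)) ⊆ L
  sum_ρ : ∀ z ∈ L, ∑ j, ρ j z = 1
  χ_infty : ∀ᶠ z in cocompact ℂ, χ j₀ z = 1 ∧ ∀ j ≠ j₀, χ j z = 0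

lemma exists_real_cutoff {s t : Set ℂ} (hs : IsClosed s) (ht : IsClosed t) (hd : Disjoint s t) :
    ∃ f : ℂ → ℂ, ContDiff ℝ ∞ f ∧ Disjoint (tsupport f) s ∧ ∀ z ∈ t, ∀ᶠ y in 𝓝 z, f y = 1 := by
  obtain ⟨f, h0, h1, -⟩ := exists_contMDiffMap_zero_one_nhds_of_isClosed 𝓘(ℝ, ℂ) (n := ⊤) hs ht hd
  refine ⟨fun z => (f z : ℂ), Complex.ofRealCLM.contDiff.comp f.contMDiff.contDiff, ?_, ?_⟩
  · rw [disjoint_right]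
    intro z hz
    rw [notMem_tsupport_iff_eventuallyEq]
    filter_upwards [eventually_nhdsSet_iff_forall.1 h0 z hz] with y hy
    simp [hy]
  · intro z hz
    filter_upwards [eventually_nhdsSet_iff_forall.1 h1 z hz] with y hy
    simp [hy]

/-- Only `χ j₀` reaches infinity, and it equals one outside a large disc; so all ∂̄χ live in a disc
`L`, where a partition of unity with compact supports suffices. -/
lemma nonempty_planeCutoff {J : Type*} [Fintype J] {U : J → Set ℂ} (hU : ∀ j, IsOpen (U j))
    (hcov : ∀ z, ∃ j, z ∈ U j) {j₀ : J} {R : ℝ} (hR : ∀ z : ℂ, R < ‖z‖ → z ∈ U j₀) :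
    Nonempty (PlaneCutoff U j₀) := by
  classical
  -- Points of `L` beyond radius `R` are covered by `U j₀` cut at R + 4 > R + 3; the other cutoffs
  -- stay within radius R + 2, inside `L`.
  set r : J → ℝ := fun j => if j = j₀ then R + 4 else R + 2 with hr
  set U' : J → Set ℂ := fun j => U j ∩ Metric.ball 0 (r j) with hU'
  set L : Set ℂ := Metric.closedBall 0 (R + 3) with hL
  obtain ⟨ρ, hρ⟩ := SmoothPartitionOfUnity.exists_isSubordinate 𝓘(ℝ, ℂ)
    (Metric.isClosed_closedBall : IsClosed L) U' (fun j => (hU j).inter Metric.isOpen_ball) (by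
      intro z hz
      rw [mem_iUnion]
      by_cases hzR : R < ‖z‖
      · refine ⟨j₀, hR z hzR, ?_⟩
        simp only [Metric.mem_closedBall, dist_zero_right] at hz
        simp only [hr, if_true, Metric.mem_ball, dist_zero_right]
        linarith
      · obtain ⟨j, hj⟩ := hcov z
        refine ⟨j, hj, ?_⟩
        simp only [hr, Metric.mem_ball, dist_zero_right]
        split_ifs <;> linarith)
  have hts : ∀ j, tsupport (fun z => (ρ j z : ℂ)) = tsupport (ρ j) := fun j => by
    unfold tsupport
    congr 1
    ext z
    simp
  have hρs : ∀ j, tsupport (ρ j) ⊆ U' j := hρ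
  have hχ : ∀ j, ∃ f : ℂ → ℂ, ContDiff ℝ ∞ f ∧ tsupport f ⊆ U j ∧
      (∀ z ∈ tsupport (ρ j), ∀ᶠ y in 𝓝 z, f y = 1) ∧
      (j ≠ j₀ → tsupport f ⊆ L) ∧ (j = j₀ → ∀ z : ℂ, R + 3 ≤ ‖z‖ → ∀ᶠ y in 𝓝 z, f y = 1) := by
    intro j
    by_cases hj : j = j₀
    · obtain ⟨f, hf, hf0, hf1⟩ := exists_real_cutoff (hU j).isClosed_compl
        ((isClosed_tsupport (ρ j)).union (isClosed_le continuous_const continuous_norm :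
          IsClosed {z : ℂ | R + 3 ≤ ‖z‖})) (by
          rw [disjoint_compl_left_iff_subset]
          refine union_subset ((hρs j).trans inter_subset_left) fun z hz => ?_
          rw [hj]
          exact hR z (by have : R + 3 ≤ ‖z‖ := hz; linarith))
      refine ⟨f, hf, disjoint_compl_right_iff_subset.1 hf0, fun z hz => hf1 z (Or.inl hz),
        fun h => absurd hj h, fun _ z hz => hf1 z (Or.inr hz)⟩
    · obtain ⟨f, hf, hf0, hf1⟩ := exists_real_cutoff
        ((hU j).inter (Metric.isOpen_ball (x := (0 : ℂ)) (ε := r j))).isClosed_compl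
        (isClosed_tsupport (ρ j)) (disjoint_compl_left_iff_subset.2 (hρs j))
      have hsub := disjoint_compl_right_iff_subset.1 hf0
      refine ⟨f, hf, hsub.trans inter_subset_left, hf1, fun _ z hz => ?_, fun h => absurd h hj⟩
      have := (hsub hz).2
      simp only [hr, hj, if_false, Metric.mem_ball, dist_zero_right] at this
      simp only [hL, Metric.mem_closedBall, dist_zero_right]
      linarith
  choose χ h1 h2 h3 h4 h5 using hχ
  have hfar : ∀ᶠ z : ℂ in cocompact ℂ, R + 3 < ‖z‖ :=
    tendsto_norm_cocompact_atTop.eventually_gt_atTop _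
  refine ⟨{ ρ := fun j z => (ρ j z : ℂ), χ := χ, L := L
            contDiff_ρ := fun j => Complex.ofRealCLM.contDiff.comp (ρ j).contMDiff.contDiff
            contDiff_χ := h1
            isCompact_tsupport_ρ := fun j => ?_
            tsupport_ρ_subset := fun j => ?_
            tsupport_χ_subset := h2
            χ_eq_one := fun j => ?_
            tsupport_fderiv_χ := fun j => ?_
            sum_ρ := fun z hz => ?_
            χ_infty := ?_ }⟩
  · rw [hts]
    exact (isCompact_closedBall (0 : ℂ) (r j)).of_isClosed_subset (isClosed_tsupport _)
      ((hρs j).trans (inter_subset_right.trans Metric.ball_subset_closedBall))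
  · rw [hts]
    exact (hρs j).trans inter_subset_left
  · rw [hts]
    exact h3 j
  · by_cases hj : j = j₀
    · refine closure_minimal (fun z hz => ?_) Metric.isClosed_closedBall
      by_contra hzL
      simp only [hL, Metric.mem_closedBall, dist_zero_right, not_le] at hzL
      refine hz ?_
      rw [Filter.EventuallyEq.fderiv_eq (show χ j =ᶠ[𝓝 z] fun _ => 1 from h5 j hj z hzL.le)]
      simp
    · exact (tsupport_fderiv_subset ℝ).trans (h4 j hj)
  · have := ρ.sum_eq_one hz
    rw [finsum_eq_sum_of_fintype] at this
    exact_mod_cast this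
  · filter_upwards [hfar] with z hz
    refine ⟨(h5 j₀ rfl z hz.le).self_of_nhds, fun j hj => image_eq_zero_of_notMem_tsupport fun h => ?_⟩
    have := h4 j hj h
    simp only [hL, Metric.mem_closedBall, dist_zero_right] at this
    linarith

end Cutoff

/-! ### Calculus of the ∂̄-operator -/

section Cocycle

variable {E F : Type*} [NormedAddCommGroup E] [NormedSpace ℂ E]
  [NormedAddCommGroup F] [NormedSpace ℂ F]

lemma contDiff_of_tsupport_subset {G : Type*} [NormedAddCommGroup G] [NormedSpace ℝ G]
    {f : ℂ → G} {O : Set ℂ} (hO : IsOpen O) (hf : ContDiffOn ℝ 1 f O) (h : tsupport f ⊆ O) :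
    ContDiff ℝ 1 f := by
  rw [contDiff_iff_contDiffAt]
  intro z
  by_cases hz : z ∈ tsupport f
  · exact hf.contDiffAt (hO.mem_nhds (h hz))
  · exact contDiffAt_const.congr_of_eventuallyEq (notMem_tsupport_iff_eventuallyEq.1 hz)

lemma contDiffOn_real_of_differentiableOn [CompleteSpace F] {f : ℂ → F} {O : Set ℂ}
    (hO : IsOpen O) (hf : DifferentiableOn ℂ f O) : ContDiffOn ℝ 1 f O :=
  (hf.contDiffOn hO).restrict_scalars ℝ

lemma Filter.EventuallyEq.dbar_eq {f f' : ℂ → F} {z : ℂ} (h : f =ᶠ[𝓝 z] f') :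
    dbar f z = dbar f' z := by
  rw [dbar, dbar, h.fderiv_eq]

lemma dbar_sum {J : Type*} {s : Finset J} {f : J → ℂ → F} {z : ℂ}
    (h : ∀ j ∈ s, DifferentiableAt ℝ (f j) z) :
    dbar (fun z => ∑ j ∈ s, f j z) z = ∑ j ∈ s, dbar (f j) z := by
  simp only [dbar, fderiv_fun_sum h, sum_apply, Finset.smul_sum, Finset.sum_add_distrib, smul_add]

lemma dbar_add {f f' : ℂ → F} {z : ℂ} (h : DifferentiableAt ℝ f z)
    (h' : DifferentiableAt ℝ f' z) : dbar (fun z => f z + f' z) z = dbar f z + dbar f' z := by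
  simp only [dbar, fderiv_fun_add h h', add_apply]
  module

lemma dbar_const_smul {f : ℂ → F} {z : ℂ} (c : ℂ) (h : DifferentiableAt ℝ f z) :
    dbar (fun z => c • f z) z = c • dbar f z := by
  simp only [dbar, fderiv_fun_const_smul h, smul_apply]
  module

lemma dbar_eq_zero {f : ℂ → F} {z : ℂ} (h : DifferentiableAt ℂ f z) : dbar f z = 0 := by
  have h1 : fderiv ℝ f z = (fderiv ℂ f z).restrictScalars ℝ :=
    (h.hasFDerivAt.restrictScalars ℝ).fderiv
  have h2 : fderiv ℂ f z Complex.I = Complex.I • fderiv ℂ f z 1 := by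
    rw [← map_smul, smul_eq_mul, mul_one]
  rw [dbar, h1]
  simp only [ContinuousLinearMap.coe_restrictScalars', h2, smul_smul, Complex.I_mul_I]
  simp

lemma differentiableAt_of_dbar_eq_zero {f : ℂ → F} {z : ℂ} (h : DifferentiableAt ℝ f z)
    (h0 : dbar f z = 0) : DifferentiableAt ℂ f z := by
  rw [differentiableAt_complex_iff_differentiableAt_real]
  refine ⟨h, ?_⟩
  rw [dbar, smul_eq_zero] at h0
  have h1 := h0.resolve_left (by norm_num)
  have h2 : fderiv ℝ f z 1 = -(Complex.I • fderiv ℝ f z Complex.I) := eq_neg_of_add_eq_zero_left h1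
  rw [h2, smul_neg, smul_smul, Complex.I_mul_I]
  simp

/-- The holomorphic factor `g` contributes no term because its derivative is complex linear. -/
lemma dbar_smul_clm_apply {χ : ℂ → ℂ} {g : ℂ → E →L[ℂ] F} {H : ℂ → E} {z : ℂ}
    (hχ : DifferentiableAt ℝ χ z) (hg : DifferentiableAt ℂ g z) (hH : DifferentiableAt ℝ H z) :
    dbar (fun z => χ z • g z (H z)) z = dbar χ z • g z (H z) + χ z • g z (dbar H z) := by
  have h1 := (hg.hasFDerivAt.restrictScalars ℝ)
  have h2 := HasFDerivAt.comp (g := fun p : (E →L[ℂ] F) × E => p.1 p.2) z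
    (((isBoundedBilinearMap_apply (𝕜 := ℂ) (E := E) (F := F)).hasFDerivAt
      (g z, H z)).restrictScalars ℝ) (h1.prodMk hH.hasFDerivAt)
  have h3 := hχ.hasFDerivAt.smul h2
  have h4 : fderiv ℂ g z Complex.I = Complex.I • fderiv ℂ g z 1 := by
    rw [← map_smul, smul_eq_mul, mul_one]
  rw [dbar, dbar, dbar, show fderiv ℝ (fun z => χ z • g z (H z)) z = _ from h3.fderiv]
  simp [h4]
  have h5 : Complex.I * Complex.I = -1 := Complex.I_mul_I
  simp only [smul_smul]
  match_scalars <;> ring_nf <;> simp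

end Cocycle

/-! ### Solving the ∂̄-equation twisted by a cocycle -/

section CocycleSection

variable {F : Type*} [NormedAddCommGroup F] [NormedSpace ℂ F]

/-- A holomorphic cocycle with values in the endomorphisms of `F` on an open cover of the plane. -/
structure HolomorphicCocycle {J : Type*} (U : J → Set ℂ) (g : J → J → ℂ → F →L[ℂ] F) : Prop where
  isOpen : ∀ j, IsOpen (U j)
  cover : ∀ z, ∃ j, z ∈ U j
  differentiableOn : ∀ i j, DifferentiableOn ℂ (g i j) (U i ∩ U j)
  self_apply : ∀ i, ∀ z ∈ U i, ∀ v, g i i z v = v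
  comp_apply : ∀ i j k, ∀ z ∈ U i, z ∈ U j → z ∈ U k → ∀ v, g i j z (g j k z v) = g i k z v

lemma contDiffOn_complex_clm_apply {E : Type*} [NormedAddCommGroup E] [NormedSpace ℂ E]
    {f : ℂ → E →L[ℂ] F} {h : ℂ → E} {s : Set ℂ} (hf : ContDiffOn ℝ 1 f s)
    (hh : ContDiffOn ℝ 1 h s) : ContDiffOn ℝ 1 (fun z => f z (h z)) s :=
  ((isBoundedBilinearMap_apply (𝕜 := ℂ) (E := E) (F := F)).contDiff.restrict_scalars ℝ
    ).comp_contDiffOn (hf.prodMk hh)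

lemma contDiff_dbar {χ : ℂ → ℂ} (hχ : ContDiff ℝ ∞ χ) : ContDiff ℝ 1 (dbar χ) := by
  have h : ContDiff ℝ 1 (fderiv ℝ χ) := (contDiff_infty_iff_fderiv.1 hχ).2.of_le (by exact_mod_cast le_top)
  unfold dbar
  fun_prop

lemma tsupport_dbar_subset (χ : ℂ → ℂ) : tsupport (dbar χ) ⊆ tsupport (fderiv ℝ χ) := by
  refine closure_mono fun z hz => ?_
  contrapose! hz
  simp only [Function.notMem_support] at hz ⊢
  simp [dbar, hz]

/-- The equation is the one that makes ∑ χ_j g_ij H_j holomorphic. Put H_j = π⁻¹ · (Cauchy transform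
of h_j), plus `p • v` when `j = j₀`. Then ∂̄H_j = h_j, and the system becomes a Fredholm equation
for `h` whose right hand side is `p` times a fixed function. -/
lemma exists_dbar_solution [FiniteDimensional ℂ F] {J : Type*} [Fintype J] {U : J → Set ℂ}
    {g : J → J → ℂ → F →L[ℂ] F} (hg : HolomorphicCocycle U g) {j₀ : J} (c : PlaneCutoff U j₀)
    (v : F) :
    ∃ p : Polynomial ℂ, p ≠ 0 ∧ ∃ H : J → ℂ → F,
      (∀ j, Differentiable ℝ (H j)) ∧
      (∀ i z, dbar (H i) z = -∑ j, (c.ρ i z * dbar (c.χ j) z) • g i j z (H j z)) ∧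
      Tendsto (fun z => H j₀ z - p.eval z • v) (cocompact ℂ) (𝓝 0) := by
  classical
  have : CompleteSpace F := FiniteDimensional.complete ℂ F
  set A : J → Set ℂ := fun j => tsupport (c.ρ j) with hA
  set D : J → ℂ → ℂ := fun j => dbar (c.χ j) with hD
  have hDc : ∀ j, ContDiff ℝ 1 (D j) := fun j => contDiff_dbar (c.contDiff_χ j)
  have hDU : ∀ j, tsupport (D j) ⊆ U j := fun j => (tsupport_dbar_subset _).trans
    ((tsupport_fderiv_subset ℝ).trans (c.tsupport_χ_subset j))
  -- Since χ_j = 1 near the support of ρ_j, ∂̄χ_j vanishes there: this separates the two variables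
  -- of the Cauchy kernel.
  have hDA : ∀ j, Disjoint (tsupport (D j)) (A j) := fun j => by
    rw [disjoint_right]
    intro z hz
    rw [notMem_tsupport_iff_eventuallyEq]
    filter_upwards [(c.χ_eq_one j z hz).eventually_nhds] with y hy
    have h1 : c.χ j =ᶠ[𝓝 y] fun _ => 1 := hy
    rw [Pi.zero_apply, hD]
    simp only
    rw [h1.dbar_eq, dbar]
    simp
  set m : J → J → ℂ → F →L[ℂ] F := fun i j z => (c.ρ i z * D j z) • g i j z with hm
  have hms : ∀ i j, tsupport (m i j) ⊆ A i ∩ tsupport (D j) := fun i j => by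
    refine (tsupport_smul_subset_left (fun z => c.ρ i z * D j z) (g i j)).trans (subset_inter ?_ ?_)
    · exact tsupport_mul_subset_left
    · exact tsupport_mul_subset_right
  have hmc : ∀ i j, ContDiff ℝ 1 (m i j) := fun i j => by
    refine contDiff_of_tsupport_subset ((hg.isOpen i).inter (hg.isOpen j)) ?_
      ((hms i j).trans (inter_subset_inter (c.tsupport_ρ_subset i) (hDU j)))
    have h1 : ContDiff ℝ 1 fun z => c.ρ i z * D j z :=
      ((c.contDiff_ρ i).of_le (by exact_mod_cast le_top)).mul (hDc j)
    have h2 : ContDiffOn ℝ 1 (g i j) (U i ∩ U j) := contDiffOn_real_of_differentiableOn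
      ((hg.isOpen i).inter (hg.isOpen j)) (hg.differentiableOn i j)
    exact h1.contDiffOn.smul h2
  -- `M j` is the `j`-th column of the matrix `m`; the factor π⁻¹ compensates ∂̄ of the Cauchy
  -- transform being π times the density.
  set M : J → ℂ → (J → F) →L[ℂ] (J → F) := fun j z =>
    ∑ i, (ContinuousLinearMap.single ℂ (fun _ : J => F) i).comp
      (((Real.pi : ℂ)⁻¹ • m i j z).comp (ContinuousLinearMap.proj j)) with hM
  have hMapp : ∀ j z (w : J → F) i, M j z w i = (Real.pi : ℂ)⁻¹ • m i j z (w j) := by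
    intro j z w i
    simp only [hM, sum_apply, Finset.sum_apply]
    rw [Finset.sum_eq_single i]
    · simp
    · intro k _ hk
      simp [hk.symm]
    · simp
  have hMC : ∀ j, ContDiff ℝ 1 (M j) := fun j => by
    refine ContDiff.sum fun i _ => ?_
    have h1 : ContDiff ℝ 1 fun z => (Real.pi : ℂ)⁻¹ • m i j z := (hmc i j).const_smul (Real.pi : ℂ)⁻¹
    have hL : ∃ L : (F →L[ℂ] F) →L[ℂ] ((J → F) →L[ℂ] (J → F)), ∀ T, L T =
        (ContinuousLinearMap.single ℂ (fun _ : J => F) i).comp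
          (T.comp (ContinuousLinearMap.proj j)) :=
      ⟨(ContinuousLinearMap.compL ℂ _ _ _ (ContinuousLinearMap.single ℂ (fun _ : J => F) i)).comp
        ((ContinuousLinearMap.compL ℂ (J → F) F F).flip (ContinuousLinearMap.proj j)),
        fun T => rfl⟩
    obtain ⟨L, hL⟩ := hL
    simp only [← hL]
    exact (L.restrictScalars ℝ).contDiff.comp h1
  have hMs : ∀ j, tsupport (M j) ⊆ (⋃ i, A i) ∩ tsupport (D j) := fun j => by
    refine closure_minimal (fun z hz => ?_)
      ((isClosed_iUnion_of_finite fun i => isClosed_tsupport _).inter (isClosed_tsupport _))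
    by_contra hn
    refine hz ?_
    have : ∀ i, m i j z = 0 := fun i => image_eq_zero_of_notMem_tsupport fun h =>
      hn ⟨mem_iUnion.2 ⟨i, (hms i j h).1⟩, (hms i j h).2⟩
    ext w i
    simp [hMapp, this]
  have hAU : IsCompact (⋃ i, A i) := isCompact_iUnion c.isCompact_tsupport_ρ
  have hMA : ∀ j, tsupport (M j) ⊆ (A j)ᶜ := fun j z hz hzA =>
    disjoint_left.1 (hDA j) (hMs j hz).2 hzA
  set N : ℂ → J → F := fun z i => -(m i j₀ z v) with hN
  have hNc : ContDiff ℝ 1 N := by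
    rw [contDiff_pi]
    intro i
    rw [← contDiffOn_univ]
    exact (contDiffOn_complex_clm_apply (hmc i j₀).contDiffOn contDiffOn_const).neg
  have hNs : HasCompactSupport N := by
    refine HasCompactSupport.of_support_subset_isCompact hAU fun z hz => ?_
    by_contra hn
    refine hz ?_
    funext i
    have : m i j₀ z = 0 := image_eq_zero_of_notMem_tsupport fun h =>
      hn (mem_iUnion.2 ⟨i, (hms i j₀ h).1⟩)
    simp [hN, this]
  obtain ⟨p, hp, h, hhc, ⟨C, hC⟩, heq⟩ := exists_polynomial_solution A c.isCompact_tsupport_ρ M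
    (fun j => (hMC j).continuous)
    (fun j => hAU.of_isClosed_subset (isClosed_tsupport _) ((hMs j).trans inter_subset_left))
    (fun j => disjoint_left.2 (hMA j)) N hNc.continuous hNs
  -- Regularity comes from the equation: `M j` is supported off `A j`, where the Cauchy integral of
  -- a merely continuous `h` is already holomorphic.
  have hhC : ContDiff ℝ 1 h := by
    have h1 : h = fun z => p.eval z • N z - ∑ j, M j z (cauchyIntegralOn (A j) h z) :=
      funext fun z => eq_sub_of_add_eq (heq z)
    rw [h1]
    have h2 : ContDiff ℝ 1 fun z : ℂ => p.eval z := p.differentiable.contDiff.restrict_scalars ℝ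
    refine (h2.smul hNc).sub (ContDiff.sum fun j _ => ?_)
    refine contDiff_of_tsupport_subset (c.isCompact_tsupport_ρ j).isClosed.isOpen_compl ?_
      ((closure_mono fun z hz => ?_).trans (hMA j))
    · exact contDiffOn_complex_clm_apply (hMC j).contDiffOn (contDiffOn_real_of_differentiableOn
        (c.isCompact_tsupport_ρ j).isClosed.isOpen_compl
        (differentiableOn_cauchyIntegralOn (c.isCompact_tsupport_ρ j) hhc))
    · contrapose! hz
      simp only [Function.notMem_support] at hz ⊢
      rw [hz, zero_apply]
  -- Taking the `j`-th component commutes with the integral off `A j`; on `A j`, where the kernel is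
  -- singular, `m i j` vanishes.
  have hcomp : ∀ i j z, m i j z (cauchyIntegralOn (A j) h z j) =
      m i j z (cauchyIntegralOn (A j) (fun ζ => h ζ j) z) := by
    intro i j z
    by_cases hz : z ∈ A j
    · have : m i j z = 0 := image_eq_zero_of_notMem_tsupport fun h =>
        disjoint_left.1 (hDA j) (hms i j h).2 hz
      rw [this, zero_apply, zero_apply]
    · congr 1
      refine ((ContinuousLinearMap.proj (R := ℂ) (φ := fun _ : J => F) j).integral_comp_comm ?_).symm
      refine ContinuousOn.integrableOn_compact (c.isCompact_tsupport_ρ j) ?_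
      refine ContinuousOn.smul (ContinuousOn.inv₀ (continuousOn_const.sub continuousOn_id) fun ζ hζ h0 => hz ?_)
        hhc.continuousOn
      rwa [show z = ζ from sub_eq_zero.1 h0]
  set H : J → ℂ → F := fun j z => (Real.pi : ℂ)⁻¹ • cauchyIntegralOn (A j) (fun ζ => h ζ j) z +
    (if j = j₀ then p.eval z else 0) • v with hH
  have hhi : ∀ i z, h z i = -∑ j, m i j z (H j z) := by
    intro i z
    have h1 := congrFun (heq z) i
    simp only [Pi.add_apply, Finset.sum_apply, hMapp, hcomp, Pi.smul_apply] at h1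
    simp only [hH, map_add, map_smul, Finset.sum_add_distrib, neg_add]
    have h2 : ∑ j, m i j z ((if j = j₀ then p.eval z else 0) • v) = p.eval z • m i j₀ z v := by
      rw [Finset.sum_eq_single j₀ (fun j _ hj => by simp [hj]) (by simp)]
      simp
    simp only [map_smul] at h2
    rw [h2]
    rw [eq_sub_of_add_eq h1, hN]
    simp only [smul_neg]
    abel
  -- The factor ρ_j in the equation confines h_j to `A j`, so its integral over `A j` is the full
  -- Cauchy transform.
  have hh0 : ∀ j, ∀ z ∉ A j, h z j = 0 := fun j z hz => by
    rw [hhi, neg_eq_zero]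
    refine Finset.sum_eq_zero fun k _ => ?_
    have : m j k z = 0 := image_eq_zero_of_notMem_tsupport fun h => hz (hms j k h).1
    rw [this, zero_apply]
  have hhj : ∀ j, ContDiff ℝ 1 fun z => h z j := fun j => contDiff_pi.1 hhC j
  have hhs : ∀ j, HasCompactSupport fun z => h z j := fun j =>
    HasCompactSupport.of_support_subset_isCompact (c.isCompact_tsupport_ρ j) fun z hz => by
      by_contra hn
      exact hz (hh0 j z hn)
  have hpoly : ∀ j, Differentiable ℂ fun z : ℂ => (if j = j₀ then p.eval z else 0) • v := by
    intro j
    split_ifs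
    · exact p.differentiable.smul_const v
    · simp
  have hCd : ∀ j, Differentiable ℝ (cauchyIntegralOn (A j) fun ζ => h ζ j) := fun j =>
    differentiable_cauchyIntegralOn (hh0 j) (hhj j) (hhs j)
  refine ⟨p, hp, H, fun j => ?_, fun i z => ?_, ?_⟩
  · exact ((hCd j).const_smul _).add ((hpoly j).restrictScalars ℝ)
  · rw [hH]
    simp only
    refine (dbar_add (f := fun z => (Real.pi : ℂ)⁻¹ • cauchyIntegralOn (A i) (fun ζ => h ζ i) z)
      (((hCd i) z).const_smul _) (((hpoly i) z).restrictScalars ℝ)).trans ?_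
    rw [dbar_const_smul _ (hCd i z), dbar_eq_zero (hpoly i z), add_zero,
      dbar_cauchyIntegralOn (hh0 i) (hhj i) (hhs i), smul_smul,
      inv_mul_cancel₀ (by exact_mod_cast Real.pi_ne_zero), one_smul, hhi]
    rfl
  · have h1 := (tendsto_cauchyIntegralOn (c.isCompact_tsupport_ρ j₀)
      (fun ζ => (norm_le_pi_norm (h ζ) j₀).trans (hC ζ))).const_smul (Real.pi : ℂ)⁻¹
    rw [smul_zero] at h1
    refine h1.congr fun z => ?_
    simp [hH, hA]

/-- The section is f_i = ∑ χ_j g_ij H_j. The cocycle identity gives compatibility, the equation for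
`H` gives ∂̄f_i = 0, and near infinity f_{j₀} = H_{j₀}. -/
theorem exists_holomorphic_section [FiniteDimensional ℂ F] {J : Type*} [Fintype J]
    {U : J → Set ℂ} {g : J → J → ℂ → F →L[ℂ] F} (hg : HolomorphicCocycle U g) {j₀ : J} {R : ℝ}
    (hR : ∀ z : ℂ, R < ‖z‖ → z ∈ U j₀) (v : F) :
    ∃ p : Polynomial ℂ, p ≠ 0 ∧ ∃ f : J → ℂ → F, (∀ i, DifferentiableOn ℂ (f i) (U i)) ∧
      (∀ i j, ∀ z ∈ U i, z ∈ U j → f i z = g i j z (f j z)) ∧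
      Tendsto (fun z => f j₀ z - p.eval z • v) (cocompact ℂ) (𝓝 0) := by
  obtain ⟨c⟩ := nonempty_planeCutoff hg.isOpen hg.cover hR
  obtain ⟨p, hp, H, hHd, hHb, hlim⟩ := exists_dbar_solution hg c v
  have hχ0 : ∀ j z, z ∉ U j → c.χ j =ᶠ[𝓝 z] 0 := fun j z hz =>
    notMem_tsupport_iff_eventuallyEq.1 fun h => hz (c.tsupport_χ_subset j h)
  have hD0 : ∀ j z, z ∉ U j → dbar (c.χ j) z = 0 := fun j z hz => by
    rw [(hχ0 j z hz).dbar_eq, dbar]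
    simp
  have hρ0 : ∀ j z, z ∉ U j → c.ρ j z = 0 := fun j z hz =>
    image_eq_zero_of_notMem_tsupport fun h => hz (c.tsupport_ρ_subset j h)
  refine ⟨p, hp, fun i z => ∑ j, c.χ j z • g i j z (H j z), fun i z hz => ?_,
    fun i j z hi hj => ?_, ?_⟩
  · have hterm : ∀ j, DifferentiableAt ℝ (fun z => c.χ j z • g i j z (H j z)) z ∧
        dbar (fun z => c.χ j z • g i j z (H j z)) z =
          dbar (c.χ j) z • g i j z (H j z) + c.χ j z • g i j z (dbar (H j) z) := by
      intro j
      by_cases hj : z ∈ U j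
      · have h1 : DifferentiableAt ℝ (c.χ j) z :=
          ((c.contDiff_χ j).differentiable (by simp)) z
        have h2 : DifferentiableAt ℂ (g i j) z :=
          (hg.differentiableOn i j).differentiableAt
            (((hg.isOpen i).inter (hg.isOpen j)).mem_nhds ⟨hz, hj⟩)
        refine ⟨h1.smul ?_, dbar_smul_clm_apply h1 h2 (hHd j z)⟩
        have h3 := HasFDerivAt.comp (g := fun p : (F →L[ℂ] F) × F => p.1 p.2) z
          (((isBoundedBilinearMap_apply (𝕜 := ℂ) (E := F) (F := F)).hasFDerivAt
            (g i j z, H j z)).restrictScalars ℝ)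
          ((h2.hasFDerivAt.restrictScalars ℝ).prodMk (hHd j z).hasFDerivAt)
        exact h3.differentiableAt
      · have h1 : (fun z => c.χ j z • g i j z (H j z)) =ᶠ[𝓝 z] fun _ => 0 := by
          filter_upwards [hχ0 j z hj] with y hy
          rw [hy, Pi.zero_apply, zero_smul]
        refine ⟨(differentiableAt_const 0).congr_of_eventuallyEq h1, ?_⟩
        rw [h1.dbar_eq, hD0 j z hj, (hχ0 j z hj).self_of_nhds, dbar]
        simp
    refine DifferentiableAt.differentiableWithinAt (differentiableAt_of_dbar_eq_zero
      (DifferentiableAt.fun_sum fun j _ => (hterm j).1) ?_)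
    rw [dbar_sum fun j _ => (hterm j).1, Finset.sum_congr rfl fun j _ => (hterm j).2,
      Finset.sum_add_distrib]
    -- On the support of ρ_j the cutoff χ_j is one, and g_ij g_jk = g_ik makes the inner sum
    -- independent of `j`.
    have h1 : ∀ j, c.χ j z • g i j z (dbar (H j) z) =
        -(c.ρ j z • ∑ k, dbar (c.χ k) z • g i k z (H k z)) := by
      intro j
      rw [hHb, map_neg, map_sum, smul_neg, Finset.smul_sum, Finset.smul_sum]
      congr 1
      refine Finset.sum_congr rfl fun k _ => ?_
      by_cases hj : z ∈ tsupport (c.ρ j)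
      · by_cases hk : z ∈ U k
        · rw [map_smul, hg.comp_apply i j k z hz (c.tsupport_ρ_subset j hj) hk,
            (c.χ_eq_one j z hj).self_of_nhds, one_smul, smul_smul]
        · simp [hD0 k z hk]
      · simp [image_eq_zero_of_notMem_tsupport hj]
    rw [Finset.sum_congr rfl fun j _ => h1 j, Finset.sum_neg_distrib, ← Finset.sum_smul]
    -- On `L` the ρ_j sum to one and the two terms cancel; off `L` every ∂̄χ_k vanishes.
    by_cases hL : z ∈ c.L
    · rw [c.sum_ρ z hL, one_smul, add_neg_cancel]
    · have h2 : ∀ k, dbar (c.χ k) z = 0 := fun k => image_eq_zero_of_notMem_tsupport fun h =>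
        hL (c.tsupport_fderiv_χ k (tsupport_dbar_subset _ h))
      simp [h2]
  · rw [map_sum]
    refine Finset.sum_congr rfl fun k _ => ?_
    by_cases hk : z ∈ U k
    · rw [map_smul, hg.comp_apply i j k z hi hj hk]
    · rw [(hχ0 k z hk).self_of_nhds]
      simp
  · refine hlim.congr' ?_
    filter_upwards [c.χ_infty, tendsto_norm_cocompact_atTop.eventually_gt_atTop R] with z hz hzR
    rw [Finset.sum_eq_single j₀ (fun j _ hj => by rw [hz.2 j hj, zero_smul]) (by simp), hz.1,
      one_smul, hg.self_apply j₀ z (hR z hzR)]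

end CocycleSection

/-! ### Meromorphic functions on the sphere have degree zero -/

section MeromorphicDegree

lemma meromorphicOrderAt_inv_sub_const (u : ℂ) :
    MeromorphicAt (fun w : ℂ => w⁻¹ - u) 0 ∧
      meromorphicOrderAt (fun w : ℂ => w⁻¹ - u) 0 = ((-1 : ℤ) : WithTop ℤ) := by
  have h1 : MeromorphicAt (fun w : ℂ => w⁻¹ - u) 0 :=
    (MeromorphicAt.id 0).inv.sub (MeromorphicAt.const u 0)
  refine ⟨h1, (meromorphicOrderAt_eq_int_iff h1).2 ⟨fun w => 1 - u * w, by fun_prop, by simp, ?_⟩⟩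
  filter_upwards [self_mem_nhdsWithin] with w hw
  have hw' : w ≠ 0 := hw
  simp only [sub_zero, zpow_neg_one, smul_eq_mul]
  field_simp

lemma analyticAt_inv_comp {q : ℂ → ℂ} {w : ℂ} (hw : w ≠ 0)
    (h : AnalyticAt ℂ (fun w => q w⁻¹) w) : AnalyticAt ℂ q w⁻¹ := by
  have h1 : AnalyticAt ℂ (fun z : ℂ => z⁻¹) w⁻¹ := analyticAt_inv (inv_ne_zero hw)
  have h2 : AnalyticAt ℂ (fun w => q w⁻¹) (w⁻¹)⁻¹ := by rwa [inv_inv]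
  have h3 := h2.comp h1
  refine h3.congr (Eventually.of_forall fun z => ?_)
  simp

/-- The orders of a meromorphic function on the sphere, not identically zero, cannot have a
positive sum. -/
theorem meromorphicOrderAt_eq_top_of_sum_pos {r : ℂ → ℂ} {ν : ℂ →₀ ℤ} {m : ℤ}
    (hr : ∀ p, MeromorphicAt r p) (hν : ∀ p, (ν p : WithTop ℤ) ≤ meromorphicOrderAt r p)
    (hr' : MeromorphicAt (fun w => r w⁻¹) 0)
    (hm : (m : WithTop ℤ) ≤ meromorphicOrderAt (fun w => r w⁻¹) 0)
    (hpos : 0 < (ν.sum fun _ k => k) + m) (p : ℂ) : meromorphicOrderAt r p = ⊤ := by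
  classical
  -- `Q = ∏ (z - u) ^ (-ν u)` cancels the prescribed orders in the plane and has order ∑ ν at
  -- infinity. Thus `r * Q` has no poles in the plane and positive order at infinity.
  set d : ℂ → ℤ := fun u => -ν u with hd
  have hdf : d.HasFiniteSupport := by
    refine ν.hasFiniteSupport.subset fun u hu => ?_
    simpa [hd] using hu
  set Q : ℂ → ℂ := ∏ᶠ u, (· - u) ^ d u with hQ
  have hQm : ∀ z, MeromorphicAt Q z := fun z =>
    (Function.FactorizedRational.meromorphicNFOn_univ d (mem_univ z)).meromorphicAt
  have hQo : ∀ z, meromorphicOrderAt Q z = ((-ν z : ℤ) : WithTop ℤ) := fun z =>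
    Function.FactorizedRational.meromorphicOrderAt_eq d hdf
  have hQprod : ∀ z, Q z = ∏ u ∈ ν.support, (z - u) ^ d u := by
    intro z
    rw [hQ, finprod_eq_prod_of_mulSupport_subset (s := ν.support), Finset.prod_apply]
    · rfl
    · rw [Function.FactorizedRational.mulSupport]
      intro u hu
      simpa [hd] using hu
  have hQi : MeromorphicAt (fun w => Q w⁻¹) 0 ∧ meromorphicOrderAt (fun w => Q w⁻¹) 0 =
      ((ν.sum fun _ k => k : ℤ) : WithTop ℤ) := by
    have hf : ∀ u ∈ ν.support, MeromorphicAt (fun w : ℂ => (w⁻¹ - u) ^ d u) 0 := fun u _ =>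
      (meromorphicOrderAt_inv_sub_const u).1.zpow _
    have he : (fun w => Q w⁻¹) = fun w => ∏ u ∈ ν.support, (w⁻¹ - u) ^ d u := by
      funext w
      rw [hQprod]
    rw [he]
    refine ⟨MeromorphicAt.fun_prod hf, ?_⟩
    rw [meromorphicOrderAt_fun_prod hf, Finsupp.sum, WithTop.coe_sum]
    refine Finset.sum_congr rfl fun u _ => ?_
    change meromorphicOrderAt ((fun w : ℂ => w⁻¹ - u) ^ d u) 0 = _
    rw [meromorphicOrderAt_zpow (meromorphicOrderAt_inv_sub_const u).1,
      (meromorphicOrderAt_inv_sub_const u).2, ← WithTop.coe_mul]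
    simp [hd]
  set q : ℂ → ℂ := r * Q with hq
  have hqm : MeromorphicOn q univ := fun z _ => (hr z).mul (hQm z)
  have hqo : ∀ z, meromorphicOrderAt q z = meromorphicOrderAt r z + ((-ν z : ℤ) : WithTop ℤ) :=
    fun z => by rw [hq, meromorphicOrderAt_mul (hr z) (hQm z), hQo]
  set h : ℂ → ℂ := toMeromorphicNFOn q univ with hh
  have hNF : ∀ z, MeromorphicNFAt h z := fun z =>
    meromorphicNFOn_toMeromorphicNFOn q univ (mem_univ z)
  have hho : ∀ z, meromorphicOrderAt h z = meromorphicOrderAt q z := fun z =>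
    meromorphicOrderAt_toMeromorphicNFOn hqm (mem_univ z)
  have hha : ∀ z, AnalyticAt ℂ h z := fun z => by
    rw [← (hNF z).meromorphicOrderAt_nonneg_iff_analyticAt, hho, hqo]
    have h1 := add_le_add_left (hν z) ((-ν z : ℤ) : WithTop ℤ)
    rw [← WithTop.coe_add, add_neg_cancel] at h1
    exact h1
  have hqi : MeromorphicAt (fun w => q w⁻¹) 0 := hr'.mul hQi.1
  have hqi0 : Tendsto (fun w => q w⁻¹) (𝓝[≠] 0) (𝓝 0) := by
    refine tendsto_zero_of_meromorphicOrderAt_pos ?_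
    change 0 < meromorphicOrderAt ((fun w => r w⁻¹) * fun w => Q w⁻¹) 0
    rw [meromorphicOrderAt_mul hr' hQi.1, hQi.2]
    refine lt_of_lt_of_le ?_ (add_le_add_left hm _)
    rw [← WithTop.coe_add]
    exact_mod_cast (by linarith : 0 < m + ν.sum fun _ k => k)
  -- A normal form agrees with `q` only off a discrete set in general; near infinity `q` is analytic
  -- at every point, so there the values agree.
  have hhq : ∀ᶠ w in 𝓝[≠] (0 : ℂ), q w⁻¹ = h w⁻¹ := by
    filter_upwards [hqi.eventually_analyticAt, self_mem_nhdsWithin] with w hw hw0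
    have h1 : AnalyticAt ℂ q w⁻¹ := analyticAt_inv_comp hw0 hw
    have h2 := hqm.toMeromorphicNFOn_eq_self_on_nhdsNE (mem_univ w⁻¹)
    exact ((h1.meromorphicNFAt.eventuallyEq_nhdsNE_iff_eventuallyEq_nhds (hNF w⁻¹)).1
      h2.symm).self_of_nhds
  have hlim : Tendsto h (cocompact ℂ) (𝓝 0) := by
    have h1 : Tendsto (fun w => h w⁻¹) (𝓝[≠] 0) (𝓝 0) := hqi0.congr' hhq
    rw [← Metric.cobounded_eq_cocompact]
    refine (h1.comp tendsto_inv₀_cobounded').congr fun z => ?_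
    simp
  -- Liouville's theorem: an entire function tending to zero at infinity vanishes.
  have h0 : h = fun _ => 0 := funext fun z =>
    Differentiable.apply_eq_of_tendsto_cocompact (fun z => (hha z).differentiableAt) z hlim
  have h1 : meromorphicOrderAt h p = ⊤ := by
    rw [meromorphicOrderAt_eq_top_iff, h0]
    simp
  rw [hho, hqo, WithTop.add_eq_top] at h1
  exact h1.resolve_right (WithTop.coe_ne_top)

end MeromorphicDegree

/-! ### Holomorphic functions and sections on the sphere -/

namespace RiemannSphere

lemma chartAt_coe (z : ℂ) : chartAt ℂ (z : RiemannSphere) = affineChart :=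
  if_neg (OnePoint.coe_ne_infty z)

lemma chartAt_infty : chartAt ℂ (OnePoint.infty : RiemannSphere) = inftyChart :=
  if_pos rfl

lemma eventually_ofInv_eq : ∀ᶠ w in 𝓝[≠] (0 : ℂ), ofInv w = ((w⁻¹ : ℂ) : RiemannSphere) := by
  filter_upwards [self_mem_nhdsWithin] with w hw
  exact ofInv_of_ne hw

lemma eventually_coe_mem {z : ℂ} {U : Set RiemannSphere} (hU : U ∈ 𝓝 (z : RiemannSphere)) :
    ∀ᶠ u : ℂ in 𝓝 z, (u : RiemannSphere) ∈ U :=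
  OnePoint.continuous_coe.continuousAt.eventually hU

lemma eventually_ofInv_mem {U : Set RiemannSphere}
    (hU : U ∈ 𝓝 (OnePoint.infty : RiemannSphere)) : ∀ᶠ w in 𝓝 (0 : ℂ), ofInv w ∈ U := by
  rw [← ofInv_zero] at hU
  exact continuous_ofInv.continuousAt.eventually hU

section Functions

variable {E : Type*} [NormedAddCommGroup E] [NormedSpace ℂ E] [CompleteSpace E]

lemma contMDiffAt_iff_analyticAt {f : RiemannSphere → E} {p : RiemannSphere} :
    ContMDiffAt 𝓘(ℂ) 𝓘(ℂ, E) ω f p ↔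
      AnalyticAt ℂ (fun u => f ((chartAt ℂ p).symm u)) (chartAt ℂ p p) := by
  rw [contMDiffAt_iff_source, contMDiffWithinAt_iff_contDiffWithinAt]
  simp only [extChartAt, mfld_simps, contDiffWithinAt_univ]
  exact ⟨fun h => h.analyticAt, fun h => h.contDiffAt⟩

lemma contMDiffAt_coe_iff {f : RiemannSphere → E} {z : ℂ} :
    ContMDiffAt 𝓘(ℂ) 𝓘(ℂ, E) ω f z ↔ AnalyticAt ℂ (fun u : ℂ => f u) z := by
  rw [contMDiffAt_iff_analyticAt, chartAt_coe]
  rfl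

lemma contMDiffAt_infty_iff {f : RiemannSphere → E} :
    ContMDiffAt 𝓘(ℂ) 𝓘(ℂ, E) ω f OnePoint.infty ↔ AnalyticAt ℂ (fun w => f (ofInv w)) 0 := by
  rw [contMDiffAt_iff_analyticAt, chartAt_infty]
  rfl

end Functions

end RiemannSphere

open RiemannSphere

lemma analyticAt_update_of_tendsto {E : Type*} [NormedAddCommGroup E] [NormedSpace ℂ E]
    [CompleteSpace E] {f : ℂ → E} {p : ℂ} {ℓ : E}
    (hf : ∀ᶠ u in 𝓝[≠] p, DifferentiableAt ℂ f u) (h : Tendsto f (𝓝[≠] p) (𝓝 ℓ)) :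
    AnalyticAt ℂ (Function.update f p ℓ) p := by
  refine Complex.analyticAt_of_differentiable_on_punctured_nhds_of_continuousAt ?_
    (continuousAt_update_same.2 h)
  filter_upwards [hf, self_mem_nhdsWithin] with u hu hup
  refine hu.congr_of_eventuallyEq ?_
  filter_upwards [isOpen_ne.mem_nhds hup] with v hv
  exact Function.update_of_ne hv _ _

/-! ### Top-degree alternating forms and determinants -/

section Determinant

variable {V : Type*} [AddCommGroup V] [Module ℂ V] {ι : Type*} [Fintype ι] [DecidableEq ι]

/-- Cramer's rule without division. -/
lemma det_update_sum_smul (D : V [⋀^ι]→ₗ[ℂ] ℂ) (u : ι → V) (c : ι → ℂ) (i : ι) :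
    D (Function.update u i (∑ j, c j • u j)) = c i * D u := by
  rw [D.map_update_sum, Finset.sum_eq_single i]
  · simp
  · intro j _ hj
    rw [D.map_update_smul, D.map_update_self _ hj.symm, smul_zero]
  · simp

/-- Top-degree forms are proportional, so ratios of their values do not depend on the form. -/
lemma alternating_mul_det (b : Module.Basis ι ℂ V) (D : V [⋀^ι]→ₗ[ℂ] ℂ) (u v : ι → V) :
    D u * b.det v = D v * b.det u := by
  rw [D.eq_smul_basis_det b]
  simp only [AlternatingMap.smul_apply, smul_eq_mul]
  ring

lemma linearIndependent_iff_det_ne_zero (b : Module.Basis ι ℂ V) {v : ι → V} :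
    LinearIndependent ℂ v ↔ b.det v ≠ 0 := by
  rw [← isUnit_iff_ne_zero, ← b.is_basis_iff_det, iff_self_and]
  intro h
  have : FiniteDimensional ℂ V := Module.Finite.of_basis b
  exact h.span_eq_top_of_card_eq_finrank' (Module.finrank_eq_card_basis b).symm

end Determinant

section DeterminantSmooth

variable {F : Type*} [NormedAddCommGroup F] [NormedSpace ℂ F] {ι : Type*} [Fintype ι]
  [DecidableEq ι]

lemma contDiff_basis_det (b : Module.Basis ι ℂ F) :
    ContDiff ℂ ω (fun v : ι → F => b.det v) := by
  have : FiniteDimensional ℂ F := Module.Finite.of_basis b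
  have hc : ∀ i j, ContDiff ℂ ω (fun v : ι → F => b.repr (v j) i) := fun i j =>
    ((LinearMap.toContinuousLinearMap (b.coord i)).contDiff).comp (contDiff_apply ℂ F j)
  simp only [Module.Basis.det_apply, Matrix.det_apply, Module.Basis.toMatrix_apply]
  exact ContDiff.sum fun σ _ => (contDiff_prod fun i _ => hc _ _).const_smul _

lemma analyticAt_basis_det (b : Module.Basis ι ℂ F) {f : ι → ℂ → F} {p : ℂ}
    (hf : ∀ i, AnalyticAt ℂ (f i) p) : AnalyticAt ℂ (fun u => b.det fun i => f i u) p := by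
  have : FiniteDimensional ℂ F := Module.Finite.of_basis b
  have h1 : AnalyticAt ℂ (fun v : ι → F => b.det v) (fun i => f i p) :=
    (contDiff_basis_det b).contDiffAt.analyticAt
  exact h1.comp (AnalyticAt.pi hf)

end DeterminantSmooth

/-! ### Holomorphic sections in local coordinates -/

section Sections

variable {F : Type*} [NormedAddCommGroup F] [NormedSpace ℂ F]
  {W : RiemannSphere → Type*} [TopologicalSpace (TotalSpace F W)]
  [∀ x, AddCommGroup (W x)] [∀ x, Module ℂ (W x)] [∀ x, TopologicalSpace (W x)]
  [FiberBundle F W]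

variable (F) in
/-- The section `s` of `W` is holomorphic at `x`. -/
def IsHolomorphicSectionAt (s : ∀ x, W x) (x : RiemannSphere) : Prop :=
  ContMDiffAt 𝓘(ℂ) (𝓘(ℂ).prod 𝓘(ℂ, F)) ω (fun y => TotalSpace.mk' F y (s y)) x

lemma isHolomorphicSectionAt_congr {s t : ∀ x, W x} {x : RiemannSphere}
    (hs : IsHolomorphicSectionAt F s x) (h : ∀ᶠ y in 𝓝 x, t y = s y) :
    IsHolomorphicSectionAt F t x :=
  ContMDiffAt.congr_of_eventuallyEq hs (h.mono fun y hy => congrArg (TotalSpace.mk' F y) hy)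

variable [VectorBundle ℂ F W]

variable (F) in
/-- The coordinates at `y` given by the preferred trivialization at `x`. -/
noncomputable def localCoord (x y : RiemannSphere) : W y →L[ℂ] F :=
  (trivializationAt F W x).continuousLinearMapAt ℂ y

lemma localCoord_apply {x y : RiemannSphere} (hy : y ∈ (trivializationAt F W x).baseSet)
    (v : W y) : localCoord F x y v = (trivializationAt F W x ⟨y, v⟩).2 := by
  exact congrFun (Trivialization.coe_linearMapAt_of_mem (R := ℂ) _ hy) v

variable (F) in
/-- `localCoord` as an equivalence. -/
noncomputable def localCoordEquiv {x y : RiemannSphere}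
    (hy : y ∈ (trivializationAt F W x).baseSet) : W y ≃ₗ[ℂ] F :=
  ((trivializationAt F W x).continuousLinearEquivAt ℂ y hy).toLinearEquiv

lemma localCoordEquiv_apply {x y : RiemannSphere}
    (hy : y ∈ (trivializationAt F W x).baseSet) (v : W y) :
    localCoordEquiv F hy v = localCoord F x y v := by
  rw [localCoord_apply hy]
  rfl

lemma linearIndependent_localCoord_iff {ι : Type*} {x y : RiemannSphere}
    (hy : y ∈ (trivializationAt F W x).baseSet) {v : ι → W y} :
    LinearIndependent ℂ (fun i => localCoord F x y (v i)) ↔ LinearIndependent ℂ v := by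
  have h := LinearMap.linearIndependent_iff (localCoordEquiv F hy : W y →ₗ[ℂ] F) (v := v)
    (LinearEquiv.ker _)
  rw [← h]
  have h' : (fun i => localCoord F x y (v i)) = (localCoordEquiv F hy : W y →ₗ[ℂ] F) ∘ v :=
    funext fun i => (localCoordEquiv_apply hy _).symm
  rw [h']

lemma baseSet_mem_nhds (x : RiemannSphere) : (trivializationAt F W x).baseSet ∈ 𝓝 x :=
  (trivializationAt F W x).open_baseSet.mem_nhds (mem_baseSet_trivializationAt F W x)

lemma IsHolomorphicSectionAt.sum_smul {ι : Type*} {t : Finset ι} {s : ι → ∀ x, W x}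
    {c : ι → RiemannSphere → ℂ} {x : RiemannSphere}
    (hc : ∀ i ∈ t, ContMDiffAt 𝓘(ℂ) 𝓘(ℂ) ω (c i) x)
    (hs : ∀ i ∈ t, IsHolomorphicSectionAt F (s i) x) :
    IsHolomorphicSectionAt F (fun y => ∑ i ∈ t, c i y • s i y) x :=
  ContMDiffAt.sum_section fun i hi => ContMDiffAt.smul_section (hc i hi) (hs i hi)

variable [ContMDiffVectorBundle ω F W 𝓘(ℂ)]

lemma isHolomorphicSectionAt_iff {s : ∀ x, W x} {x y : RiemannSphere}
    (hy : y ∈ (trivializationAt F W x).baseSet) :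
    IsHolomorphicSectionAt F s y ↔
      ContMDiffAt 𝓘(ℂ) 𝓘(ℂ, F) ω (fun y => localCoord F x y (s y)) y := by
  rw [IsHolomorphicSectionAt, Trivialization.contMDiffAt_section_iff (trivializationAt F W x) hy]
  refine Filter.EventuallyEq.contMDiffAt_iff ?_
  filter_upwards [(trivializationAt F W x).open_baseSet.mem_nhds hy] with u hu
  rw [localCoord_apply hu]

variable [FiniteDimensional ℂ F]

lemma isHolomorphicSectionAt_iff_analyticAt {s : ∀ x, W x} {x : RiemannSphere} :
    IsHolomorphicSectionAt F s x ↔ AnalyticAt ℂ (fun u => localCoord F x ((chartAt ℂ x).symm u)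
      (s ((chartAt ℂ x).symm u))) (chartAt ℂ x x) := by
  have : CompleteSpace F := FiniteDimensional.complete ℂ F
  rw [isHolomorphicSectionAt_iff (mem_baseSet_trivializationAt F W x), contMDiffAt_iff_analyticAt]

lemma isHolomorphicSectionAt_coe_iff {s : ∀ x, W x} {x : RiemannSphere} {z : ℂ}
    (hz : (z : RiemannSphere) ∈ (trivializationAt F W x).baseSet) :
    IsHolomorphicSectionAt F s z ↔
      AnalyticAt ℂ (fun u : ℂ => localCoord F x u (s u)) z := by
  have : CompleteSpace F := FiniteDimensional.complete ℂ F
  rw [isHolomorphicSectionAt_iff hz, contMDiffAt_coe_iff]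

lemma isHolomorphicSectionAt_infty_iff {s : ∀ x, W x} :
    IsHolomorphicSectionAt F s OnePoint.infty ↔
      AnalyticAt ℂ (fun w => localCoord F OnePoint.infty (ofInv w) (s (ofInv w))) 0 := by
  have : CompleteSpace F := FiniteDimensional.complete ℂ F
  rw [isHolomorphicSectionAt_iff (mem_baseSet_trivializationAt F W _), contMDiffAt_infty_iff]

/-- A holomorphic section on a punctured neighbourhood of a point of the plane, with a limit in
coordinates, extends holomorphically. -/
lemma isHolomorphicSectionAt_update {s : ∀ x, W x} {z : ℂ} {ℓ : F}
    (hs : ∀ u : ℂ, u ≠ z → IsHolomorphicSectionAt F s u)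
    (h : Tendsto (fun u : ℂ => localCoord F z u (s u)) (𝓝[≠] z) (𝓝 ℓ)) :
    ∃ t : ∀ x, W x, (∀ x : RiemannSphere, x ≠ z → t x = s x) ∧ ∀ u : ℂ, IsHolomorphicSectionAt F t u := by
  classical
  have : CompleteSpace F := FiniteDimensional.complete ℂ F
  have hz := mem_baseSet_trivializationAt F W (z : RiemannSphere)
  refine ⟨Function.update s z ((localCoordEquiv F hz).symm ℓ),
    fun x hx => Function.update_of_ne hx _ _, fun u => ?_⟩
  have hcoe : ∀ u : ℂ, u ≠ z → (u : RiemannSphere) ≠ z := fun u hu h =>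
    hu (OnePoint.coe_injective h)
  rcases eq_or_ne u z with rfl | hu
  · rw [isHolomorphicSectionAt_coe_iff hz]
    refine (analyticAt_update_of_tendsto (f := fun v : ℂ => localCoord F u v (s v)) ?_ h).congr
      (Eventually.of_forall fun v => ?_)
    · filter_upwards [self_mem_nhdsWithin, nhdsWithin_le_nhds
        (eventually_coe_mem (baseSet_mem_nhds (F := F) (W := W) (u : RiemannSphere)))] with v hv hv'
      exact ((isHolomorphicSectionAt_coe_iff hv').1 (hs v hv)).differentiableAt
    · rcases eq_or_ne v u with rfl | hv
      · simp [← localCoordEquiv_apply hz]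
      · simp only [Function.update_of_ne hv, Function.update_of_ne (hcoe v hv)]
  · refine isHolomorphicSectionAt_congr (hs u hu) ?_
    filter_upwards [isOpen_ne.mem_nhds (hcoe u hu)] with v hv
    exact Function.update_of_ne hv _ _

end Sections

/-! ### Pole orders at infinity and their reduction -/

section LeadingTerm

variable {F : Type*} [NormedAddCommGroup F] [NormedSpace ℂ F]
  {W : RiemannSphere → Type*} [TopologicalSpace (TotalSpace F W)]
  [∀ x, AddCommGroup (W x)] [∀ x, Module ℂ (W x)] [∀ x, TopologicalSpace (W x)]
  [FiberBundle F W] [VectorBundle ℂ F W]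

/-- Near infinity, in coordinates, `s z` is `ℓ * z ^ d` up to terms of lower order. -/
def HasLeadingTerm (s : ∀ x, W x) (d : ℤ) (ℓ : F) : Prop :=
  Tendsto (fun w : ℂ => w ^ d • localCoord F OnePoint.infty ((w⁻¹ : ℂ) : RiemannSphere)
    (s ((w⁻¹ : ℂ) : RiemannSphere))) (𝓝[≠] 0) (𝓝 ℓ)

namespace HasLeadingTerm

variable {s t : ∀ x, W x} {d : ℤ} {ℓ : F}

lemma congr (h : HasLeadingTerm s d ℓ)
    (hst : ∀ᶠ w : ℂ in 𝓝[≠] 0, s ((w⁻¹ : ℂ) : RiemannSphere) = t ((w⁻¹ : ℂ) : RiemannSphere)) :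
    HasLeadingTerm t d ℓ := by
  refine Tendsto.congr' ?_ h
  filter_upwards [hst] with w hw
  rw [hw]

lemma smul (h : HasLeadingTerm s d ℓ) {f : ℂ → ℂ} {k : ℤ} {c : ℂ}
    (hf : Tendsto (fun w : ℂ => w ^ k * f w⁻¹) (𝓝[≠] 0) (𝓝 c)) :
    HasLeadingTerm (fun x => f (coord x) • s x) (d + k) (c • ℓ) := by
  refine (hf.smul h).congr' ?_
  filter_upwards [self_mem_nhdsWithin] with w hw
  rw [map_smul, smul_smul, smul_smul, coord_coe, zpow_add₀ hw]
  congr 1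
  ring

/-- The leading coefficient may be zero: `d` only bounds the pole order, so it can be raised. -/
lemma of_le (h : HasLeadingTerm s d ℓ) {d' : ℤ} (hd : d ≤ d') :
    ∃ ℓ' : F, HasLeadingTerm s d' ℓ' := by
  obtain ⟨m, rfl⟩ := Int.le.dest hd
  have h1 : Tendsto (fun w : ℂ => w ^ (m : ℤ) * 1) (𝓝[≠] 0) (𝓝 ((0 : ℂ) ^ m)) := by
    simp only [zpow_natCast, mul_one]
    exact ((continuous_pow m).tendsto 0).mono_left nhdsWithin_le_nhds
  have h2 := h.smul (f := fun _ => 1) h1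
  exact ⟨_, h2.congr (Eventually.of_forall fun w => one_smul ℂ _)⟩

lemma sum {ι : Type*} {S : Finset ι} {s : ι → ∀ x, W x} {ℓ : ι → F}
    (h : ∀ i ∈ S, HasLeadingTerm (s i) d (ℓ i)) :
    HasLeadingTerm (fun x => ∑ i ∈ S, s i x) d (∑ i ∈ S, ℓ i) := by
  refine (tendsto_finsetSum S h).congr fun w => ?_
  rw [map_sum, Finset.smul_sum]

variable [ContMDiffVectorBundle ω F W 𝓘(ℂ)] [FiniteDimensional ℂ F]

/-- The existence of a limit makes the singularity at w = 0 removable. -/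
lemma analyticAt (h : HasLeadingTerm s d ℓ) (hs : ∀ z : ℂ, IsHolomorphicSectionAt F s z) :
    ∃ g : ℂ → F, AnalyticAt ℂ g 0 ∧ g 0 = ℓ ∧ ∀ w, w ≠ 0 →
      g w = w ^ d • localCoord F OnePoint.infty ((w⁻¹ : ℂ) : RiemannSphere)
        (s ((w⁻¹ : ℂ) : RiemannSphere)) := by
  have : CompleteSpace F := FiniteDimensional.complete ℂ F
  refine ⟨_, analyticAt_update_of_tendsto ?_ h, Function.update_self _ _ _,
    fun w hw => Function.update_of_ne hw _ _⟩
  filter_upwards [self_mem_nhdsWithin, nhdsWithin_le_nhds (eventually_ofInv_mem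
    (baseSet_mem_nhds (F := F) (W := W) OnePoint.infty))] with w hw hw'
  rw [ofInv_of_ne hw] at hw'
  have h1 := ((isHolomorphicSectionAt_coe_iff hw').1 (hs w⁻¹)).differentiableAt
  exact (differentiableAt_zpow.2 (Or.inl hw)).smul (h1.comp w (differentiableAt_inv hw))

/-- An analytic function vanishing at 0 is divisible by `w`; the new coefficient is its derivative
at 0. -/
lemma sub_one (h : HasLeadingTerm s d (0 : F)) (hs : ∀ z : ℂ, IsHolomorphicSectionAt F s z) :
    ∃ ℓ' : F, HasLeadingTerm s (d - 1) ℓ' := by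
  obtain ⟨g, hg, hg0, hgw⟩ := h.analyticAt hs
  refine ⟨deriv g 0, (hasDerivAt_iff_tendsto_slope.1 hg.differentiableAt.hasDerivAt).congr' ?_⟩
  filter_upwards [self_mem_nhdsWithin] with w hw
  rw [slope_def_module, hg0, hgw w hw, sub_zero, sub_zero, smul_smul, zpow_sub_one₀ hw, mul_comm]

end HasLeadingTerm

variable {ι : Type*} [Fintype ι] [DecidableEq ι]

/-- A family of sections, holomorphic on the plane, meromorphic at infinity with poles of order at
most `d`, and generically linearly independent. -/
structure IsSectionSystem (s : ι → ∀ x, W x) (d : ι → ℤ) (ℓ : ι → F) : Prop where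
  holomorphic : ∀ i, ∀ z : ℂ, IsHolomorphicSectionAt F (s i) z
  leading : ∀ i, HasLeadingTerm (s i) (d i) (ℓ i)
  independent : ∃ z : ℂ, LinearIndependent ℂ fun i => s i (z : RiemannSphere)

namespace IsSectionSystem

variable {s : ι → ∀ x, W x} {d : ι → ℤ} {ℓ : ι → F}

/-- The replacement preserves independence at `z`, since the new section involves `s j` there with
nonzero coefficient. -/
lemma update (h : IsSectionSystem s d ℓ) {j : ι} {t : ∀ x, W x} {ℓ' : F}
    (ht : ∀ z : ℂ, IsHolomorphicSectionAt F t z) (htℓ : HasLeadingTerm t (d j - 1) ℓ') {z : ℂ}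
    (hz : LinearIndependent ℂ fun i => s i (z : RiemannSphere)) {c : ι → ℂ} (hc : c j ≠ 0)
    (htz : t z = ∑ i, c i • s i (z : RiemannSphere)) :
    ∃ (s' : ι → ∀ x, W x) (d' : ι → ℤ) (ℓ' : ι → F), IsSectionSystem s' d' ℓ' ∧
      ∑ i, d' i < ∑ i, d i := by
  refine ⟨Function.update s j t, Function.update d j (d j - 1), Function.update ℓ j ℓ',
    ⟨?_, ?_, z, ?_⟩, ?_⟩
  · intro i
    rcases eq_or_ne i j with rfl | hij
    · rwa [Function.update_self]
    · rw [Function.update_of_ne hij]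
      exact h.holomorphic i
  · intro i
    rcases eq_or_ne i j with rfl | hij
    · simpa only [Function.update_self] using htℓ
    · simp only [Function.update_of_ne hij]
      exact h.leading i
  · have h1 : (fun i => Function.update s j t i (z : RiemannSphere)) =
        Function.update (fun i => s i (z : RiemannSphere)) j (t z) := by
      funext i
      rcases eq_or_ne i j with rfl | hij
      · simp
      · simp [Function.update_of_ne hij]
    rw [h1]
    refine hz.update j _ ⟨1, one_mem _, Finsupp.equivFunOnFinite.symm c,
      mem_nonZeroDivisors_of_ne_zero hc, ?_⟩
    rw [one_smul, htz, Finsupp.linearCombination_apply, Finsupp.sum_fintype _ _ (by simp)]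
    rfl
  · refine Finset.sum_lt_sum (fun i _ => ?_) ⟨j, Finset.mem_univ j, by simp⟩
    rcases eq_or_ne i j with rfl | hij
    · simp
    · simp [Function.update_of_ne hij]

lemma exists_max_degree {c : ι → ℂ} (hc : ∃ i, c i ≠ 0) (d : ι → ℤ) :
    ∃ j, c j ≠ 0 ∧ ∀ i, c i ≠ 0 → d i ≤ d j := by
  obtain ⟨i, hi⟩ := hc
  obtain ⟨j, hj, hmax⟩ := (Finset.univ.filter fun i => c i ≠ 0).exists_max_image d
    ⟨i, by simpa using hi⟩
  exact ⟨j, by simpa using hj, fun i hi => hmax i (by simpa using hi)⟩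

variable [ContMDiffVectorBundle ω F W 𝓘(ℂ)] [FiniteDimensional ℂ F]

/-- A relation ∑ c_i s_i(z₀) = 0 makes (∑ c_i s_i) / (z - z₀) holomorphic on the plane, and the
division lowers the order at infinity by one. It replaces a section of largest `d` among those with
c_i ≠ 0. -/
lemma exists_lt_of_not_linearIndependent (h : IsSectionSystem s d ℓ) {z₀ : ℂ}
    (hz₀ : ¬ LinearIndependent ℂ fun i => s i (z₀ : RiemannSphere)) :
    ∃ (s' : ι → ∀ x, W x) (d' : ι → ℤ) (ℓ' : ι → F), IsSectionSystem s' d' ℓ' ∧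
      ∑ i, d' i < ∑ i, d i := by
  obtain ⟨c, hc0, hc⟩ := Fintype.not_linearIndependent_iff.1 hz₀
  obtain ⟨j, hj, hmax⟩ := exists_max_degree hc d
  obtain ⟨z₁, hz₁⟩ := h.independent
  have hne : z₁ ≠ z₀ := fun e => hz₀ (e ▸ hz₁)
  set u : ∀ x, W x := fun x => ∑ i, c i • s i x with hu
  have huh : ∀ z : ℂ, IsHolomorphicSectionAt F u z := fun z =>
    IsHolomorphicSectionAt.sum_smul (c := fun i _ => c i) (fun i _ => contMDiffAt_const)
      fun i _ => h.holomorphic i z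
  have hul : ∃ ℓ' : F, HasLeadingTerm u (d j) ℓ' := by
    have h1 : ∀ i, ∃ ℓ' : F, HasLeadingTerm (fun x => c i • s i x) (d j) ℓ' := by
      intro i
      by_cases hi : c i = 0
      · refine ⟨0, tendsto_const_nhds.congr fun w => ?_⟩
        simp [hi]
      · obtain ⟨ℓ', hℓ'⟩ := (h.leading i).of_le (hmax i hi)
        have h2 := hℓ'.smul (f := fun _ => c i) (k := 0) (c := c i) (by simp)
        rw [add_zero] at h2
        exact ⟨_, h2⟩
    choose ℓ' hℓ' using h1
    exact ⟨_, HasLeadingTerm.sum fun i _ => hℓ' i⟩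
  obtain ⟨ℓ', hℓ'⟩ := hul
  have hql : HasLeadingTerm (fun x => (coord x - z₀)⁻¹ • u x) (d j - 1) ((1 : ℂ) • ℓ') := by
    refine hℓ'.smul (f := fun z => (z - z₀)⁻¹) (k := -1) (c := 1) ?_
    have h1 : Tendsto (fun w : ℂ => (1 - w * z₀)⁻¹) (𝓝[≠] 0) (𝓝 1) := by
      have h2 : ContinuousAt (fun w : ℂ => (1 - w * z₀)⁻¹) 0 :=
        ContinuousAt.inv₀ (by fun_prop) (by simp)
      simpa using h2.tendsto.mono_left nhdsWithin_le_nhds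
    refine h1.congr' ?_
    filter_upwards [self_mem_nhdsWithin] with w hw
    have hw' : w ≠ 0 := hw
    rw [zpow_neg_one, ← mul_inv, mul_sub, mul_inv_cancel₀ hw']
  have hqh : ∀ z : ℂ, z ≠ z₀ →
      IsHolomorphicSectionAt F (fun x => (coord x - z₀)⁻¹ • u x) z := by
    intro z hz
    refine ContMDiffAt.smul_section (contMDiffAt_coe_iff.2 ?_) (huh z)
    exact (analyticAt_id.sub analyticAt_const).inv (sub_ne_zero.2 hz)
  have hmem := mem_baseSet_trivializationAt F W (z₀ : RiemannSphere)
  have hlim : Tendsto (fun z : ℂ => localCoord F (z₀ : RiemannSphere) z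
      ((coord (z : RiemannSphere) - z₀)⁻¹ • u z)) (𝓝[≠] z₀)
      (𝓝 (deriv (fun z : ℂ => localCoord F (z₀ : RiemannSphere) z (u z)) z₀)) := by
    have h1 := ((isHolomorphicSectionAt_coe_iff hmem).1 (huh z₀)).differentiableAt.hasDerivAt
    refine (hasDerivAt_iff_tendsto_slope.1 h1).congr fun z => ?_
    rw [slope_def_module, map_smul, coord_coe]
    have h2 : u (z₀ : RiemannSphere) = 0 := hc0
    rw [h2, map_zero, sub_zero]
  obtain ⟨t, htq, hth⟩ := isHolomorphicSectionAt_update hqh hlim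
  have hcoe : ∀ z : ℂ, z ≠ z₀ → (z : RiemannSphere) ≠ z₀ := fun z hz h =>
    hz (OnePoint.coe_injective h)
  refine h.update (j := j) (t := t) hth (hql.congr ?_) hz₁
    (c := fun i => (z₁ - z₀)⁻¹ * c i) (mul_ne_zero (inv_ne_zero (sub_ne_zero.2 hne)) hj) ?_
  · have h1 : ∀ᶠ w : ℂ in 𝓝[≠] 0, w⁻¹ ≠ z₀ := by
      have h2 : Tendsto (fun w : ℂ => w⁻¹) (𝓝[≠] 0) (Bornology.cobounded ℂ) :=
        tendsto_inv₀_nhdsNE_zero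
      exact h2.eventually (Bornology.eventually_ne_cobounded z₀)
    filter_upwards [h1] with w hw
    exact (htq _ (hcoe _ hw)).symm
  · rw [htq _ (hcoe _ hne)]
    simp only [hu, coord_coe, Finset.smul_sum, smul_smul]

/-- A relation ∑ c_i ℓ_i = 0 makes the leading terms cancel in ∑ c_i z^(d_j - d_i) s_i, where d_j is
maximal among the c_i ≠ 0; maximality makes the exponents that occur nonnegative, so no pole arises
in the plane. -/
lemma exists_lt_of_not_linearIndependent_leading (h : IsSectionSystem s d ℓ)
    (hℓ : ¬ LinearIndependent ℂ ℓ) :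
    ∃ (s' : ι → ∀ x, W x) (d' : ι → ℤ) (ℓ' : ι → F), IsSectionSystem s' d' ℓ' ∧
      ∑ i, d' i < ∑ i, d i := by
  obtain ⟨c, hc0, hc⟩ := Fintype.not_linearIndependent_iff.1 hℓ
  obtain ⟨j, hj, hmax⟩ := exists_max_degree hc d
  obtain ⟨z₁, hz₁⟩ := h.independent
  set f : ι → ℂ → ℂ := fun i z => c i * z ^ (d j - d i).toNat with hf
  set u : ∀ x, W x := fun x => ∑ i, f i (coord x) • s i x with hu
  have huh : ∀ z : ℂ, IsHolomorphicSectionAt F u z := fun z =>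
    IsHolomorphicSectionAt.sum_smul (c := fun i x => f i (coord x))
      (fun i _ => contMDiffAt_coe_iff.2 (analyticAt_const.mul (analyticAt_id.pow _)))
      fun i _ => h.holomorphic i z
  have hul : HasLeadingTerm u (d j) (0 : F) := by
    rw [← hc0]
    refine HasLeadingTerm.sum fun i _ => ?_
    by_cases hi : c i = 0
    · rw [hi, zero_smul]
      refine tendsto_const_nhds.congr fun w => ?_
      simp [hf, hi]
    · have h1 : ((d j - d i).toNat : ℤ) = d j - d i :=
        Int.toNat_of_nonneg (sub_nonneg.2 (hmax i hi))
      have h2 := (h.leading i).smul (f := f i) (k := d j - d i) (c := c i) (by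
        refine tendsto_const_nhds.congr' ?_
        filter_upwards [self_mem_nhdsWithin] with w hw
        have hw' : w ≠ 0 := hw
        simp only [hf]
        rw [← zpow_natCast, h1, inv_zpow]
        field_simp)
      rwa [add_sub_cancel] at h2
  obtain ⟨ℓ', hℓ'⟩ := hul.sub_one huh
  exact h.update (c := fun i => f i z₁) huh hℓ' hz₁ (by simpa [hf] using hj) rfl

end IsSectionSystem

end LeadingTerm

lemma exists_finsupp_plane (ν : RiemannSphere →₀ ℤ) :
    ∃ μ : ℂ →₀ ℤ, (∀ z : ℂ, μ z = ν (z : RiemannSphere)) ∧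
      (ν.sum fun _ m => m) = (μ.sum fun _ m => m) + ν OnePoint.infty := by
  refine ⟨Finsupp.some (α := ℂ) ν, fun z => rfl, ?_⟩
  rw [add_comm]
  exact Finsupp.sum_option_index (α := ℂ) ν (fun _ m => m) (fun _ => rfl) fun _ _ _ => rfl

/-! ### The degree of the bundle and the pole orders of a section system -/

section DegreeBound

variable {F : Type*} [NormedAddCommGroup F] [NormedSpace ℂ F]
  {W : RiemannSphere → Type*} [TopologicalSpace (TotalSpace F W)]
  [∀ x, AddCommGroup (W x)] [∀ x, Module ℂ (W x)] [∀ x, TopologicalSpace (W x)]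
  [FiberBundle F W] [VectorBundle ℂ F W] [ContMDiffVectorBundle ω F W 𝓘(ℂ)]
  [FiniteDimensional ℂ F]

lemma tendsto_chartAt_symm (p : RiemannSphere) :
    Tendsto (chartAt ℂ p).symm (𝓝 (chartAt ℂ p p)) (𝓝 p) := by
  have h := (chartAt ℂ p).continuousAt_symm (mem_chart_target ℂ p)
  rwa [ContinuousAt, (chartAt ℂ p).left_inv (mem_chart_source ℂ p)] at h

/-- In terms of a meromorphic section `η` of the dual of the determinant bundle: the order of
`η (s₁, …, sₙ)` differs from the order of `η` by the order of the determinant of the coordinates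
of the `sᵢ`. -/
lemma HasDegree.exists_form {n : ℕ} {d : ℤ} (h : HasDegree F W n (fun _ => ⊤) d)
    (b : Module.Basis (Fin n) ℂ F) :
    ∃ (η : ∀ x, W x [⋀^Fin n]→ₗ[ℂ] ℂ) (ν : RiemannSphere →₀ ℤ), (d = -ν.sum fun _ m => m) ∧
      ∀ p (s : Fin n → ∀ x, W x),
        MeromorphicAt (fun u => b.det fun i => localCoord F p ((chartAt ℂ p).symm u)
          (s i ((chartAt ℂ p).symm u))) (chartAt ℂ p p) →
        MeromorphicAt (fun u => η ((chartAt ℂ p).symm u) fun i => s i ((chartAt ℂ p).symm u))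
          (chartAt ℂ p p) ∧
        meromorphicOrderAt
          (fun u => η ((chartAt ℂ p).symm u) fun i => s i ((chartAt ℂ p).symm u))
          (chartAt ℂ p p) = ν p + meromorphicOrderAt
            (fun u => b.det fun i => localCoord F p ((chartAt ℂ p).symm u)
              (s i ((chartAt ℂ p).symm u))) (chartAt ℂ p p) := by
  obtain ⟨η, ν, hη, hd⟩ := h
  refine ⟨η, ν, hd, fun p s hs => ?_⟩
  obtain ⟨U, hUo, hpU, t, ht, hm, ho⟩ := hη p
  set ψ := (chartAt ℂ p).symm with hψ
  set q := chartAt ℂ p p with hq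
  have hψq : ψ q = p := (chartAt ℂ p).left_inv (mem_chart_source ℂ p)
  set T : ℂ → ℂ := fun u => b.det fun i => localCoord F p (ψ u) (t i (ψ u)) with hT
  have hTa : AnalyticAt ℂ T q := analyticAt_basis_det b fun i =>
    isHolomorphicSectionAt_iff_analyticAt.1 ((ht.holomorphic i).contMDiffAt (hUo.mem_nhds hpU))
  have hT0 : T q ≠ 0 := by
    rw [hT]
    dsimp only
    rw [hψq, ← linearIndependent_iff_det_ne_zero b,
      linearIndependent_localCoord_iff (mem_baseSet_trivializationAt F W p)]
    exact ht.linearIndependent p hpU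
  have hTi : AnalyticAt ℂ T⁻¹ q := hTa.inv hT0
  have hTo : meromorphicOrderAt T⁻¹ q = 0 := by
    rw [hTi.meromorphicOrderAt_eq, hTi.analyticOrderAt_eq_zero.2 (inv_ne_zero hT0)]
    rfl
  -- Proportionality of top forms compares `s` with the local frame `t`, whose coordinate
  -- determinant `T` is invertible and so has order zero.
  have hev : ∀ᶠ u in 𝓝 q, η (ψ u) (fun i => s i (ψ u)) =
      η (ψ u) (fun i => t i (ψ u)) *
        ((b.det fun i => localCoord F p (ψ u) (s i (ψ u))) * T⁻¹ u) := by
    filter_upwards [(tendsto_chartAt_symm p).eventually (baseSet_mem_nhds (F := F) (W := W) p),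
      hTa.continuousAt.eventually_ne hT0] with u hu hTu
    set L := localCoordEquiv F hu with hL
    have h1 := alternating_mul_det (b.map L.symm) (η (ψ u)) (fun i => s i (ψ u))
      (fun i => t i (ψ u))
    simp only [Module.Basis.det_map, LinearEquiv.symm_symm, Function.comp_def, hL,
      localCoordEquiv_apply] at h1
    rw [← mul_assoc, ← h1, mul_assoc, Pi.inv_apply]
    exact (mul_inv_cancel_right₀ hTu _).symm.trans (mul_assoc _ _ _)
  have hev' := hev.filter_mono (nhdsWithin_le_nhds (s := {q}ᶜ))
  have hprod := hs.mul hTi.meromorphicAt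
  refine ⟨(hm.mul hprod).congr (hev'.mono fun u hu => hu.symm), ?_⟩
  rw [meromorphicOrderAt_congr hev', ← ho]
  refine (meromorphicOrderAt_mul hm hprod).trans ?_
  rw [meromorphicOrderAt_mul hs hTi.meromorphicAt, hTo, add_zero]

namespace IsSectionSystem

variable {n : ℕ} {s : Fin n → ∀ x, W x} {d : Fin n → ℤ} {ℓ : Fin n → F}

/-- The coordinates at infinity of a section system. -/
lemma exists_det_infty (h : IsSectionSystem s d ℓ) (b : Module.Basis (Fin n) ℂ F) :
    ∃ G : ℂ → ℂ, AnalyticAt ℂ G 0 ∧ G 0 = b.det ℓ ∧ ∀ w, w ≠ 0 →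
      (b.det fun i => localCoord F OnePoint.infty ((w⁻¹ : ℂ) : RiemannSphere)
        (s i ((w⁻¹ : ℂ) : RiemannSphere))) = w ^ (-∑ i, d i) * G w := by
  choose g hg hg0 hgw using fun i => (h.leading i).analyticAt (h.holomorphic i)
  refine ⟨_, analyticAt_basis_det b hg, by simp only [hg0], fun w hw => ?_⟩
  have hp : ∀ S : Finset (Fin n), ∏ i ∈ S, w ^ d i = w ^ ∑ i ∈ S, d i := by
    intro S
    induction S using Finset.induction_on with
    | empty => simp
    | insert i S hi ih => rw [Finset.prod_insert hi, Finset.sum_insert hi, ih, zpow_add₀ hw]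
  simp only [fun i => hgw i w hw]
  rw [AlternatingMap.map_smul_univ, hp, smul_eq_mul, ← mul_assoc, ← zpow_add₀ hw,
    neg_add_cancel, zpow_zero, one_mul]

/-- The order at infinity of the determinant of a section system. -/
lemma meromorphicOrderAt_det_infty (h : IsSectionSystem s d ℓ) (b : Module.Basis (Fin n) ℂ F) :
    MeromorphicAt (fun w => b.det fun i => localCoord F OnePoint.infty (ofInv w)
      (s i (ofInv w))) 0 ∧
    ((-∑ i, d i : ℤ) : WithTop ℤ) ≤ meromorphicOrderAt (fun w => b.det fun i =>
      localCoord F OnePoint.infty (ofInv w) (s i (ofInv w))) 0 ∧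
    (LinearIndependent ℂ ℓ → meromorphicOrderAt (fun w => b.det fun i =>
      localCoord F OnePoint.infty (ofInv w) (s i (ofInv w))) 0 = ((-∑ i, d i : ℤ) : WithTop ℤ)) := by
  obtain ⟨G, hG, hG0, hGw⟩ := h.exists_det_infty b
  set N : ℤ := -∑ i, d i
  have hz : MeromorphicAt (fun w : ℂ => w ^ N) 0 := (MeromorphicAt.id 0).zpow N
  have hzo : meromorphicOrderAt (fun w : ℂ => w ^ N) 0 = (N : WithTop ℤ) :=
    (meromorphicOrderAt_eq_int_iff hz).2 ⟨fun _ => 1, analyticAt_const, one_ne_zero, by simp⟩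
  have hev : (fun w => b.det fun i => localCoord F OnePoint.infty (ofInv w) (s i (ofInv w)))
      =ᶠ[𝓝[≠] 0] (fun w => w ^ N) * G := by
    filter_upwards [self_mem_nhdsWithin] with w hw
    rw [ofInv_of_ne hw, hGw w hw]
    rfl
  rw [meromorphicOrderAt_congr hev, meromorphicOrderAt_mul hz hG.meromorphicAt, hzo]
  refine ⟨(hz.mul hG.meromorphicAt).congr hev.symm, ?_, fun hℓ => ?_⟩
  · exact le_add_of_nonneg_right hG.meromorphicOrderAt_nonneg
  · have h1 : G 0 ≠ 0 := by
      rw [hG0]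
      exact (linearIndependent_iff_det_ne_zero b).1 hℓ
    rw [hG.meromorphicOrderAt_eq, hG.analyticOrderAt_eq_zero.2 h1]
    exact add_zero _

lemma analyticAt_det_coe (h : IsSectionSystem s d ℓ) (b : Module.Basis (Fin n) ℂ F) (z : ℂ) :
    AnalyticAt ℂ (fun u : ℂ => b.det fun i => localCoord F (z : RiemannSphere) u (s i u)) z :=
  analyticAt_basis_det b fun i =>
    (isHolomorphicSectionAt_coe_iff (mem_baseSet_trivializationAt F W _)).1 (h.holomorphic i z)

lemma meromorphicOrderAt_det_coe (h : IsSectionSystem s d ℓ) (b : Module.Basis (Fin n) ℂ F)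
    {z : ℂ} (hz : LinearIndependent ℂ fun i => s i (z : RiemannSphere)) :
    meromorphicOrderAt
      (fun u : ℂ => b.det fun i => localCoord F (z : RiemannSphere) u (s i u)) z = 0 := by
  have h1 := h.analyticAt_det_coe b z
  rw [h1.meromorphicOrderAt_eq, h1.analyticOrderAt_eq_zero.2]
  · rfl
  · rwa [← linearIndependent_iff_det_ne_zero b,
      linearIndependent_localCoord_iff (mem_baseSet_trivializationAt F W _)]

/-- The order of `η (s₁, …, sₙ)` at the points of the plane and at infinity. -/
lemma exists_order (h : IsSectionSystem s d ℓ) {D : ℤ} (hdeg : HasDegree F W n (fun _ => ⊤) D)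
    (hn : Module.finrank ℂ F = n) :
    ∃ (r : ℂ → ℂ) (μ : ℂ →₀ ℤ) (m : ℤ), D = -((μ.sum fun _ k => k) + m) ∧
      (∀ z, MeromorphicAt r z ∧ (μ z : WithTop ℤ) ≤ meromorphicOrderAt r z ∧
        (LinearIndependent ℂ (fun i => s i (z : RiemannSphere)) →
          meromorphicOrderAt r z = (μ z : WithTop ℤ))) ∧
      MeromorphicAt (fun w => r w⁻¹) 0 ∧
      ((m - ∑ i, d i : ℤ) : WithTop ℤ) ≤ meromorphicOrderAt (fun w => r w⁻¹) 0 ∧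
      (LinearIndependent ℂ ℓ → meromorphicOrderAt (fun w => r w⁻¹) 0 =
        ((m - ∑ i, d i : ℤ) : WithTop ℤ)) := by
  have b : Module.Basis (Fin n) ℂ F := Module.finBasisOfFinrankEq ℂ F hn
  obtain ⟨η, ν, hν, hη⟩ := hdeg.exists_form b
  obtain ⟨μ, hμ, hsum⟩ := exists_finsupp_plane ν
  refine ⟨fun z : ℂ => η z fun i => s i z, μ, ν OnePoint.infty, by rw [hν, hsum], fun z => ?_, ?_⟩
  · have h1 := hη (z : RiemannSphere) s
    rw [chartAt_coe] at h1
    obtain ⟨h2, h3⟩ := h1 (h.analyticAt_det_coe b z).meromorphicAt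
    refine ⟨h2, ?_, fun hz => ?_⟩
    · refine le_trans ?_ h3.ge
      rw [hμ]
      exact le_add_of_nonneg_right (h.analyticAt_det_coe b z).meromorphicOrderAt_nonneg
    · refine h3.trans ?_
      rw [hμ]
      exact (congrArg _ (h.meromorphicOrderAt_det_coe b hz)).trans (add_zero _)
  · obtain ⟨hm, hle, heq⟩ := h.meromorphicOrderAt_det_infty b
    have h1 := hη OnePoint.infty s
    rw [chartAt_infty] at h1
    obtain ⟨h2, h3⟩ := h1 hm
    have hev : (fun w => η (ofInv w) fun i => s i (ofInv w)) =ᶠ[𝓝[≠] 0]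
        fun w : ℂ => η ((w⁻¹ : ℂ) : RiemannSphere) fun i => s i ((w⁻¹ : ℂ) : RiemannSphere) := by
      filter_upwards [self_mem_nhdsWithin] with w hw
      rw [ofInv_of_ne hw]
    have h4 := (meromorphicOrderAt_congr hev).symm.trans h3
    refine ⟨h2.congr hev, ?_, fun hℓ => ?_⟩
    · rw [h4, sub_eq_add_neg, WithTop.coe_add]
      exact add_le_add_right hle _
    · rw [h4, sub_eq_add_neg, WithTop.coe_add]
      exact congrArg _ (heq hℓ)

/-- The function η(s₁, …, sₙ) is not identically zero, and its orders are bounded below by numbers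
with sum -D - ∑ d i, which therefore cannot be positive. -/
lemma neg_degree_le_sum (h : IsSectionSystem s d ℓ) {D : ℤ}
    (hdeg : HasDegree F W n (fun _ => ⊤) D) (hn : Module.finrank ℂ F = n) :
    -D ≤ ∑ i, d i := by
  obtain ⟨r, μ, m, hD, hr, hm, hle, -⟩ := h.exists_order hdeg hn
  obtain ⟨z, hz⟩ := h.independent
  by_contra hlt
  have h1 := meromorphicOrderAt_eq_top_of_sum_pos (fun p => (hr p).1) (fun p => (hr p).2.1) hm hle
    (by omega) z
  rw [(hr z).2.2 hz] at h1
  exact WithTop.coe_ne_top h1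

/-- Independence everywhere turns the bounds on the orders into equalities, so the same argument
applies to the reciprocal function. -/
lemma sum_eq_neg_degree (h : IsSectionSystem s d ℓ) {D : ℤ}
    (hdeg : HasDegree F W n (fun _ => ⊤) D) (hn : Module.finrank ℂ F = n)
    (hs : ∀ z : ℂ, LinearIndependent ℂ fun i => s i (z : RiemannSphere))
    (hℓ : LinearIndependent ℂ ℓ) : ∑ i, d i = -D := by
  refine le_antisymm ?_ (h.neg_degree_le_sum hdeg hn)
  obtain ⟨r, μ, m, hD, hr, hm, -, heq⟩ := h.exists_order hdeg hn
  by_contra hlt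
  have ho : ∀ p, meromorphicOrderAt r⁻¹ p = ((-μ) p : WithTop ℤ) := fun p => by
    rw [meromorphicOrderAt_inv, (hr p).2.2 (hs p)]
    rfl
  have ho' : meromorphicOrderAt (fun w => r⁻¹ w⁻¹) 0 = ((-(m - ∑ i, d i) : ℤ) : WithTop ℤ) := by
    refine (meromorphicOrderAt_inv (f := fun w => r w⁻¹)).trans ?_
    rw [heq hℓ]
    rfl
  have hneg : ((-μ).sum fun _ k => k) = -(μ.sum fun _ k => k) := by
    rw [Finsupp.sum_neg_index (fun _ => rfl)]
    simp [Finsupp.sum]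
  have h1 := meromorphicOrderAt_eq_top_of_sum_pos (r := r⁻¹) (fun p => (hr p).1.inv)
    (fun p => (ho p).ge) hm.inv ho'.ge (by rw [hneg]; omega) 0
  rw [ho] at h1
  exact WithTop.coe_ne_top h1

end IsSectionSystem

end DegreeBound

/-! ### The Birkhoff–Grothendieck splitting -/

section Splitting

variable {F : Type*} [NormedAddCommGroup F] [NormedSpace ℂ F]
  {W : RiemannSphere → Type*} [TopologicalSpace (TotalSpace F W)]
  [∀ x, AddCommGroup (W x)] [∀ x, Module ℂ (W x)] [∀ x, TopologicalSpace (W x)]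
  [FiberBundle F W] [VectorBundle ℂ F W]

lemma coordChangeL_eq_localCoord {x x' y : RiemannSphere}
    (hy : y ∈ (trivializationAt F W x).baseSet) (hy' : y ∈ (trivializationAt F W x').baseSet)
    (v : F) : (trivializationAt F W x).coordChangeL ℂ (trivializationAt F W x') y v =
      localCoord F x' y ((localCoordEquiv F hy).symm v) := by
  rw [Trivialization.coordChangeL_apply _ _ ⟨hy, hy'⟩, localCoord_apply hy']
  rfl

/-- The left side is the reversed polynomial, whose constant term is the leading coefficient of `p`.
-/
lemma tendsto_pow_mul_eval_inv (p : Polynomial ℂ) :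
    Tendsto (fun w : ℂ => w ^ (p.natDegree : ℤ) * p.eval w⁻¹) (𝓝[≠] 0) (𝓝 p.leadingCoeff) := by
  have h1 : Tendsto (fun w => p.reverse.eval w) (𝓝[≠] 0) (𝓝 p.leadingCoeff) := by
    have h2 := p.reverse.continuous.tendsto (0 : ℂ)
    rw [← Polynomial.coeff_zero_eq_eval_zero, Polynomial.coeff_zero_reverse] at h2
    exact h2.mono_left nhdsWithin_le_nhds
  refine h1.congr' ?_
  filter_upwards [self_mem_nhdsWithin] with w hw
  have hw' : w ≠ 0 := hw
  let _ : Invertible w⁻¹ := invertibleOfNonzero (inv_ne_zero hw')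
  have h2 := Polynomial.eval₂_reverse_mul_pow (RingHom.id ℂ) w⁻¹ p
  rw [invOf_eq_inv, inv_inv] at h2
  rw [Polynomial.eval, Polynomial.eval, ← h2, zpow_natCast, mul_comm, mul_assoc, ← mul_pow,
    inv_mul_cancel₀ hw', one_pow, mul_one]

/-- Sections whose leading terms at infinity are linearly independent are linearly independent
near infinity. -/
lemma exists_linearIndependent_of_leading {n : ℕ} (b : Module.Basis (Fin n) ℂ F)
    {s : Fin n → ∀ x, W x} {d : Fin n → ℤ} {ℓ : Fin n → F}
    (h : ∀ i, HasLeadingTerm (s i) (d i) (ℓ i)) (hℓ : LinearIndependent ℂ ℓ) :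
    ∃ z : ℂ, LinearIndependent ℂ fun i => s i (z : RiemannSphere) := by
  have h1 := ((contDiff_basis_det b).continuous.tendsto ℓ).comp (tendsto_pi_nhds.2 h)
  have h2 := h1.eventually_ne ((linearIndependent_iff_det_ne_zero b).1 hℓ)
  have h3 : ∀ᶠ w in 𝓝[≠] (0 : ℂ), ofInv w ∈ (trivializationAt F W OnePoint.infty).baseSet :=
    nhdsWithin_le_nhds (eventually_ofInv_mem (baseSet_mem_nhds (F := F) (W := W) OnePoint.infty))
  obtain ⟨w, hw, hw', hw0⟩ := (h2.and (h3.and self_mem_nhdsWithin)).exists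
  rw [ofInv_of_ne hw0] at hw'
  refine ⟨w⁻¹, (linearIndependent_localCoord_iff hw').1 ?_⟩
  rw [linearIndependent_iff_det_ne_zero b]
  intro h0
  refine hw ?_
  simp only [Function.comp_apply]
  rw [AlternatingMap.map_smul_univ, h0, smul_zero]

variable [ContMDiffVectorBundle ω F W 𝓘(ℂ)] [FiniteDimensional ℂ F]

/-- The transition functions of `W` over the plane. -/
lemma holomorphicCocycle_coordChangeL {J : Type*} (P : J → RiemannSphere)
    (hP : ∀ z : ℂ, ∃ j, (z : RiemannSphere) ∈ (trivializationAt F W (P j)).baseSet) :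
    HolomorphicCocycle (fun j => {z : ℂ | (z : RiemannSphere) ∈ (trivializationAt F W (P j)).baseSet})
      (fun i j z => ((trivializationAt F W (P j)).coordChangeL ℂ (trivializationAt F W (P i))
        (z : RiemannSphere) : F →L[ℂ] F)) where
  isOpen j := (trivializationAt F W (P j)).open_baseSet.preimage OnePoint.continuous_coe
  cover := hP
  differentiableOn i j z hz := by
    have : CompleteSpace F := FiniteDimensional.complete ℂ F
    have h1 := contMDiffOn_coordChangeL (n := ω) (IB := 𝓘(ℂ)) (𝕜 := ℂ)
      (trivializationAt F W (P j)) (trivializationAt F W (P i))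
    have h2 := h1.contMDiffAt (((trivializationAt F W (P j)).open_baseSet.inter
      (trivializationAt F W (P i)).open_baseSet).mem_nhds ⟨hz.2, hz.1⟩)
    exact (contMDiffAt_coe_iff.1 h2).differentiableAt.differentiableWithinAt
  self_apply i z hz v := by
    refine (coordChangeL_eq_localCoord hz hz v).trans ?_
    rw [← localCoordEquiv_apply hz, LinearEquiv.apply_symm_apply]
  comp_apply i j k z hi hj hk v := by
    refine (coordChangeL_eq_localCoord hj hi _).trans ?_
    refine Eq.trans ?_ (coordChangeL_eq_localCoord hk hi v).symm
    congr 1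
    rw [LinearEquiv.symm_apply_eq, localCoordEquiv_apply]
    exact coordChangeL_eq_localCoord hk hj v

variable (W) in
/-- For each vector `v` there is a section, holomorphic on the plane, with leading term a nonzero
multiple of `v` at infinity. -/
lemma exists_section_leading (v : F) :
    ∃ (s : ∀ x, W x) (d : ℤ) (c : ℂ), c ≠ 0 ∧ (∀ z : ℂ, IsHolomorphicSectionAt F s z) ∧
      HasLeadingTerm s d (c • v) := by
  classical
  have hinf : ∀ᶠ z in cocompact ℂ, ((z : ℂ) : RiemannSphere) ∈
      (trivializationAt F W OnePoint.infty).baseSet := by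
    have h1 : Tendsto ((↑) : ℂ → RiemannSphere) (cocompact ℂ) (𝓝 OnePoint.infty) := by
      rw [← coclosedCompact_eq_cocompact]
      exact OnePoint.tendsto_coe_infty
    exact h1.eventually (baseSet_mem_nhds OnePoint.infty)
  have hinf' := hinf
  rw [← Metric.cobounded_eq_cocompact, Filter.HasBasis.eventually_iff
    (Metric.hasBasis_cobounded_compl_closedBall (0 : ℂ))] at hinf'
  obtain ⟨R, -, hR⟩ := hinf'
  obtain ⟨T, -, hT⟩ := (isCompact_closedBall (0 : ℂ) R).elim_nhds_subcover
    (fun z => {u : ℂ | (u : RiemannSphere) ∈ (trivializationAt F W (z : RiemannSphere)).baseSet})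
    (fun z _ => eventually_coe_mem (baseSet_mem_nhds (F := F) (W := W) (z : RiemannSphere)))
  -- The trivialization at infinity, indexed by `none`, covers the outside of a disc; compactness
  -- leaves finitely many others for the disc.
  let P : Option T → RiemannSphere := fun j => j.elim OnePoint.infty fun z => (z.1 : RiemannSphere)
  have hP : ∀ z : ℂ, ∃ j, (z : RiemannSphere) ∈ (trivializationAt F W (P j)).baseSet := by
    intro z
    by_cases hz : z ∈ Metric.closedBall (0 : ℂ) R
    · obtain ⟨u, hu, hzu⟩ := mem_iUnion₂.1 (hT hz)
      exact ⟨some ⟨u, hu⟩, hzu⟩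
    · exact ⟨none, hR hz⟩
  obtain ⟨p, hp, f, hf, hfg, hlim⟩ := exists_holomorphic_section
    (holomorphicCocycle_coordChangeL (F := F) (W := W) P hP) (j₀ := none) (R := R)
    (fun z hz => hR (by simpa using hz)) v
  choose j hj using hP
  -- The value 0 at infinity is arbitrary: only the behaviour on the plane enters.
  let s : ∀ x, W x := @OnePoint.rec ℂ W 0
    fun z => (localCoordEquiv F (hj z)).symm (f (j z) z)
  have hs : ∀ (i) (z : ℂ), (z : RiemannSphere) ∈ (trivializationAt F W (P i)).baseSet →
      localCoord F (P i) z (s z) = f i z := fun i z hz =>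
    ((hfg i (j z) z hz (hj z)).trans (coordChangeL_eq_localCoord (hj z) hz _)).symm
  refine ⟨s, p.natDegree, p.leadingCoeff, Polynomial.leadingCoeff_ne_zero.2 hp, fun z => ?_, ?_⟩
  · rw [isHolomorphicSectionAt_coe_iff (hj z)]
    have ho := (holomorphicCocycle_coordChangeL (F := F) (W := W) P fun z => ⟨j z, hj z⟩).isOpen
      (j z)
    have : CompleteSpace F := FiniteDimensional.complete ℂ F
    refine ((hf (j z)).analyticAt (ho.mem_nhds (hj z))).congr ?_
    filter_upwards [ho.mem_nhds (hj z)] with u hu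
    exact (hs _ u hu).symm
  · have hinv : Tendsto (fun w : ℂ => w⁻¹) (𝓝[≠] 0) (cocompact ℂ) := by
      rw [← Metric.cobounded_eq_cocompact]
      exact tendsto_inv₀_nhdsNE_zero
    -- The error decays at infinity and the power of `w` is bounded near 0, so the leading term is
    -- that of `p • v`.
    have h1 : Tendsto (fun w : ℂ => w ^ (p.natDegree : ℤ) •
        (f none w⁻¹ - p.eval w⁻¹ • v)) (𝓝[≠] 0) (𝓝 0) := by
      have h2 : Tendsto (fun w : ℂ => w ^ (p.natDegree : ℤ)) (𝓝[≠] 0)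
          (𝓝 ((0 : ℂ) ^ p.natDegree)) := by
        simp only [zpow_natCast]
        exact ((continuous_pow _).tendsto 0).mono_left nhdsWithin_le_nhds
      simpa using h2.smul (hlim.comp hinv)
    have h3 := h1.add ((tendsto_pow_mul_eval_inv p).smul_const v)
    rw [zero_add] at h3
    refine h3.congr' ?_
    filter_upwards [hinv.eventually hinf] with w hw
    have h4 : localCoord F OnePoint.infty ((w⁻¹ : ℂ) : RiemannSphere)
        (s ((w⁻¹ : ℂ) : RiemannSphere)) = f none w⁻¹ := hs none w⁻¹ hw
    rw [h4, smul_sub, smul_smul, sub_add_cancel]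

-- One section for each basis vector: their leading terms are nonzero multiples of a basis, so they
-- are independent near infinity.
variable (W) in
lemma exists_isSectionSystem {n : ℕ} (hn : Module.finrank ℂ F = n) :
    ∃ (s : Fin n → ∀ x, W x) (d : Fin n → ℤ) (ℓ : Fin n → F), IsSectionSystem s d ℓ := by
  have b : Module.Basis (Fin n) ℂ F := Module.finBasisOfFinrankEq ℂ F hn
  choose s d c hc hs hl using fun i => exists_section_leading W (b i)
  refine ⟨s, d, _, hs, hl, exists_linearIndependent_of_leading b hl ?_⟩
  exact b.linearIndependent.units_smul fun i => Units.mk0 (c i) (hc i)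

/-- Sections `sᵢ` framing `W` over the plane and `tᵢ` framing `W` at infinity, with
`tᵢ = z ^ (-dᵢ) sᵢ`. -/
structure IsSplittingFrame {ι : Type*} (s t : ι → ∀ x, W x) (d : ι → ℤ) : Prop where
  holomorphic_coe : ∀ i, ∀ z : ℂ, IsHolomorphicSectionAt F (s i) z
  independent_coe : ∀ z : ℂ, LinearIndependent ℂ fun i => s i (z : RiemannSphere)
  holomorphic_infty : ∀ i, IsHolomorphicSectionAt F (t i) OnePoint.infty
  independent_infty : LinearIndependent ℂ fun i => t i OnePoint.infty
  eq_smul : ∀ i, ∀ z : ℂ, z ≠ 0 → t i z = z ^ (-d i) • s i (z : RiemannSphere)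

variable (W) in
/-- Every holomorphic vector bundle on the sphere splits into line bundles. -/
theorem exists_isSplittingFrame {n : ℕ} (hn : Module.finrank ℂ F = n) {D : ℤ}
    (hdeg : HasDegree F W n (fun _ => ⊤) D) :
    ∃ (s t : Fin n → ∀ x, W x) (d : Fin n → ℤ), IsSplittingFrame (F := F) s t d ∧
      ∑ i, d i = -D := by
  classical
  -- At the minimal total pole order neither reduction is possible, so independence holds at every
  -- point of the plane and for the leading terms.
  obtain ⟨m, ⟨s, d, ℓ, h, hm⟩, hmin⟩ := Int.exists_least_of_bdd
    (P := fun m => ∃ (s : Fin n → ∀ x, W x) (d : Fin n → ℤ) (ℓ : Fin n → F),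
      IsSectionSystem s d ℓ ∧ ∑ i, d i = m)
    ⟨-D, by
      rintro m ⟨s, d, ℓ, h, rfl⟩
      exact h.neg_degree_le_sum hdeg hn⟩
    (by
      obtain ⟨s, d, ℓ, h⟩ := exists_isSectionSystem W hn
      exact ⟨_, s, d, ℓ, h, rfl⟩)
  have hno : ¬ ∃ (s' : Fin n → ∀ x, W x) (d' : Fin n → ℤ) (ℓ' : Fin n → F),
      IsSectionSystem s' d' ℓ' ∧ ∑ i, d' i < ∑ i, d i := by
    rintro ⟨s', d', ℓ', h', hlt⟩
    have := hmin _ ⟨s', d', ℓ', h', rfl⟩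
    omega
  have hs : ∀ z : ℂ, LinearIndependent ℂ fun i => s i (z : RiemannSphere) := fun z => by
    by_contra hz
    exact hno (h.exists_lt_of_not_linearIndependent hz)
  have hℓ : LinearIndependent ℂ ℓ := by
    by_contra hz
    exact hno (h.exists_lt_of_not_linearIndependent_leading hz)
  have hinf := mem_baseSet_trivializationAt F W (OnePoint.infty : RiemannSphere)
  -- The value at infinity is the leading coefficient, which is what makes `t i` holomorphic there.
  let t : Fin n → ∀ x, W x := fun i => Function.update (fun x => coord x ^ (-d i) • s i x)
    OnePoint.infty ((localCoordEquiv F hinf).symm (ℓ i))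
  have htz : ∀ i (z : ℂ), t i z = z ^ (-d i) • s i (z : RiemannSphere) := fun i z =>
    Function.update_of_ne (OnePoint.coe_ne_infty z) _ _
  have hti : ∀ i, localCoord F OnePoint.infty OnePoint.infty (t i OnePoint.infty) = ℓ i := by
    intro i
    rw [← localCoordEquiv_apply hinf]
    simp [t]
  refine ⟨s, t, d, ⟨h.holomorphic, hs, fun i => ?_, ?_, fun i z _ => htz i z⟩,
    h.sum_eq_neg_degree hdeg hn hs hℓ⟩
  · rw [isHolomorphicSectionAt_infty_iff]
    obtain ⟨g, hg, hg0, hgw⟩ := (h.leading i).analyticAt (h.holomorphic i)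
    convert hg using 1
    funext w
    rcases eq_or_ne w 0 with rfl | hw
    · rw [hg0, ofInv_zero, hti]
    · rw [hgw w hw, ofInv_of_ne hw, htz, map_smul, inv_zpow', neg_neg]
  · rw [← linearIndependent_localCoord_iff hinf]
    simpa only [hti] using hℓ

end Splitting

/-! ### Coefficients with respect to a holomorphic frame -/

section Coefficients

variable {F : Type*} [NormedAddCommGroup F] [NormedSpace ℂ F]
  {W : RiemannSphere → Type*} [TopologicalSpace (TotalSpace F W)]
  [∀ x, AddCommGroup (W x)] [∀ x, Module ℂ (W x)] [∀ x, TopologicalSpace (W x)]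
  [FiberBundle F W] [VectorBundle ℂ F W]

lemma linearIndependent_span_eq_top {n : ℕ} (hn : Module.finrank ℂ F = n) [FiniteDimensional ℂ F]
    {x : RiemannSphere} {v : Fin n → W x} (hv : LinearIndependent ℂ v) :
    Submodule.span ℂ (range v) = ⊤ := by
  have e := localCoordEquiv F (mem_baseSet_trivializationAt F W x)
  have : FiniteDimensional ℂ (W x) := e.symm.finiteDimensional
  exact hv.span_eq_top_of_card_eq_finrank' (by rw [Fintype.card_fin, e.finrank_eq, hn])

/-- The parameter space `M` is the sphere when a section is expanded, and the total space of `W`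
when the tautological section is. -/
lemma exists_coefficients {n : ℕ} (hn : Module.finrank ℂ F = n) [FiniteDimensional ℂ F]
    {M : Type*} (f : M → RiemannSphere) (s : Fin n → ∀ x, W x) (u : ∀ m, W (f m)) :
    ∃ c : Fin n → M → ℂ, ∀ m, (LinearIndependent ℂ fun i => s i (f m)) →
      u m = ∑ i, c i m • s i (f m) := by
  have hex : ∀ m, ∃ c : Fin n → ℂ, (LinearIndependent ℂ fun i => s i (f m)) →
      u m = ∑ i, c i • s i (f m) := by
    intro m
    by_cases hm : LinearIndependent ℂ fun i => s i (f m)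
    · have h1 : u m ∈ Submodule.span ℂ (range fun i => s i (f m)) := by
        rw [linearIndependent_span_eq_top hn hm]
        exact Submodule.mem_top
      obtain ⟨c, hc⟩ := (Submodule.mem_span_range_iff_exists_fun ℂ).1 h1
      exact ⟨c, fun _ => hc.symm⟩
    · exact ⟨0, fun h => absurd h hm⟩
  choose c hc using hex
  exact ⟨fun i m => c m i, hc⟩

lemma LinearIndependent.coefficient_unique {V ι : Type*} [AddCommGroup V] [Module ℂ V] [Fintype ι]
    {v : ι → V} (hv : LinearIndependent ℂ v) {c c' : ι → ℂ}
    (h : ∑ i, c i • v i = ∑ i, c' i • v i) (i : ι) : c i = c' i := by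
  refine sub_eq_zero.1 (Fintype.linearIndependent_iff.1 hv (fun i => c i - c' i) ?_ i)
  simp only [sub_smul, Finset.sum_sub_distrib, h, sub_self]

variable [ContMDiffVectorBundle ω F W 𝓘(ℂ)] [FiniteDimensional ℂ F]
  {E : Type*} [NormedAddCommGroup E] [NormedSpace ℂ E] {H : Type*} [TopologicalSpace H]
  {I : ModelWithCorners ℂ E H} {M : Type*} [TopologicalSpace M] [ChartedSpace H M]
  {f : M → RiemannSphere} {m : M}

lemma contMDiffAt_totalSpace_iff_localCoord {u : ∀ m, W (f m)} :
    ContMDiffAt I (𝓘(ℂ).prod 𝓘(ℂ, F)) ω (fun m => TotalSpace.mk' F (f m) (u m)) m ↔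
      ContMDiffAt I 𝓘(ℂ) ω f m ∧
        ContMDiffAt I 𝓘(ℂ, F) ω (fun x => localCoord F (f m) (f x) (u x)) m := by
  rw [contMDiffAt_totalSpace]
  refine and_congr_right fun hf => Filter.EventuallyEq.contMDiffAt_iff ?_
  filter_upwards [hf.continuousAt.eventually (baseSet_mem_nhds (F := F) (W := W) (f m))] with x hx
  exact (localCoord_apply hx _).symm

variable {ι : Type*} [Fintype ι] {s : ι → ∀ x, W x} {c : ι → M → ℂ}

lemma IsHolomorphicSectionAt.contMDiffAt_localCoord {t : ∀ x, W x}
    (ht : IsHolomorphicSectionAt F t (f m)) (hf : ContMDiffAt I 𝓘(ℂ) ω f m) :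
    ContMDiffAt I 𝓘(ℂ, F) ω (fun x => localCoord F (f m) (f x) (t (f x))) m :=
  ((isHolomorphicSectionAt_iff (mem_baseSet_trivializationAt F W (f m))).1 ht).comp m hf

lemma contMDiffAt_linearCombination (hf : ContMDiffAt I 𝓘(ℂ) ω f m)
    (hs : ∀ i, IsHolomorphicSectionAt F (s i) (f m)) (hc : ∀ i, ContMDiffAt I 𝓘(ℂ) ω (c i) m) :
    ContMDiffAt I (𝓘(ℂ).prod 𝓘(ℂ, F)) ω
      (fun m => TotalSpace.mk' F (f m) (∑ i, c i m • s i (f m))) m := by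
  refine contMDiffAt_totalSpace_iff_localCoord.2 ⟨hf, ?_⟩
  simp only [map_sum, map_smul]
  exact ContMDiffAt.sum fun i _ => (hc i).smul ((hs i).contMDiffAt_localCoord hf)

/-- The coefficients of a holomorphic map to `W` with respect to a holomorphic frame of `W` are
holomorphic. -/
lemma contMDiffAt_coefficient {n : ℕ} (hn : Module.finrank ℂ F = n) {s : Fin n → ∀ x, W x}
    {c : Fin n → M → ℂ} {u : ∀ m, W (f m)}
    (hu : ContMDiffAt I (𝓘(ℂ).prod 𝓘(ℂ, F)) ω (fun m => TotalSpace.mk' F (f m) (u m)) m)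
    (hs : ∀ i, IsHolomorphicSectionAt F (s i) (f m))
    (hli : LinearIndependent ℂ fun i => s i (f m))
    (hc : ∀ᶠ x in 𝓝 m, u x = ∑ i, c i x • s i (f x)) (j : Fin n) :
    ContMDiffAt I 𝓘(ℂ) ω (c j) m := by
  have b : Module.Basis (Fin n) ℂ F := Module.finBasisOfFinrankEq ℂ F hn
  obtain ⟨hf, hu'⟩ := contMDiffAt_totalSpace_iff_localCoord.1 hu
  set L : ∀ x, W (f x) → F := fun x => localCoord F (f m) (f x) with hL
  set A : M → Fin n → F := fun x i => L x (s i (f x)) with hA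
  have hAi : ∀ i, ContMDiffAt I 𝓘(ℂ, F) ω (fun x => A x i) m := fun i =>
    (hs i).contMDiffAt_localCoord hf
  have hdet : ∀ {B : M → Fin n → F}, (∀ i, ContMDiffAt I 𝓘(ℂ, F) ω (fun x => B x i) m) →
      ContMDiffAt I 𝓘(ℂ) ω (fun x => b.det (B x)) m := fun hB =>
    ((contDiff_basis_det b).contMDiff.contMDiffAt).comp m (contMDiffAt_pi_space.2 hB)
  have hA0 : b.det (A m) ≠ 0 := by
    rw [← linearIndependent_iff_det_ne_zero b]
    exact (linearIndependent_localCoord_iff (mem_baseSet_trivializationAt F W (f m))).2 hli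
  -- By Cramer's rule the coefficient is this determinant divided by that of the frame.
  have hnum : ContMDiffAt I 𝓘(ℂ) ω (fun x => b.det (Function.update (A x) j (L x (u x)))) m := by
    refine hdet fun i => ?_
    rcases eq_or_ne i j with rfl | hij
    · simpa only [Function.update_self] using hu'
    · simpa only [Function.update_of_ne hij] using hAi i
  refine (hnum.div₀ (hdet hAi) hA0).congr_of_eventuallyEq ?_
  filter_upwards [hc, (hdet hAi).continuousAt.eventually_ne hA0] with x hx hx0
  have h1 : L x (u x) = ∑ i, c i x • A x i := by
    rw [hx]
    simp only [hL, hA, map_sum, map_smul]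
  simp only [Pi.div_apply, h1, det_update_sum_smul]
  exact (mul_div_cancel_right₀ _ hx0).symm

end Coefficients

/-! ### Bundles with equal splitting types are isomorphic -/

section Isomorphism

variable {F : Type*} [NormedAddCommGroup F] [NormedSpace ℂ F]
  {W : RiemannSphere → Type*} [TopologicalSpace (TotalSpace F W)]
  [∀ x, AddCommGroup (W x)] [∀ x, Module ℂ (W x)] [∀ x, TopologicalSpace (W x)]
  [FiberBundle F W] [VectorBundle ℂ F W] [ContMDiffVectorBundle ω F W 𝓘(ℂ)]
  [FiniteDimensional ℂ F]
  {F' : Type*} [NormedAddCommGroup F'] [NormedSpace ℂ F']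
  {W' : RiemannSphere → Type*} [TopologicalSpace (TotalSpace F' W')]
  [∀ x, AddCommGroup (W' x)] [∀ x, Module ℂ (W' x)] [∀ x, TopologicalSpace (W' x)]
  [FiberBundle F' W'] [VectorBundle ℂ F' W'] [ContMDiffVectorBundle ω F' W' 𝓘(ℂ)]
  [FiniteDimensional ℂ F']

/-- A fibrewise linear map taking a holomorphic frame to holomorphic sections is holomorphic. -/
lemma contMDiffAt_of_map_frame {n : ℕ} (hn : Module.finrank ℂ F = n) (e : ∀ x, W x →ₗ[ℂ] W' x)
    {s : Fin n → ∀ x, W x} {s' : Fin n → ∀ x, W' x} {v : TotalSpace F W}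
    (hs : ∀ i, IsHolomorphicSectionAt F (s i) v.proj)
    (hs' : ∀ i, IsHolomorphicSectionAt F' (s' i) v.proj)
    (hli : ∀ᶠ x in 𝓝 v.proj, LinearIndependent ℂ fun i => s i x)
    (he : ∀ᶠ x in 𝓝 v.proj, ∀ i, e x (s i x) = s' i x) :
    ContMDiffAt (𝓘(ℂ).prod 𝓘(ℂ, F)) (𝓘(ℂ).prod 𝓘(ℂ, F')) ω
      (fun v : TotalSpace F W => (⟨v.proj, e v.proj v.snd⟩ : TotalSpace F' W')) v := by
  -- A point of the total space is expanded in the frame; the image has the same coefficients in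
  -- `s'`.
  obtain ⟨c, hc⟩ := exists_coefficients hn (fun v : TotalSpace F W => v.proj) s fun v => v.2
  have hproj : ContMDiffAt (𝓘(ℂ).prod 𝓘(ℂ, F)) 𝓘(ℂ) ω
      (fun u : TotalSpace F W => u.proj) v := contMDiff_proj W v
  have hcs : ∀ i, ContMDiffAt (𝓘(ℂ).prod 𝓘(ℂ, F)) 𝓘(ℂ) ω (c i) v :=
    contMDiffAt_coefficient (f := fun u : TotalSpace F W => u.proj) (u := fun u => u.2)
      (c := fun i u => c i u) hn contMDiffAt_id hs hli.self_of_nhds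
      ((hproj.continuousAt.eventually hli).mono fun u hu => hc u hu)
  refine (contMDiffAt_linearCombination hproj hs' hcs).congr_of_eventuallyEq ?_
  filter_upwards [hproj.continuousAt.eventually hli, hproj.continuousAt.eventually he] with u h1 h2
  refine congrArg (TotalSpace.mk u.proj) ?_
  conv_lhs => rw [hc u h1]
  simp only [map_sum, map_smul, h2]

namespace IsSplittingFrame

variable {n : ℕ} {s t : Fin n → ∀ x, W x} {d : Fin n → ℤ}

lemma linearIndependent_of_ne_zero (h : IsSplittingFrame (F := F) s t d) :
    ∀ x : RiemannSphere, x ≠ ((0 : ℂ) : RiemannSphere) → LinearIndependent ℂ fun i => t i x := by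
  intro x hx
  induction x using OnePoint.rec with
  | infty => exact h.independent_infty
  | coe z =>
    have hz : z ≠ 0 := fun e => hx (congrArg _ e)
    simp only [h.eq_smul _ z hz]
    exact (h.independent_coe z).units_smul fun i => Units.mk0 _ (zpow_ne_zero (-d i) hz)

lemma holomorphic_of_ne_zero (h : IsSplittingFrame (F := F) s t d) (i : Fin n) {x : RiemannSphere}
    (hx : x ≠ ((0 : ℂ) : RiemannSphere)) : IsHolomorphicSectionAt F (t i) x := by
  induction x using OnePoint.rec with
  | infty => exact h.holomorphic_infty i
  | coe z =>
    have hz : z ≠ 0 := fun e => hx (congrArg _ e)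
    have h1 : IsHolomorphicSectionAt F (fun x => coord x ^ (-d i) • s i x) z :=
      ContMDiffAt.smul_section (contMDiffAt_coe_iff.2 (analyticAt_id.zpow hz))
        (h.holomorphic_coe i z)
    refine isHolomorphicSectionAt_congr h1 ?_
    filter_upwards [isOpen_ne.mem_nhds hx,
      OnePoint.isOpen_range_coe.mem_nhds (mem_range_self z)] with y hy hy'
    obtain ⟨u, rfl⟩ := hy'
    exact h.eq_smul i u fun e => hy (congrArg _ e)

/-- Two holomorphic vector bundles with splitting frames of the same degrees are isomorphic. -/
theorem holomorphicallyIsomorphic (h : IsSplittingFrame (F := F) s t d)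
    {s' t' : Fin n → ∀ x, W' x} (h' : IsSplittingFrame (F := F') s' t' d)
    (hn : Module.finrank ℂ F = n) (hn' : Module.finrank ℂ F' = n) :
    HolomorphicallyIsomorphic F W F' W' := by
  -- Matching the plane frames also matches the frames at infinity on the overlap, because both
  -- bundles use the same exponents `d`.
  have hb : ∀ x, ∃ e : W x ≃ₗ[ℂ] W' x, (∀ z : ℂ, x = z → ∀ i, e (s i x) = s' i x) ∧
      (x ≠ ((0 : ℂ) : RiemannSphere) → ∀ i, e (t i x) = t' i x) := by
    intro x
    have key : ∀ (v : Fin n → W x) (v' : Fin n → W' x), LinearIndependent ℂ v →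
        LinearIndependent ℂ v' → ∃ e : W x ≃ₗ[ℂ] W' x, ∀ i, e (v i) = v' i := by
      intro v v' hv hv'
      refine ⟨(Module.Basis.mk hv (linearIndependent_span_eq_top hn hv).ge).equiv
        (Module.Basis.mk hv' (linearIndependent_span_eq_top hn' hv').ge) (Equiv.refl _),
        fun i => ?_⟩
      conv_lhs => rw [← Module.Basis.mk_apply hv (linearIndependent_span_eq_top hn hv).ge i]
      rw [Module.Basis.equiv_apply, Module.Basis.mk_apply, Equiv.refl_apply]
    induction x using OnePoint.rec with
    | infty =>
      obtain ⟨e, he⟩ := key _ _ h.independent_infty h'.independent_infty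
      exact ⟨e, fun z hz => absurd hz (OnePoint.infty_ne_coe z), fun _ => he⟩
    | coe z =>
      obtain ⟨e, he⟩ := key _ _ (h.independent_coe z) (h'.independent_coe z)
      refine ⟨e, fun _ _ => he, fun hz i => ?_⟩
      have hz' : z ≠ 0 := fun e => hz (congrArg _ e)
      rw [h.eq_smul _ z hz', h'.eq_smul _ z hz', map_smul, he]
  choose e he1 he2 using hb
  have hne : ∀ z : ℂ, ∀ᶠ x : RiemannSphere in 𝓝 (z : RiemannSphere), ∃ u : ℂ, x = u := by
    intro z
    filter_upwards [OnePoint.isOpen_range_coe.mem_nhds (mem_range_self z)] with x hx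
    obtain ⟨u, rfl⟩ := hx
    exact ⟨u, rfl⟩
  have h0 : ∀ᶠ x in 𝓝 (OnePoint.infty : RiemannSphere), x ≠ ((0 : ℂ) : RiemannSphere) :=
    isOpen_ne.mem_nhds (OnePoint.infty_ne_coe 0)
  refine ⟨e, ?_, ?_⟩
  · rintro ⟨x, v⟩
    induction x using OnePoint.rec with
    | infty =>
      exact contMDiffAt_of_map_frame hn (fun x => (e x : W x →ₗ[ℂ] W' x)) h.holomorphic_infty
        h'.holomorphic_infty (h0.mono h.linearIndependent_of_ne_zero) (h0.mono he2)
    | coe z =>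
      refine contMDiffAt_of_map_frame hn (fun x => (e x : W x →ₗ[ℂ] W' x))
        (fun i => h.holomorphic_coe i z) (fun i => h'.holomorphic_coe i z) ?_ ?_
      · exact (hne z).mono fun x ⟨u, hu⟩ => hu ▸ h.independent_coe u
      · exact (hne z).mono fun x ⟨u, hu⟩ => he1 x u hu
  · rintro ⟨x, v⟩
    induction x using OnePoint.rec with
    | infty =>
      refine contMDiffAt_of_map_frame hn' (fun x => ((e x).symm : W' x →ₗ[ℂ] W x))
        h'.holomorphic_infty h.holomorphic_infty (h0.mono h'.linearIndependent_of_ne_zero)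
        (h0.mono fun x hx i => ?_)
      exact (LinearEquiv.symm_apply_eq _).2 (he2 x hx i).symm
    | coe z =>
      refine contMDiffAt_of_map_frame hn' (fun x => ((e x).symm : W' x →ₗ[ℂ] W x))
        (fun i => h'.holomorphic_coe i z) (fun i => h.holomorphic_coe i z) ?_ ?_
      · exact (hne z).mono fun x ⟨u, hu⟩ => hu ▸ h'.independent_coe u
      · exact (hne z).mono fun x ⟨u, hu⟩ i => (LinearEquiv.symm_apply_eq _).2 (he1 x u hu i).symm

lemma reindex (h : IsSplittingFrame (F := F) s t d) (σ : Equiv.Perm (Fin n)) :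
    IsSplittingFrame (F := F) (fun i => s (σ i)) (fun i => t (σ i)) (fun i => d (σ i)) where
  holomorphic_coe i := h.holomorphic_coe (σ i)
  independent_coe z := (h.independent_coe z).comp σ σ.injective
  holomorphic_infty i := h.holomorphic_infty (σ i)
  independent_infty := h.independent_infty.comp σ σ.injective
  eq_smul i := h.eq_smul (σ i)

end IsSplittingFrame

end Isomorphism

/-! ### Splitting frame of the model 𝒪(a) ⊕ 𝒪(b) ⊕ 𝒪(c) -/

section DirectSum

namespace RiemannSphere

/-- The nowhere vanishing section `1` of `𝒪(n)` over `S² \ {∞}`. -/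
noncomputable def unitSection (n : ℤ) (x : RiemannSphere) : O n x := (1 : ℂ)

/-- The nowhere vanishing section `zⁿ` of `𝒪(n)` over `S² \ {0}`. -/
noncomputable def zpowSection (n : ℤ) (x : RiemannSphere) : O n x :=
  (x.elim 1 fun z => z ^ n : ℂ)

lemma trivializationAt_unitSection (n : ℤ) (z u : ℂ) :
    (trivializationAt ℂ (O n) (z : RiemannSphere) ⟨(u : RiemannSphere), unitSection n u⟩).2 = 1 :=
  one_smul ℂ (1 : ℂ)

lemma trivializationAt_zpowSection (n : ℤ) (w : ℂ) :
    (trivializationAt ℂ (O n) OnePoint.infty ⟨ofInv w, zpowSection n (ofInv w)⟩).2 = 1 := by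
  rcases eq_or_ne w 0 with rfl | hw
  · rw [ofInv_zero]
    exact one_smul ℂ (1 : ℂ)
  · rw [ofInv_of_ne hw]
    change (w⁻¹ : ℂ) ^ (-n) * (w⁻¹ : ℂ) ^ n = 1
    rw [← zpow_add₀ (inv_ne_zero hw), neg_add_cancel, zpow_zero]

lemma zpowSection_coe (n : ℤ) (z : ℂ) :
    zpowSection n (z : RiemannSphere) = z ^ (-(-n)) • unitSection n (z : RiemannSphere) := by
  rw [neg_neg]
  exact (mul_one (z ^ n)).symm

variable (a b c : ℤ)

/-- Sections of `𝒪(a) ⊕ 𝒪(b) ⊕ 𝒪(c)` from sections of the summands, each in its summand. -/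
noncomputable def summandSections (σ : ∀ n x, O n x) : Fin 3 → ∀ x, SumO a b c x :=
  ![fun x => (σ a x, 0, 0), fun x => (0, σ b x, 0), fun x => (0, 0, σ c x)]

lemma localCoord_summandSections {σ : ∀ n x, O n x} {x y : RiemannSphere}
    (hy : ∀ n, y ∈ (trivializationAt ℂ (O n) x).baseSet)
    (h : ∀ n, (trivializationAt ℂ (O n) x ⟨y, σ n y⟩).2 = 1) (i : Fin 3) :
    localCoord (ℂ × ℂ × ℂ) x y (summandSections a b c σ i y) =
      (![(1, 0, 0), (0, 1, 0), (0, 0, 1)] : Fin 3 → ℂ × ℂ × ℂ) i := by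
  have h0 : ∀ n, (trivializationAt ℂ (O n) x ⟨y, (0 : O n y)⟩).2 = 0 := fun n => by
    rw [← localCoord_apply (hy n), map_zero]
  rw [localCoord_apply (show y ∈ (trivializationAt (ℂ × ℂ × ℂ) (SumO a b c) x).baseSet from
    ⟨hy a, hy b, hy c⟩)]
  fin_cases i
  · exact Prod.ext (h a) (Prod.ext (h0 b) (h0 c))
  · exact Prod.ext (h0 a) (Prod.ext (h b) (h0 c))
  · exact Prod.ext (h0 a) (Prod.ext (h0 b) (h c))

lemma linearIndependent_standard :
    LinearIndependent ℂ (![(1, 0, 0), (0, 1, 0), (0, 0, 1)] : Fin 3 → ℂ × ℂ × ℂ) := by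
  rw [Fintype.linearIndependent_iff]
  intro g hg
  rw [Fin.sum_univ_three] at hg
  have h0 := congrArg Prod.fst hg
  have h1 := congrArg (fun v => v.2.1) hg
  have h2 := congrArg (fun v => v.2.2) hg
  simp at h0 h1 h2
  intro i
  fin_cases i
  exacts [h0, h1, h2]

/-- The signs arise because the frame of 𝒪(n) at infinity is zⁿ times the frame of the plane, so its
exponent `d` is -n. -/
lemma isSplittingFrame_summandSections :
    IsSplittingFrame (F := ℂ × ℂ × ℂ) (W := SumO a b c) (summandSections a b c unitSection)
      (summandSections a b c zpowSection) ![-a, -b, -c] := by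
  have hcoe : ∀ (z u : ℂ) (n : ℤ),
      (u : RiemannSphere) ∈ (trivializationAt ℂ (O n) (z : RiemannSphere)).baseSet :=
    fun z u n => OnePoint.coe_ne_infty u
  have hinf : ∀ (w : ℂ) (n : ℤ),
      ofInv w ∈ (trivializationAt ℂ (O n) OnePoint.infty).baseSet := fun w n =>
    inftyChart.map_target (mem_univ w)
  have hinf0 : ∀ n : ℤ, OnePoint.infty ∈ (trivializationAt ℂ (O n) OnePoint.infty).baseSet :=
    fun n => mem_baseSet_trivializationAt ℂ (O n) OnePoint.infty
  refine ⟨fun i z => ?_, fun z => ?_, fun i => ?_, ?_, fun i z hz => ?_⟩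
  · rw [isHolomorphicSectionAt_coe_iff (mem_baseSet_trivializationAt _ _ (z : RiemannSphere))]
    simp only [localCoord_summandSections a b c (hcoe z _)
      (fun n => trivializationAt_unitSection n z _)]
    exact analyticAt_const
  · rw [← linearIndependent_localCoord_iff (F := ℂ × ℂ × ℂ)
      (mem_baseSet_trivializationAt _ _ (z : RiemannSphere))]
    simp only [localCoord_summandSections a b c (hcoe z _)
      (fun n => trivializationAt_unitSection n z _)]
    exact linearIndependent_standard
  · rw [isHolomorphicSectionAt_infty_iff]
    simp only [localCoord_summandSections a b c (hinf _)
      (fun n => trivializationAt_zpowSection n _)]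
    exact analyticAt_const
  · rw [← linearIndependent_localCoord_iff (F := ℂ × ℂ × ℂ)
      (mem_baseSet_trivializationAt _ _ OnePoint.infty)]
    have h1 : ∀ n : ℤ, (trivializationAt ℂ (O n) OnePoint.infty
        ⟨OnePoint.infty, zpowSection n OnePoint.infty⟩).2 = 1 := fun n => by
      have h2 := trivializationAt_zpowSection n 0
      rwa [ofInv_zero] at h2
    simp only [localCoord_summandSections a b c hinf0 h1]
    exact linearIndependent_standard
  · fin_cases i
    · exact Prod.ext (zpowSection_coe a z) (Prod.ext (smul_zero _).symm (smul_zero _).symm)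
    · exact Prod.ext (smul_zero _).symm (Prod.ext (zpowSection_coe b z) (smul_zero _).symm)
    · exact Prod.ext (smul_zero _).symm (Prod.ext (smul_zero _).symm (zpowSection_coe c z))

end RiemannSphere

end DirectSum

/-! ### Coordinate vector fields on the sphere -/

section Tangent

namespace RiemannSphere

/-- The vector field `∂/∂z`. -/
noncomputable def planeField (x : RiemannSphere) : TangentSpace 𝓘(ℂ) x := (1 : ℂ)

/-- The vector field `∂/∂w = -z² ∂/∂z`, where `w = 1/z`. -/
noncomputable def inftyField (x : RiemannSphere) : TangentSpace 𝓘(ℂ) x :=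
  (x.elim 1 fun z => -z ^ 2 : ℂ)

lemma contMDiffAt_planeField (z : ℂ) :
    ContMDiffAt 𝓘(ℂ) (𝓘(ℂ).prod 𝓘(ℂ)) ω (fun x : RiemannSphere =>
      TotalSpace.mk' ℂ (E := fun x : RiemannSphere => TangentSpace 𝓘(ℂ) x) x (planeField x)) z := by
  rw [contMDiffAt_section, contMDiffAt_coe_iff]
  refine (analyticAt_const (v := (1 : ℂ))).congr (Eventually.of_forall fun u => ?_)
  beta_reduce
  rw [TangentBundle.trivializationAt_apply]
  simp only [chartAt_coe, planeField]
  have h1 : (affineChart.extend 𝓘(ℂ)) ∘ (affineChart.extend 𝓘(ℂ)).symm = id := rfl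
  rw [h1]
  simp

/-- In the coordinate w = 1/z this field is the constant 1. -/
lemma contMDiffAt_inftyField :
    ContMDiffAt 𝓘(ℂ) (𝓘(ℂ).prod 𝓘(ℂ)) ω (fun x : RiemannSphere =>
      TotalSpace.mk' ℂ (E := fun x : RiemannSphere => TangentSpace 𝓘(ℂ) x) x (inftyField x))
      OnePoint.infty := by
  rw [contMDiffAt_section, contMDiffAt_infty_iff]
  refine (analyticAt_const (v := (1 : ℂ))).congr (Eventually.of_forall fun w => ?_)
  beta_reduce
  rw [TangentBundle.trivializationAt_apply]
  rcases eq_or_ne w 0 with rfl | hw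
  · simp only [ofInv_zero, chartAt_infty]
    have h1 : (inftyChart.extend 𝓘(ℂ)) ∘ (inftyChart.extend 𝓘(ℂ)).symm = id :=
      funext fun w => inftyChart.right_inv (mem_univ w)
    rw [h1]
    simp [inftyField]
  · rw [ofInv_of_ne hw]
    simp only [chartAt_infty, chartAt_coe]
    have h1 : (inftyChart.extend 𝓘(ℂ)) ∘ (affineChart.extend 𝓘(ℂ)).symm =
      fun z : ℂ => z⁻¹ := rfl
    have h2 : (affineChart.extend 𝓘(ℂ)) ((w⁻¹ : ℂ) : RiemannSphere) = w⁻¹ := rfl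
    have h3 : inftyField ((w⁻¹ : ℂ) : RiemannSphere) = (-(w⁻¹) ^ 2 : ℂ) := rfl
    rw [h1, h2, h3]
    simp only [mfld_simps, fderivWithin_univ]
    rw [← toSpanSingleton_deriv]
    simp
    field_simp

end RiemannSphere

end Tangent

lemma tendsto_coe_punctured (z : ℂ) :
    Tendsto ((↑) : ℂ → RiemannSphere) (𝓝[≠] z) (𝓝[≠] (z : RiemannSphere)) := by
  refine tendsto_nhdsWithin_of_tendsto_nhds_of_eventually_within _
    (OnePoint.continuous_coe.continuousAt.tendsto.mono_left nhdsWithin_le_nhds) ?_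
  filter_upwards [self_mem_nhdsWithin] with u hu h
  exact hu (OnePoint.coe_injective h)

lemma tendsto_inv_coe_punctured :
    Tendsto (fun w : ℂ => ((w⁻¹ : ℂ) : RiemannSphere)) (𝓝[≠] 0) (𝓝[≠] OnePoint.infty) := by
  refine tendsto_nhdsWithin_of_tendsto_nhds_of_eventually_within _ ?_
    (Eventually.of_forall fun w => OnePoint.coe_ne_infty _)
  have h := (continuous_ofInv.tendsto 0).mono_left (nhdsWithin_le_nhds (s := {(0 : ℂ)}ᶜ))
  rw [ofInv_zero] at h
  exact h.congr' eventually_ofInv_eq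

/-! ### Matrix entries of a Higgs field -/

section Higgs

variable {F : Type*} [NormedAddCommGroup F] [NormedSpace ℂ F]
  {W : RiemannSphere → Type*} [TopologicalSpace (TotalSpace F W)]
  [∀ x, AddCommGroup (W x)] [∀ x, Module ℂ (W x)] [∀ x, TopologicalSpace (W x)]
  [∀ x, IsTopologicalAddGroup (W x)] [∀ x, ContinuousSMul ℂ (W x)]
  [FiberBundle F W] [VectorBundle ℂ F W] [ContMDiffVectorBundle ω F W 𝓘(ℂ)]
  [FiniteDimensional ℂ F]

lemma IsHolomorphicOneFormAt.apply {Ψ : EndOneForm W} {x : RiemannSphere}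
    (hΨ : IsHolomorphicOneFormAt F Ψ x) {v : ∀ x : RiemannSphere, TangentSpace 𝓘(ℂ) x}
    (hv : ContMDiffAt 𝓘(ℂ) (𝓘(ℂ).prod 𝓘(ℂ)) ω (fun x : RiemannSphere =>
      TotalSpace.mk' ℂ (E := fun x : RiemannSphere => TangentSpace 𝓘(ℂ) x) x (v x)) x)
    {s : ∀ x, W x} (hs : IsHolomorphicSectionAt F s x) :
    IsHolomorphicSectionAt F (fun x => Ψ x (v x) (s x)) x :=
  ContMDiffAt.clm_bundle_apply₂ (F₁ := ℂ) (F₂ := F) (F₃ := F) hΨ hv hs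

namespace IsSplittingFrame

variable {n : ℕ} {s t : Fin n → ∀ x, W x} {d : Fin n → ℤ}

/-- The matrix entries over the plane of a holomorphic one-form are holomorphic. -/
lemma analyticAt_coefficient_coe (h : IsSplittingFrame (F := F) s t d)
    (hn : Module.finrank ℂ F = n) {Ψ : EndOneForm W} {z : ℂ} (hΨ : IsHolomorphicOneFormAt F Ψ z)
    {i : Fin n} {α : Fin n → RiemannSphere → ℂ}
    (hα : ∀ u : ℂ, Ψ u (planeField u) (s i u) = ∑ k, α k u • s k (u : RiemannSphere)) (j : Fin n) :
    AnalyticAt ℂ (fun u : ℂ => α j u) z := by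
  rw [← contMDiffAt_coe_iff]
  refine contMDiffAt_coefficient (f := id) (m := (z : RiemannSphere)) hn
    (hΨ.apply (contMDiffAt_planeField z) (h.holomorphic_coe i z))
    (fun k => h.holomorphic_coe k z) (h.independent_coe z) ?_ j
  filter_upwards [OnePoint.isOpen_range_coe.mem_nhds (mem_range_self z)] with x hx
  obtain ⟨u, rfl⟩ := hx
  exact hα u

/-- The matrix entries at infinity of a holomorphic one-form are holomorphic. -/
lemma analyticAt_coefficient_infty (h : IsSplittingFrame (F := F) s t d)
    (hn : Module.finrank ℂ F = n) {Ψ : EndOneForm W}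
    (hΨ : IsHolomorphicOneFormAt F Ψ OnePoint.infty) {i : Fin n} {β : Fin n → RiemannSphere → ℂ}
    (hβ : ∀ x : RiemannSphere, x ≠ ((0 : ℂ) : RiemannSphere) →
      Ψ x (inftyField x) (t i x) = ∑ k, β k x • t k x) (j : Fin n) :
    AnalyticAt ℂ (fun w => β j (ofInv w)) 0 := by
  rw [← contMDiffAt_infty_iff]
  refine contMDiffAt_coefficient (f := id) (m := (OnePoint.infty : RiemannSphere)) hn
    (hΨ.apply contMDiffAt_inftyField (h.holomorphic_infty i)) h.holomorphic_infty
    h.independent_infty ?_ j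
  filter_upwards [isOpen_ne.mem_nhds (OnePoint.infty_ne_coe (0 : ℂ))] with x hx
  exact hβ x hx

/-- The change of frame for the matrix entries of a one-form. -/
lemma coefficient_inv (h : IsSplittingFrame (F := F) s t d) {Ψ : EndOneForm W} {i : Fin n}
    {α β : Fin n → ℂ} {w : ℂ} (hw : w ≠ 0)
    (hα : Ψ ((w⁻¹ : ℂ) : RiemannSphere) (planeField _) (s i _) =
      ∑ k, α k • s k ((w⁻¹ : ℂ) : RiemannSphere))
    (hβ : Ψ ((w⁻¹ : ℂ) : RiemannSphere) (inftyField _) (t i _) =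
      ∑ k, β k • t k ((w⁻¹ : ℂ) : RiemannSphere)) (j : Fin n) :
    α j = -(w ^ (2 + d j - d i) * β j) := by
  have hw' := inv_ne_zero hw
  -- Changing ∂/∂w to ∂/∂z contributes -z², the source of the 2 in the exponent; changing the frames
  -- contributes `d j - d i`.
  have h1 : inftyField ((w⁻¹ : ℂ) : RiemannSphere) =
      (-(w⁻¹) ^ 2 : ℂ) • planeField ((w⁻¹ : ℂ) : RiemannSphere) := (mul_one (-(w⁻¹) ^ 2 : ℂ)).symm
  have h2 : ∑ k, (-(w⁻¹) ^ 2 * (w⁻¹) ^ (-d i) * α k) • s k ((w⁻¹ : ℂ) : RiemannSphere) =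
      ∑ k, (β k * (w⁻¹) ^ (-d k)) • s k ((w⁻¹ : ℂ) : RiemannSphere) := by
    rw [h1, h.eq_smul _ _ hw', map_smul, map_smul, smul_apply, hα] at hβ
    simp only [h.eq_smul _ _ hw', Finset.smul_sum, smul_smul] at hβ
    convert hβ using 3
    ring
  have h3 := (h.independent_coe w⁻¹).coefficient_unique h2 j
  simp only [inv_zpow', neg_neg] at h3
  have h4 : w ^ (2 + d j - d i) = w ^ (2 : ℤ) * w ^ d j * (w ^ d i)⁻¹ := by
    rw [zpow_sub₀ hw, zpow_add₀ hw, div_eq_mul_inv]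
  rw [h4]
  have h5 : w ^ (2 : ℤ) = w ^ 2 := zpow_natCast w 2
  have h6 := zpow_ne_zero (d i) hw
  rw [h5]
  field_simp at h3 ⊢
  linear_combination -h3

end IsSplittingFrame

end Higgs

/-! ### Vanishing of entries between distant summands -/

section Vanishing

variable {F : Type*} [NormedAddCommGroup F] [NormedSpace ℂ F]
  {W : RiemannSphere → Type*} [TopologicalSpace (TotalSpace F W)]
  [∀ x, AddCommGroup (W x)] [∀ x, Module ℂ (W x)] [∀ x, TopologicalSpace (W x)]
  [∀ x, IsTopologicalAddGroup (W x)] [∀ x, ContinuousSMul ℂ (W x)]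
  [FiberBundle F W] [VectorBundle ℂ F W] [ContMDiffVectorBundle ω F W 𝓘(ℂ)]
  [FiniteDimensional ℂ F]

lemma meromorphicOrderAt_zpow_mul {q : ℂ} {N : ℤ} {f g : ℂ → ℂ} (hg : AnalyticAt ℂ g q)
    (h : ∀ᶠ u in 𝓝[≠] q, f u = (u - q) ^ N * g u) :
    MeromorphicAt f q ∧ (N : WithTop ℤ) ≤ meromorphicOrderAt f q := by
  have hz : MeromorphicAt (fun u : ℂ => (u - q) ^ N) q :=
    ((MeromorphicAt.id q).sub (MeromorphicAt.const q q)).zpow N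
  have hzo : meromorphicOrderAt (fun u : ℂ => (u - q) ^ N) q = (N : WithTop ℤ) :=
    (meromorphicOrderAt_eq_int_iff hz).2 ⟨fun _ => 1, analyticAt_const, one_ne_zero, by simp⟩
  refine ⟨(hz.mul hg.meromorphicAt).congr (h.mono fun u hu => hu.symm), ?_⟩
  rw [meromorphicOrderAt_congr h]
  refine le_trans ?_ (meromorphicOrderAt_mul hz hg.meromorphicAt).ge
  rw [hzo]
  exact le_add_of_nonneg_right hg.meromorphicOrderAt_nonneg

lemma eq_zero_of_eventually_punctured_eq_zero {f : ℂ → ℂ} {q : ℂ} (hf : AnalyticAt ℂ f q)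
    (h : ∀ᶠ u in 𝓝[≠] q, f u = 0) : f q = 0 :=
  tendsto_nhds_unique (hf.continuousAt.tendsto.mono_left nhdsWithin_le_nhds)
    (tendsto_const_nhds.congr' (h.mono fun _ hu => hu.symm))

namespace IsSplittingFrame

variable {n : ℕ} {s t : Fin n → ∀ x, W x} {d : Fin n → ℤ}

/-- The entries of a Higgs field with three simple poles vanish between summands whose degrees
differ by at least two. -/
theorem coefficient_eq_zero (h : IsSplittingFrame (F := F) s t d) (hn : Module.finrank ℂ F = n)
    {D : Finset RiemannSphere} (hD : D.card ≤ 3) {Φ : EndOneForm W}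
    (hΦ : IsParabolicHiggsField F D Φ) {i j : Fin n} (hij : d i + 2 ≤ d j) :
    (∀ z : ℂ, (z : RiemannSphere) ∉ D → ∀ c : Fin n → ℂ,
      Φ z (planeField z) (s i z) = ∑ k, c k • s k (z : RiemannSphere) → c j = 0) ∧
    (OnePoint.infty ∉ D → ∀ c : Fin n → ℂ,
      Φ OnePoint.infty (inftyField OnePoint.infty) (t i OnePoint.infty) =
        ∑ k, c k • t k OnePoint.infty → c j = 0) := by
  classical
  have hA : ∀ Ψ : EndOneForm W, ∃ α : Fin n → RiemannSphere → ℂ,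
      ∀ u : ℂ, Ψ u (planeField u) (s i u) = ∑ k, α k u • s k (u : RiemannSphere) := fun Ψ => by
    obtain ⟨α, hα⟩ := exists_coefficients hn id s fun x => Ψ x (planeField x) (s i x)
    exact ⟨α, fun u => hα u (h.independent_coe u)⟩
  have hB : ∀ Ψ : EndOneForm W, ∃ β : Fin n → RiemannSphere → ℂ,
      ∀ x : RiemannSphere, x ≠ ((0 : ℂ) : RiemannSphere) →
        Ψ x (inftyField x) (t i x) = ∑ k, β k x • t k x := fun Ψ => by
    obtain ⟨β, hβ⟩ := exists_coefficients hn id t fun x => Ψ x (inftyField x) (t i x)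
    exact ⟨β, fun x hx => hβ x (h.linearIndependent_of_ne_zero x hx)⟩
  have hinvne : ∀ w : ℂ, w ≠ 0 → ((w⁻¹ : ℂ) : RiemannSphere) ≠ ((0 : ℂ) : RiemannSphere) :=
    fun w hw e => inv_ne_zero hw (OnePoint.coe_injective e)
  obtain ⟨a, ha⟩ := hA Φ
  set r : ℂ → ℂ := fun u => a j u with hr
  have hholo : ∀ z : ℂ, (z : RiemannSphere) ∉ D → AnalyticAt ℂ r z := fun z hz =>
    h.analyticAt_coefficient_coe hn (hΦ.holomorphic z hz) ha j
  -- The lower bound for the order of the entry: -1 at the permitted poles and 0 elsewhere; the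
  -- frame change at infinity is accounted for separately.
  let ν : RiemannSphere →₀ ℤ :=
    Finsupp.onFinset D (fun x => if x ∈ D then -1 else 0) fun x hx => by
      by_contra hxD
      exact hx (if_neg hxD)
  have hν : ∀ x, ν x = if x ∈ D then -1 else 0 := fun x => rfl
  have hνsum : (ν.sum fun _ m => m) = -D.card := by
    rw [Finsupp.onFinset_sum _ fun _ => rfl]
    simp
  obtain ⟨μ, hμ, hsum⟩ := exists_finsupp_plane ν
  have hord : ∀ z : ℂ, MeromorphicAt r z ∧ (μ z : WithTop ℤ) ≤ meromorphicOrderAt r z := by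
    intro z
    rw [hμ, hν]
    split_ifs with hz
    · obtain ⟨Ψ, hΨ, hΨΦ⟩ := hΦ.simple_pole z hz
      obtain ⟨α, hα⟩ := hA Ψ
      refine meromorphicOrderAt_zpow_mul (h.analyticAt_coefficient_coe hn hΨ hα j) ?_
      filter_upwards [(tendsto_coe_punctured z).eventually hΨΦ, self_mem_nhdsWithin] with u hu huz
      have huz' : u - z ≠ 0 := sub_ne_zero.2 huz
      have h1 : ∑ k, α k u • s k (u : RiemannSphere) =
          ∑ k, ((u - z) * a k u) • s k (u : RiemannSphere) := by
        rw [← hα u, hu, chartAt_coe]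
        simp only [mul_smul, ← Finset.smul_sum, ← ha u]
        rfl
      rw [(h.independent_coe u).coefficient_unique h1 j, zpow_neg_one, inv_mul_cancel_left₀ huz']
    · exact ⟨(hholo z hz).meromorphicAt, (hholo z hz).meromorphicOrderAt_nonneg⟩
  have hord' : MeromorphicAt (fun w => r w⁻¹) 0 ∧
      ((2 + d j - d i + ν OnePoint.infty : ℤ) : WithTop ℤ) ≤
        meromorphicOrderAt (fun w => r w⁻¹) 0 := by
    rw [hν]
    split_ifs with hz
    · obtain ⟨Ψ, hΨ, hΨΦ⟩ := hΦ.simple_pole _ hz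
      obtain ⟨α, hα⟩ := hA Ψ
      obtain ⟨β, hβ⟩ := hB Ψ
      refine meromorphicOrderAt_zpow_mul (h.analyticAt_coefficient_infty hn hΨ hβ j).neg ?_
      filter_upwards [tendsto_inv_coe_punctured.eventually hΨΦ, self_mem_nhdsWithin] with w hw hw0
      have hw0' : w ≠ 0 := hw0
      have h1 : ∑ k, α k (w⁻¹ : ℂ) • s k ((w⁻¹ : ℂ) : RiemannSphere) =
          ∑ k, (w * a k (w⁻¹ : ℂ)) • s k ((w⁻¹ : ℂ) : RiemannSphere) := by
        rw [← hα w⁻¹, hw, chartAt_infty]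
        simp only [mul_smul, ← Finset.smul_sum, ← ha w⁻¹]
        have h2 : inftyChart ((w⁻¹ : ℂ) : RiemannSphere) - inftyChart OnePoint.infty = w :=
          (sub_zero _).trans (inv_inv w)
        rw [h2]
        rfl
      have h3 := h.coefficient_inv hw0' (hα w⁻¹) (hβ _ (hinvne w hw0')) j
      rw [(h.independent_coe w⁻¹).coefficient_unique h1 j] at h3
      simp only [sub_zero, ofInv_of_ne hw0', Pi.neg_apply]
      rw [zpow_add₀ hw0', zpow_neg_one, mul_comm (w ^ _), mul_assoc, eq_inv_mul_iff_mul_eq₀ hw0']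
      exact h3.trans (mul_neg _ _).symm
    · obtain ⟨β, hβ⟩ := hB Φ
      refine meromorphicOrderAt_zpow_mul
        (h.analyticAt_coefficient_infty hn (hΦ.holomorphic _ hz) hβ j).neg ?_
      filter_upwards [self_mem_nhdsWithin] with w hw0
      have hw0' : w ≠ 0 := hw0
      simp only [sub_zero, add_zero, ofInv_of_ne hw0', Pi.neg_apply]
      exact (h.coefficient_inv hw0' (ha w⁻¹) (hβ _ (hinvne w hw0')) j).trans (mul_neg _ _).symm
  -- The order bounds add up to 2 + d j - d i - card D ≥ 4 - 3 > 0.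
  have htop := meromorphicOrderAt_eq_top_of_sum_pos (fun p => (hord p).1) (fun p => (hord p).2)
    hord'.1 hord'.2 (by
      have h1 : (D.card : ℤ) ≤ 3 := by exact_mod_cast hD
      omega)
  have hzero : ∀ z : ℂ, (z : RiemannSphere) ∉ D → a j z = 0 := fun z hz =>
    eq_zero_of_eventually_punctured_eq_zero (hholo z hz) (meromorphicOrderAt_eq_top_iff.1 (htop z))
  refine ⟨fun z hz c hc => ?_, fun hinf c hc => ?_⟩
  · rw [← hzero z hz]
    exact (h.independent_coe z).coefficient_unique (hc.symm.trans (ha z)) j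
  · obtain ⟨β, hβ⟩ := hB Φ
    have h1 : c j = β j OnePoint.infty := h.independent_infty.coefficient_unique
      (hc.symm.trans (hβ _ (OnePoint.infty_ne_coe _))) j
    have h2 := h.analyticAt_coefficient_infty hn (hΦ.holomorphic _ hinf) hβ j
    have hDc : ∀ᶠ x in 𝓝 (OnePoint.infty : RiemannSphere), x ∉ D :=
      D.finite_toSet.isClosed.isOpen_compl.mem_nhds hinf
    -- At infinity the entry vanishes by continuity, as the finite set `D` leaves a neighbourhood of
    -- infinity free.
    have h3 := eq_zero_of_eventually_punctured_eq_zero h2 (by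
      filter_upwards [tendsto_inv_coe_punctured.eventually (hDc.filter_mono nhdsWithin_le_nhds),
        self_mem_nhdsWithin] with w hw hw0
      have hw0' : w ≠ 0 := hw0
      have h4 := h.coefficient_inv hw0' (ha w⁻¹) (hβ _ (hinvne w hw0')) j
      rw [hzero _ hw, eq_comm, neg_eq_zero, mul_eq_zero] at h4
      rw [ofInv_of_ne hw0']
      exact h4.resolve_left (zpow_ne_zero _ hw0'))
    rw [ofInv_zero] at h3
    rw [h1, h3]

end IsSplittingFrame

end Vanishing

/-! ### Subbundles spanned by summands, and stability -/

section Subbundle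

variable {F : Type*} [NormedAddCommGroup F] [NormedSpace ℂ F]
  {W : RiemannSphere → Type*} [TopologicalSpace (TotalSpace F W)]
  [∀ x, AddCommGroup (W x)] [∀ x, Module ℂ (W x)] [∀ x, TopologicalSpace (W x)]
  [FiberBundle F W]

open Classical in
/-- The frame `s` over the plane, together with the frame `t` at infinity. -/
noncomputable def frameAt {ι : Type*} (s t : ι → ∀ x, W x) (i : ι) (x : RiemannSphere) : W x :=
  if x = OnePoint.infty then t i x else s i x

lemma frameAt_coe {ι : Type*} (s t : ι → ∀ x, W x) (i : ι) (z : ℂ) :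
    frameAt s t i (z : RiemannSphere) = s i z :=
  if_neg (OnePoint.coe_ne_infty z)

lemma frameAt_infty {ι : Type*} (s t : ι → ∀ x, W x) (i : ι) :
    frameAt s t i OnePoint.infty = t i OnePoint.infty :=
  if_pos rfl

/-- The family of subspaces spanned by the members of a splitting frame with indices in the range
of `φ`. -/
noncomputable def frameSpan {ι κ : Type*} (s t : ι → ∀ x, W x) (φ : κ → ι) (x : RiemannSphere) :
    Submodule ℂ (W x) :=
  Submodule.span ℂ (range fun i => frameAt s t (φ i) x)

variable [VectorBundle ℂ F W] [ContMDiffVectorBundle ω F W 𝓘(ℂ)] [FiniteDimensional ℂ F]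

namespace IsSplittingFrame

variable {n k : ℕ} {s t : Fin n → ∀ x, W x} {d : Fin n → ℤ} {φ : Fin k → Fin n}

lemma linearIndependent_frameAt (h : IsSplittingFrame (F := F) s t d) (x : RiemannSphere) :
    LinearIndependent ℂ fun i => frameAt s t i x := by
  induction x using OnePoint.rec with
  | infty => simpa only [frameAt_infty] using h.independent_infty
  | coe z => simpa only [frameAt_coe] using h.independent_coe z

lemma isHolomorphicFrameOn_plane (h : IsSplittingFrame (F := F) s t d)
    (hφ : Function.Injective φ) :
    IsHolomorphicFrameOn F W (frameSpan s t φ) {OnePoint.infty}ᶜ fun i => s (φ i) where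
  holomorphic i x hx := by
    induction x using OnePoint.rec with
    | infty => exact absurd rfl hx
    | coe z => exact ContMDiffAt.contMDiffWithinAt (h.holomorphic_coe (φ i) z)
  linearIndependent x hx := by
    induction x using OnePoint.rec with
    | infty => exact absurd rfl hx
    | coe z => exact (h.independent_coe z).comp φ hφ
  span_eq x hx := by
    induction x using OnePoint.rec with
    | infty => exact absurd rfl hx
    | coe z => simp only [frameSpan, frameAt_coe]

lemma isHolomorphicFrameOn_infty (h : IsSplittingFrame (F := F) s t d)
    (hφ : Function.Injective φ) :
    IsHolomorphicFrameOn F W (frameSpan s t φ) {((0 : ℂ) : RiemannSphere)}ᶜ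
      fun i => t (φ i) where
  holomorphic i x hx := ContMDiffAt.contMDiffWithinAt (h.holomorphic_of_ne_zero (φ i) hx)
  linearIndependent x hx := (h.linearIndependent_of_ne_zero x hx).comp φ hφ
  span_eq x hx := by
    induction x using OnePoint.rec with
    | infty => simp only [frameSpan, frameAt_infty]
    | coe z =>
      have hz : z ≠ 0 := fun e => hx (congrArg _ e)
      simp only [frameSpan, frameAt_coe, h.eq_smul _ z hz]
      refine le_antisymm (Submodule.span_le.2 ?_) (Submodule.span_le.2 ?_)
      · rintro _ ⟨i, rfl⟩
        exact Submodule.smul_mem _ _ (Submodule.subset_span ⟨i, rfl⟩)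
      · rintro _ ⟨i, rfl⟩
        have h1 := Submodule.smul_mem (Submodule.span ℂ (range fun i : Fin k =>
          z ^ (-d (φ i)) • s (φ i) (z : RiemannSphere))) (z ^ d (φ i))
          (Submodule.subset_span ⟨i, rfl⟩)
        rwa [smul_smul, ← zpow_add₀ hz, add_neg_cancel, zpow_zero, one_smul] at h1

lemma isHolomorphicSubbundle_frameSpan (h : IsSplittingFrame (F := F) s t d)
    (hφ : Function.Injective φ) : IsHolomorphicSubbundle F W k (frameSpan s t φ) := by
  intro x
  induction x using OnePoint.rec with
  | infty => exact ⟨_, isOpen_compl_singleton, OnePoint.infty_ne_coe 0, _,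
      h.isHolomorphicFrameOn_infty hφ⟩
  | coe z => exact ⟨_, isOpen_compl_singleton, OnePoint.coe_ne_infty z, _,
      h.isHolomorphicFrameOn_plane hφ⟩

/-- The form dual to the plane frame has value 1 on that frame and w^(∑ d) on the frame at infinity,
so infinity carries its whole divisor. -/
lemma hasDegree_frameSpan (h : IsSplittingFrame (F := F) s t d) (hn : Module.finrank ℂ F = n)
    (hφ : Function.Injective φ) :
    HasDegree F W k (frameSpan s t φ) (-∑ i, d (φ i)) := by
  let b : ∀ x, Module.Basis (Fin n) ℂ (W x) := fun x =>
    Module.Basis.mk (h.linearIndependent_frameAt x)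
      (linearIndependent_span_eq_top hn (h.linearIndependent_frameAt x)).ge
  have hb : ∀ x i, b x i = frameAt s t i x := fun x i => Module.Basis.mk_apply _ _ i
  let η : ∀ x, W x [⋀^Fin k]→ₗ[ℂ] ℂ := fun x =>
    (Matrix.detRowAlternating (R := ℂ) (n := Fin k)).compLinearMap
      (LinearMap.pi fun i => (b x).coord (φ i))
  have hη : ∀ x, η x (fun i => frameAt s t (φ i) x) = 1 := by
    intro x
    have h1 : (fun i => LinearMap.pi (fun j => (b x).coord (φ j)) (frameAt s t (φ i) x)) =
        (1 : Matrix (Fin k) (Fin k) ℂ) := by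
      funext i j
      rw [LinearMap.pi_apply, ← hb, Module.Basis.coord_apply, Module.Basis.repr_self,
        Finsupp.single_apply, Matrix.one_apply]
      simp only [hφ.eq_iff]
    exact (congrArg Matrix.det h1).trans Matrix.det_one
  refine ⟨η, Finsupp.single OnePoint.infty (∑ i, d (φ i)), fun p => ?_, ?_⟩
  · induction p using OnePoint.rec with
    | infty =>
      refine ⟨_, isOpen_compl_singleton, OnePoint.infty_ne_coe 0, _,
        h.isHolomorphicFrameOn_infty hφ, ?_⟩
      rw [chartAt_infty, Finsupp.single_eq_same]
      have hp : ∀ w : ℂ, w ≠ 0 → ∀ S : Finset (Fin k),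
          ∏ i ∈ S, w ^ d (φ i) = w ^ ∑ i ∈ S, d (φ i) := by
        intro w hw S
        induction S using Finset.induction_on with
        | empty => simp
        | insert i S hi ih =>
          rw [Finset.prod_insert hi, Finset.sum_insert hi, ih, zpow_add₀ hw]
      have hev : ∀ᶠ w in 𝓝[≠] (0 : ℂ), η (ofInv w) (fun i => t (φ i) (ofInv w)) =
          (w - 0) ^ (∑ i, d (φ i)) • (fun _ : ℂ => (1 : ℂ)) w := by
        filter_upwards [self_mem_nhdsWithin] with w hw
        have hw' : w ≠ 0 := hw
        rw [ofInv_of_ne hw']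
        simp only [h.eq_smul _ _ (inv_ne_zero hw'), inv_zpow', neg_neg]
        have h1 := hη ((w⁻¹ : ℂ) : RiemannSphere)
        simp only [frameAt_coe] at h1
        rw [AlternatingMap.map_smul_univ, h1, hp w hw', sub_zero]
      have hm : MeromorphicAt (fun w => η (ofInv w) fun i => t (φ i) (ofInv w)) 0 := by
        exact (((MeromorphicAt.id 0).sub (MeromorphicAt.const 0 0)).zpow
          (∑ i, d (φ i))).congr (hev.mono fun w hw => (hw.trans (mul_one _)).symm)
      exact ⟨hm, (meromorphicOrderAt_eq_int_iff hm).2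
        ⟨fun _ => 1, analyticAt_const, one_ne_zero, hev⟩⟩
    | coe z =>
      refine ⟨_, isOpen_compl_singleton, OnePoint.coe_ne_infty z, _,
        h.isHolomorphicFrameOn_plane hφ, ?_⟩
      have hc : (fun u => η ((chartAt ℂ (z : RiemannSphere)).symm u) fun i =>
          s (φ i) ((chartAt ℂ (z : RiemannSphere)).symm u)) = fun _ => 1 := by
        funext u
        rw [chartAt_coe]
        have h1 := hη (u : RiemannSphere)
        simp only [frameAt_coe] at h1
        exact h1
      rw [hc, Finsupp.single_eq_of_ne (OnePoint.coe_ne_infty z)]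
      exact ⟨MeromorphicAt.const 1 _, (meromorphicOrderAt_eq_int_iff (MeromorphicAt.const 1 _)).2
        ⟨fun _ => 1, analyticAt_const, one_ne_zero, by simp⟩⟩
  · rw [Finsupp.sum_single_index rfl]

variable [∀ x, IsTopologicalAddGroup (W x)] [∀ x, ContinuousSMul ℂ (W x)]

/-- The hypothesis on the gaps makes every entry of `Φ` leading out of the span vanish. -/
lemma isInvariantSubbundle_frameSpan (h : IsSplittingFrame (F := F) s t d)
    (hn : Module.finrank ℂ F = n) {D : Finset RiemannSphere} (hD : D.card ≤ 3) {Φ : EndOneForm W}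
    (hΦ : IsParabolicHiggsField F D Φ) (hd : ∀ i, ∀ j ∉ range φ, d (φ i) + 2 ≤ d j) :
    IsInvariantSubbundle D Φ (frameSpan s t φ) := by
  have key : ∀ x : RiemannSphere, ∀ v : Fin n → W x, ∀ y : Fin n → W x, LinearIndependent ℂ v →
      (∀ i, ∀ j ∉ range φ, ∀ c : Fin n → ℂ, y (φ i) = ∑ k, c k • v k → c j = 0) →
      ∀ i, y (φ i) ∈ Submodule.span ℂ (range fun i => v (φ i)) := by
    intro x v y hv hy i
    have h1 : y (φ i) ∈ Submodule.span ℂ (range v) := by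
      rw [linearIndependent_span_eq_top hn hv]
      exact Submodule.mem_top
    obtain ⟨c, hc⟩ := (Submodule.mem_span_range_iff_exists_fun ℂ).1 h1
    rw [← hc]
    refine Submodule.sum_mem _ fun j _ => ?_
    by_cases hj : j ∈ range φ
    · obtain ⟨l, rfl⟩ := hj
      exact Submodule.smul_mem _ _ (Submodule.subset_span ⟨l, rfl⟩)
    · rw [hy i j hj c hc.symm, zero_smul]
      exact Submodule.zero_mem _
  intro x hx v w hw
  -- Tangent spaces are lines, so one coordinate vector at each point suffices.
  obtain ⟨v₀, hv₀⟩ : ∃ v₀ : TangentSpace 𝓘(ℂ) x, (∃ c : ℂ, v = c • v₀) ∧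
      ∀ i, Φ x v₀ (frameAt s t (φ i) x) ∈ frameSpan s t φ x := by
    induction x using OnePoint.rec with
    | infty =>
      refine ⟨inftyField OnePoint.infty, ⟨(v : ℂ), (mul_one (M := ℂ) v).symm⟩, ?_⟩
      simp only [frameSpan, frameAt_infty]
      exact key _ (fun i => t i OnePoint.infty) (fun i => Φ OnePoint.infty (inftyField _) (t i _))
        h.independent_infty fun i j hj c hc =>
          (h.coefficient_eq_zero hn hD hΦ (hd i j hj)).2 hx c hc
    | coe z =>
      refine ⟨planeField z, ⟨(v : ℂ), (mul_one (M := ℂ) v).symm⟩, ?_⟩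
      simp only [frameSpan, frameAt_coe]
      exact key _ (fun i => s i z) (fun i => Φ z (planeField _) (s i _))
        (h.independent_coe z) fun i j hj c hc =>
          (h.coefficient_eq_zero hn hD hΦ (hd i j hj)).1 z hx c hc
  obtain ⟨⟨c, rfl⟩, hmem⟩ := hv₀
  rw [map_smul, smul_apply]
  refine Submodule.smul_mem _ _ ?_
  have hle : frameSpan s t φ x ≤ (frameSpan s t φ x).comap (Φ x v₀ : W x →ₗ[ℂ] W x) := by
    refine Submodule.span_le.2 ?_
    rintro _ ⟨i, rfl⟩
    exact hmem i
  exact hle hw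

/-- For a stable Higgs bundle with three poles, a sum of summands whose degrees exceed all others
by at least two has negative degree. -/
lemma sum_pos_of_stable (h : IsSplittingFrame (F := F) s t d) (hn : Module.finrank ℂ F = n)
    {D : Finset RiemannSphere} (hD : D.card ≤ 3) {Φ : EndOneForm W}
    (hΦ : IsParabolicHiggsField F D Φ) (hstable : IsStableHiggs F D Φ)
    (hφ : Function.Injective φ) (hk : 0 < k) (hkn : k < n)
    (hd : ∀ i, ∀ j ∉ range φ, d (φ i) + 2 ≤ d j) : 0 < ∑ i, d (φ i) := by
  have h1 := hstable k (frameSpan s t φ) _ hk (hn ▸ hkn) (h.isHolomorphicSubbundle_frameSpan hφ)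
    (h.isInvariantSubbundle_frameSpan hn hD hΦ hd) (h.hasDegree_frameSpan hn hφ)
  omega

end IsSplittingFrame

end Subbundle

/-! ### The splitting type of a stable Higgs bundle -/

lemma IsSplittingFrame.isomorphic_sumO
    {F : Type*} [NormedAddCommGroup F] [NormedSpace ℂ F]
    {W : RiemannSphere → Type*} [TopologicalSpace (TotalSpace F W)]
    [∀ x, AddCommGroup (W x)] [∀ x, Module ℂ (W x)] [∀ x, TopologicalSpace (W x)]
    [FiberBundle F W] [VectorBundle ℂ F W] [ContMDiffVectorBundle ω F W 𝓘(ℂ)]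
    [FiniteDimensional ℂ F] {s t : Fin 3 → ∀ x, W x} {d : Fin 3 → ℤ}
    (h : IsSplittingFrame (F := F) s t d) (hF : Module.finrank ℂ F = 3) {a b c : ℤ}
    (ha : d 0 = -a) (hb : d 1 = -b) (hc : d 2 = -c) :
    HolomorphicallyIsomorphic F W (ℂ × ℂ × ℂ) (SumO a b c) := by
  have hd : d = ![-a, -b, -c] := by
    funext i
    fin_cases i
    exacts [ha, hb, hc]
  subst hd
  exact h.holomorphicallyIsomorphic (isSplittingFrame_summandSections a b c) hF (by simp)

theorem mainTheorem10
    (F : Type*) [NormedAddCommGroup F] [NormedSpace ℂ F] (hF : Module.finrank ℂ F = 3)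
    (W : RiemannSphere → Type*) [TopologicalSpace (TotalSpace F W)]
    [∀ x, AddCommGroup (W x)] [∀ x, Module ℂ (W x)] [∀ x, TopologicalSpace (W x)]
    [∀ x, IsTopologicalAddGroup (W x)] [∀ x, ContinuousSMul ℂ (W x)]
    [FiberBundle F W] [VectorBundle ℂ F W] [ContMDiffVectorBundle ω F W 𝓘(ℂ)]
    (D : Finset RiemannSphere) (hD : D.card = 3)
    (Φ : EndOneForm W) (hΦ : IsParabolicHiggsField F D Φ)
    (hdeg : HasDegree F W 3 (fun _ => ⊤) 0)
    (hstable : IsStableHiggs F D Φ) :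
    HolomorphicallyIsomorphic F W (ℂ × ℂ × ℂ) (RiemannSphere.SumO 0 0 0) ∨
      HolomorphicallyIsomorphic F W (ℂ × ℂ × ℂ) (RiemannSphere.SumO (-1) 0 1) := by
  have : FiniteDimensional ℂ F := Module.finite_of_finrank_pos (by omega)
  obtain ⟨s₀, t₀, d₀, h₀, hsum₀⟩ := exists_isSplittingFrame W hF hdeg
  -- Increasing `d` means decreasing degrees -d, so initial summands are the candidates for
  -- destabilizing.
  obtain ⟨s, t, d, h, hsum, hmono⟩ : ∃ (s t : Fin 3 → ∀ x, W x) (d : Fin 3 → ℤ),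
      IsSplittingFrame (F := F) s t d ∧ ∑ i, d i = 0 ∧ Monotone d :=
    ⟨_, _, _, h₀.reindex (Tuple.sort d₀), by
      rw [Equiv.sum_comp (Tuple.sort d₀) d₀, hsum₀, neg_zero], Tuple.monotone_sort d₀⟩
  have h01 : d 0 ≤ d 1 := hmono (by decide)
  have h12 : d 1 ≤ d 2 := hmono (by decide)
  rw [Fin.sum_univ_three] at hsum
  -- The first summand would be invariant; but the least of three integers with sum zero is never
  -- positive.
  have hgap1 : d 0 + 2 ≤ d 1 → 0 < d 0 := by
    intro hle
    have hpos := h.sum_pos_of_stable (k := 1) (φ := ![0]) hF hD.le hΦ hstable (by decide)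
      (by decide) (by decide) (by
        intro i j hj
        fin_cases i
        fin_cases j
        · exact absurd ⟨0, rfl⟩ hj
        · exact hle
        · exact hle.trans h12)
    simpa using hpos
  -- The first two summands would be invariant; but d₀ + d₁ = -d₂, and the largest of three integers
  -- with sum zero is never negative.
  have hgap2 : d 1 + 2 ≤ d 2 → 0 < d 0 + d 1 := by
    intro hle
    have hpos := h.sum_pos_of_stable (k := 2) (φ := ![0, 1]) hF hD.le hΦ hstable (by decide)
      (by decide) (by decide) (by
        intro i j hj
        fin_cases j
        · exact absurd ⟨0, rfl⟩ hj
        · exact absurd ⟨1, rfl⟩ hj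
        · fin_cases i
          · exact (add_le_add_left h01 2).trans hle
          · exact hle)
    simpa using hpos
  -- Both gaps are at most one; gaps (0, 1) and (1, 0) give a sum not divisible by 3, leaving (0, 0)
  -- and (1, 1).
  obtain ⟨h0, h1, h2⟩ | ⟨h0, h1, h2⟩ : (d 0 = 0 ∧ d 1 = 0 ∧ d 2 = 0) ∨
      (d 0 = -1 ∧ d 1 = 0 ∧ d 2 = 1) := by omega
  · exact Or.inl (h.isomorphic_sumO hF h0 h1 h2)
  -- The order is reversed because 𝒪(-1), the summand with `d = 1`, is listed first.
  · exact Or.inr ((h.reindex Fin.revPerm).isomorphic_sumO hF h2 h1 h0)
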